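/- Let $\mathcal C$ be an arrangement of finitely many distinct affine hyperplanes $H_j$ ($j\in J$) in $X=\mathbb C^N$, and let $X^0=X\setminus\bigcup_j H_j$. The vertices $\alpha$ of its graph $\Gamma$ are the strata $X_\alpha$; their closures $\overline X_\alpha$ are the non-empty intersections of hyperplanes of $\mathcal C$ (including $X$ itself, the closure of the open stratum $X_\emptyset=X^0$). Put $l(\alpha)=\operatorname{codim}\overline X_\alpha$, and write $\alpha\succ\beta$ if $\overline X_\alpha\supset\overline X_\beta$ with codimension $1$; $\alpha,\beta$ are adjacent if $\alpha\succ\beta$ or $\beta\succ\alpha$. Put $\varepsilon(\alpha,\beta)=1,-1,0$ according to whether $\alpha\succ\beta$, $\beta\succ\alpha$, or neither. *Quivers.* A quiver $\mathcal V=\{V_\alpha,A_{\alpha,\beta}\}$ of $\Gamma$ consists of finite-dimensional complex vector spaces $V_\alpha$ and linear maps $A_{\alpha,\beta}:V_\beta\to V_\alpha$ such that $A_{\alpha,\beta}=0$ if $\alpha,\beta$ are not adjacent, and $\sum_\beta A_{\alpha,\beta}A_{\beta,\gamma}=0$ whenever $|l(\alpha)-l(\gamma)|=2$, or $l(\alpha)=l(\gamma)$,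 $\alpha\ne\gamma$ and there is $\delta$ with $\alpha\succ\delta$, $\gamma\succ\delta$. Its dual is $\tau(\mathcal V)=\{V_\alpha^*,\ \varepsilon(\beta,\alpha)A_{\beta,\alpha}^*\}$. A level zero quiver $\mathcal V_{\Gamma^0}=\{V,A^j\}$ consists of a finite-dimensional complex vector space $V$ and $A^j\in\operatorname{End}V$ ($j\in J$) with $[A^j,\sum_{i:\,H_i\supset\overline X_\gamma}A^i]=0$ whenever $l(\gamma)=2$ and $H_j\supset\overline X_\gamma$. Its dual is $\tau(\mathcal V_{\Gamma^0})=\{V^*,-(A^j)^*\}$. *Quiver $\mathcal D$-modules.* Let $F_\alpha$ be the space of affine functions vanishing on $X_\alpha$, $T_\alpha$ the space of constant vector fields parallel to $X_\alpha$, $\overline\Omega_\alpha$ the line of translation-invariant top forms on $X_\alpha$, and $\langle\xi,f\rangle=\xi(f)$. Fix, for each $\alpha\succ\beta$, some $f_{\beta,\alpha}\in F_\beta\setminus F_\alpha$ and $\xi_{\alpha,\beta}\in T_\alpha\setminus T_\beta$, and let $\pi_{\beta,\alpha}:\overline\Omega_\alpha\to\overline\Omega_\beta$ and $\pi_{\alpha,\beta}:\overline\Omega_\beta\to\overline\Omega_\alpha$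 be given by $\pi_{\beta,\alpha}(\omega)=\omega'\Leftrightarrow df_{\beta,\alpha}\wedge\omega'=\omega$ and $\pi_{\alpha,\beta}(\omega')=\omega\Leftrightarrow i_{\xi_{\alpha,\beta}}(\omega)=\omega'$ (where in the second condition $i_{\xi_{\alpha,\beta}}(\omega)$ is restricted to $X_\beta$). Then $E\mathcal V$ is the $\mathcal D_X$-module generated by $\bigoplus_\alpha\overline\Omega_\alpha\otimes V_\alpha$ with the relations, for all $\alpha$, $\overline\omega\in\overline\Omega_\alpha$, $v\in V_\alpha$, $$\xi(\overline\omega\otimes v)=\sum_{\beta:\,\alpha\succ\beta}\langle\xi,f_{\beta,\alpha}\rangle\,\pi_{\beta,\alpha}(\overline\omega)\otimes A_{\beta,\alpha}v\ \ (\xi\in T_\alpha),\qquad f(\overline\omega\otimes v)=\sum_{\beta:\,\beta\succ\alpha}\langle\xi_{\beta,\alpha},f\rangle\,\pi_{\beta,\alpha}(\overline\omega)\otimes A_{\beta,\alpha}v\ \ (f\in F_\alpha).$$ For equations $f_j=0$ of the $H_j$, $E^0\mathcal V_{\Gamma^0}$ is the $\mathcal D_{X^0}$-module generated by $\overline\Omega_\emptyset\otimes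 V$ with the relations $\xi(\overline\omega\otimes v)=\sum_j\frac{\langle\xi,f_j\rangle}{f_j}\,\overline\omega\otimes A^jv$ for all constant vector fields $\xi$. *Duality.* For a smooth affine variety $Y$ let $\Omega_Y$ be the sheaf of top forms and $\widetilde{\mathcal D}_Y=\mathcal D_Y\otimes_{\mathcal O_Y}\Omega_Y^{-1}$, with two commuting left $\mathcal D_Y$-module structures: the first is $f\cdot(d\otimes\tilde\omega)=df\otimes\tilde\omega$, $\xi\cdot(d\otimes\tilde\omega)=-d\xi\otimes\tilde\omega+d\otimes\mathrm{Lie}_\xi\tilde\omega$ for functions $f$ and vector fields $\xi$; the second is left multiplication on $\mathcal D_Y$. Put $\Delta_YM=R\mathrm{Hom}_{\mathcal D_Y}(M,\widetilde{\mathcal D}_Y)[\dim Y]$, where Hom uses the first structure and the second one makes it a complex of left $\mathcal D_Y$-modules. (As $X$ and $X^0$ are affine, coherent $\mathcal D$-modules on them are identified with finitely generated modules over the ring of global algebraic differential operators.) **Theorem.** (i) For every level zero quiver $\mathcal V_{\Gamma^0}$, $\Delta_{X^0}(E^0\mathcal V_{\Gamma^0})$ has cohomology only in degree $0$, and $H^0(\Delta_{X^0}(E^0\mathcal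 V_{\Gamma^0}))\cong E^0(\tau(\mathcal V_{\Gamma^0}))$ as $\mathcal D_{X^0}$-modules. (ii) For every quiver $\mathcal V$ of $\Gamma$, $\Delta_X(E\mathcal V)$ has cohomology only in degree $0$, and $H^0(\Delta_X(E\mathcal V))\cong E(\tau(\mathcal V))$ as $\mathcal D_X$-modules. -/

import Mathlib

noncomputable section

open CategoryTheory TensorProduct Module

namespace QuiverDMod

/-! ### Differential operators and holonomic duality on a smooth affine variety

A smooth affine complex variety `Y` enters through its coordinate ring `O`.  A coherent module over
the sheaf of differential operators on an affine variety is the same thing as a finitely generated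
module over the ring of its global sections, and we work with the latter. -/

section Duality

variable (O : Type) [CommRing O] [Algebra ℂ O]

/-- The ring of algebraic differential operators on `Y`: the algebra of operators on `O`
generated by the functions and the vector fields (derivations). -/
def diffOps : Subalgebra ℂ (Module.End ℂ O) :=
  Algebra.adjoin ℂ (Set.range (fun f : O => LinearMap.mulLeft ℂ f) ∪
    Set.range (fun ξ : Derivation ℂ O O => (ξ : O →ₗ[ℂ] O)))

/-- The ring of algebraic differential operators on `Y`, as a type. -/
def DOp : Type := diffOps O

instance : Ring (DOp O) := inferInstanceAs (Ring (diffOps O))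

instance : Algebra ℂ (DOp O) := inferInstanceAs (Algebra ℂ (diffOps O))

variable {O}

/-- A function, as a differential operator. -/
def DOp.fn (f : O) : DOp O :=
  ⟨LinearMap.mulLeft ℂ f, Algebra.subset_adjoin (Or.inl ⟨f, rfl⟩)⟩

/-- A vector field, as a differential operator. -/
def DOp.vf (ξ : Derivation ℂ O O) : DOp O :=
  ⟨(ξ : O →ₗ[ℂ] O), Algebra.subset_adjoin (Or.inr ⟨ξ, rfl⟩)⟩

theorem DOp.fn_one : DOp.fn (1 : O) = 1 := by
  apply Subtype.ext; ext g; exact one_mul g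

theorem DOp.fn_zero : DOp.fn (0 : O) = 0 := by
  apply Subtype.ext; ext g; exact zero_mul g

theorem DOp.fn_mul (f g : O) : DOp.fn (f * g) = DOp.fn f * DOp.fn g := by
  apply Subtype.ext; ext h; exact mul_assoc f g h

theorem DOp.fn_add (f g : O) : DOp.fn (f + g) = DOp.fn f + DOp.fn g := by
  apply Subtype.ext; ext h; exact add_mul f g h

theorem DOp.vf_mul_fn (ξ : Derivation ℂ O O) (f : O) :
    DOp.vf ξ * DOp.fn f = DOp.fn f * DOp.vf ξ + DOp.fn (ξ f) := by
  apply Subtype.ext; ext h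
  change ξ (f * h) = f * ξ h + ξ f * h
  simp [mul_comm]

variable (O) in
/-- The ring of differential operators with its *right* `O`-module structure `f • d = d f`
and its left module structure over itself. -/
def DOpR : Type := DOp O

instance : AddCommGroup (DOpR O) := inferInstanceAs (AddCommGroup (DOp O))

instance : Module (DOp O) (DOpR O) := inferInstanceAs (Module (DOp O) (DOp O))

/-- A differential operator regarded as an element of `DOpR O`. -/
def DOpR.of (d : DOp O) : DOpR O := d

/-- An element of `DOpR O` regarded as a differential operator. -/
def DOpR.out (d : DOpR O) : DOp O := d

instance : Module O (DOpR O) where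
  smul f d := DOpR.of (d.out * DOp.fn f)
  one_smul d := by
    change DOpR.out d * DOp.fn 1 = DOpR.out d
    rw [DOp.fn_one, mul_one]
  mul_smul f g d := by
    change DOpR.out d * DOp.fn (f * g) = DOpR.out d * DOp.fn g * DOp.fn f
    rw [mul_comm f g, DOp.fn_mul, mul_assoc]
  smul_zero f := by
    change (0 : DOp O) * DOp.fn f = 0
    rw [zero_mul]
  smul_add f d e := by
    change (DOpR.out d + DOpR.out e) * DOp.fn f = _
    rw [add_mul]; rfl
  add_smul f g d := by
    change DOpR.out d * DOp.fn (f + g) = _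
    rw [DOp.fn_add, mul_add]; rfl
  zero_smul d := by
    change DOpR.out d * DOp.fn 0 = 0
    rw [DOp.fn_zero, mul_zero]

theorem DOpR.smul_def (f : O) (d : DOpR O) : f • d = DOpR.of (d.out * DOp.fn f) := rfl

instance : SMulCommClass O (DOp O) (DOpR O) where
  smul_comm f d e := by
    change d * DOpR.out e * DOp.fn f = d * (DOpR.out e * DOp.fn f)
    rw [mul_assoc]

instance : SMulCommClass (DOp O) O (DOpR O) := SMulCommClass.symm _ _ _

variable (O) in
/-- Top differential forms on the `n`-dimensional variety `Y`:
alternating `O`-multilinear functions of `n` vector fields. -/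
abbrev TopForm (n : ℕ) : Type := (Derivation ℂ O O) [⋀^Fin n]→ₗ[O] O

theorem lieForm_aux {n : ℕ} (ξ : Derivation ℂ O O) (ω : TopForm O n)
    (m : Fin n → Derivation ℂ O O) (i : Fin n) (z : Derivation ℂ O O) :
    ∑ j, ω (Function.update (Function.update m i z) j ⁅ξ, Function.update m i z j⁆) =
      ω (Function.update m i ⁅ξ, z⁆) +
      ∑ j ∈ Finset.univ.erase i, ω (Function.update (Function.update m j ⁅ξ, m j⁆) i z) := by
  rw [← Finset.add_sum_erase _ _ (Finset.mem_univ i)]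
  congr 1
  · simp
  · refine Finset.sum_congr rfl fun j hj => ?_
    have hji : j ≠ i := Finset.ne_of_mem_erase hj
    rw [Function.update_of_ne hji, Function.update_comm hji]

theorem lie_smul_der (ξ θ : Derivation ℂ O O) (f : O) : ⁅ξ, f • θ⁆ = ξ f • θ + f • ⁅ξ, θ⁆ := by
  ext g
  simp [Derivation.commutator_apply]
  ring

/-- The Lie derivative of a top form:
`(Lie_ξ ω)(θ₁,…,θₙ) = ξ(ω(θ₁,…,θₙ)) - ∑ᵢ ω(θ₁,…,[ξ,θᵢ],…,θₙ)`. -/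
def lieForm {n : ℕ} (ξ : Derivation ℂ O O) (ω : TopForm O n) : TopForm O n where
  toFun θ := ξ (ω θ) - ∑ i, ω (Function.update θ i ⁅ξ, θ i⁆)
  map_update_add' := by
    intro inst m i x y
    obtain rfl : inst = instDecidableEqFin n := Subsingleton.elim _ _
    simp only [lieForm_aux, lie_add, AlternatingMap.map_update_add, map_add,
      Finset.sum_add_distrib]
    abel
  map_update_smul' := by
    intro inst m i f x
    obtain rfl : inst = instDecidableEqFin n := Subsingleton.elim _ _
    simp only [lieForm_aux, lie_smul_der, AlternatingMap.map_update_add,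
      AlternatingMap.map_update_smul, smul_eq_mul, Derivation.leibniz,
      ← Finset.mul_sum]
    ring
  map_eq_zero_of_eq' := by
    intro v i j hij hne
    have h0 : ω v = 0 := ω.map_eq_zero_of_eq v hij hne
    have hswap : Function.update v j ⁅ξ, v j⁆ =
        Function.update v i ⁅ξ, v i⁆ ∘ Equiv.swap i j := by
      funext k
      rcases eq_or_ne k j with rfl | hkj
      · simp [hij]
      · rcases eq_or_ne k i with rfl | hki
        · simp [Function.update_of_ne hne, Function.update_of_ne hne.symm, hij]
        · simp [Equiv.swap_apply_of_ne_of_ne hki hkj, Function.update_of_ne hki,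
            Function.update_of_ne hkj]
    have hs : ∑ k, ω (Function.update v k ⁅ξ, v k⁆) = 0 := by
      rw [Finset.sum_eq_add i j hne]
      · rw [hswap, ω.map_swap _ hne, add_neg_cancel]
      · intro k _ hk
        exact ω.map_eq_zero_of_eq _
          (by rw [Function.update_of_ne hk.1.symm, Function.update_of_ne hk.2.symm, hij]) hne
      · simp
      · simp
    rw [h0, hs, map_zero, sub_zero]

theorem lieForm_apply {n : ℕ} (ξ : Derivation ℂ O O) (ω : TopForm O n)
    (θ : Fin n → Derivation ℂ O O) :
    lieForm ξ ω θ = ξ (ω θ) - ∑ i, ω (Function.update θ i ⁅ξ, θ i⁆) := rfl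

variable (O) in
/-- Sections of the inverse `Ω_Y⁻¹` of the sheaf of top forms. -/
abbrev InvTopForm (n : ℕ) : Type := Module.Dual O (TopForm O n)

/-- The Lie derivative on `Ω_Y⁻¹`, determined by `ξ⟨ψ, ω⟩ = ⟨Lie_ξ ψ, ω⟩ + ⟨ψ, Lie_ξ ω⟩`. -/
def lieInv {n : ℕ} (ξ : Derivation ℂ O O) (ψ : InvTopForm O n) : InvTopForm O n where
  toFun ω := ξ (ψ ω) - ψ (lieForm ξ ω)
  map_add' ω ω' := by
    have : lieForm ξ (ω + ω') = lieForm ξ ω + lieForm ξ ω' := by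
      ext θ
      simp [lieForm_apply, Finset.sum_add_distrib]
      abel
    rw [this]; simp; abel
  map_smul' f ω := by
    have : lieForm ξ (f • ω) = ξ f • ω + f • lieForm ξ ω := by
      ext θ
      simp [lieForm_apply, Finset.mul_sum, mul_sub]
      ring
    rw [this]; simp; ring

theorem lieInv_apply {n : ℕ} (ξ : Derivation ℂ O O) (ψ : InvTopForm O n) (ω : TopForm O n) :
    lieInv ξ ψ ω = ξ (ψ ω) - ψ (lieForm ξ ω) := rfl

theorem lieInv_add {n : ℕ} (ξ : Derivation ℂ O O) (ψ ψ' : InvTopForm O n) :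
    lieInv ξ (ψ + ψ') = lieInv ξ ψ + lieInv ξ ψ' := by
  ext ω; simp [lieInv_apply]; abel

theorem lieInv_smul {n : ℕ} (ξ : Derivation ℂ O O) (f : O) (ψ : InvTopForm O n) :
    lieInv ξ (f • ψ) = ξ f • ψ + f • lieInv ξ ψ := by
  ext ω; simp [lieInv_apply]; ring

variable (O) in
/-- `D̃_Y = D_Y ⊗_O Ω_Y⁻¹`, the tensor product being taken over the right `O`-module
structure of `D_Y`.  Its second left `D_Y`-module structure `d₁ ⋆ (d₂ ⊗ ω̃) = d₁d₂ ⊗ ω̃`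
is its structure of a module over `DOp O`.  In the first structure a function `f` acts by
`f · (d ⊗ ω̃) = df ⊗ ω̃`, which is the structure of a module over `O`. -/
abbrev DTilde (n : ℕ) : Type := DOpR O ⊗[O] InvTopForm O n

/-- The action of a vector field on `D̃_Y` in the first structure:
`ξ · (d ⊗ ω̃) = - dξ ⊗ ω̃ + d ⊗ Lie_ξ ω̃`. -/
def firstVf {n : ℕ} (ξ : Derivation ℂ O O) : DTilde O n →+ DTilde O n :=
  TensorProduct.liftAddHom
    { toFun := fun d =>
        { toFun := fun ψ => -(DOpR.of (d.out * DOp.vf ξ) ⊗ₜ[O] ψ) + d ⊗ₜ[O] lieInv ξ ψ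
          map_zero' := by
            have h : lieInv ξ (0 : InvTopForm O n) = 0 := by ext ω; simp [lieInv_apply]
            simp [h]
          map_add' := fun ψ ψ' => by
            rw [lieInv_add, TensorProduct.tmul_add, TensorProduct.tmul_add]; abel }
      map_zero' := by
        ext ψ
        have h : DOpR.of (DOpR.out (0 : DOpR O) * DOp.vf ξ) = 0 :=
          zero_mul (DOp.vf ξ)
        simp [h]
      map_add' := fun d e => by
        ext ψ
        have h : DOpR.of (DOpR.out (d + e) * DOp.vf ξ) =
            DOpR.of (d.out * DOp.vf ξ) + DOpR.of (e.out * DOp.vf ξ) :=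
          add_mul (DOpR.out d) (DOpR.out e) (DOp.vf ξ)
        simp only [AddMonoidHom.coe_mk, ZeroHom.coe_mk, AddMonoidHom.add_apply, h,
          TensorProduct.add_tmul]
        abel }
    (fun f d ψ => by
      have h : DOpR.of (DOpR.out (f • d) * DOp.vf ξ) =
          f • DOpR.of (d.out * DOp.vf ξ) - (ξ f) • d := by
        change d.out * DOp.fn f * DOp.vf ξ =
          d.out * DOp.vf ξ * DOp.fn f - d.out * DOp.fn (ξ f)
        rw [mul_assoc, mul_assoc, DOp.vf_mul_fn, mul_add]; abel
      simp only [AddMonoidHom.coe_mk, ZeroHom.coe_mk, h, lieInv_smul, TensorProduct.tmul_add,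
        TensorProduct.sub_tmul, TensorProduct.smul_tmul]
      abel)

theorem firstVf_tmul {n : ℕ} (ξ : Derivation ℂ O O) (d : DOpR O) (ψ : InvTopForm O n) :
    firstVf ξ (d ⊗ₜ[O] ψ) =
      -(DOpR.of (d.out * DOp.vf ξ) ⊗ₜ[O] ψ) + d ⊗ₜ[O] lieInv ξ ψ := rfl

theorem firstVf_star {n : ℕ} (ξ : Derivation ℂ O O) (d : DOp O) (x : DTilde O n) :
    firstVf ξ (d • x) = d • firstVf ξ x := by
  induction x using TensorProduct.induction_on with
  | zero => simp
  | add x y hx hy => simp only [smul_add, map_add, hx, hy]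
  | tmul e ψ =>
    have h : DOpR.of (DOpR.out (d • e) * DOp.vf ξ) = d • DOpR.of (e.out * DOp.vf ξ) :=
      mul_assoc d (DOpR.out e) (DOp.vf ξ)
    rw [TensorProduct.smul_tmul', firstVf_tmul, firstVf_tmul, h, smul_add, smul_neg,
      TensorProduct.smul_tmul', TensorProduct.smul_tmul']

variable (O) in
/-- `Hom_{D_Y}(P, D̃_Y)`, the homomorphisms of left `D_Y`-modules being taken with respect to
the first structure on `D̃_Y` (as `D_Y` is generated by functions and vector fields, it is
enough to require that they commute with these).  It is a left `D_Y`-module by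
`(d · φ)(p) = d ⋆ φ(p)`. -/
def HomDTilde (n : ℕ) (P : Type) [AddCommGroup P] [Module (DOp O) P] :
    Submodule (DOp O) (P →+ DTilde O n) where
  carrier := {φ | (∀ (f : O) (p : P), φ (DOp.fn f • p) = f • φ p) ∧
    (∀ (ξ : Derivation ℂ O O) (p : P), φ (DOp.vf ξ • p) = firstVf ξ (φ p))}
  zero_mem' := by simp
  add_mem' := by
    rintro φ ψ ⟨h1, h2⟩ ⟨h3, h4⟩
    exact ⟨fun f p => by simp [h1, h3], fun ξ p => by simp [h2, h4]⟩
  smul_mem' := by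
    rintro d φ ⟨h1, h2⟩
    refine ⟨fun f p => ?_, fun ξ p => ?_⟩
    · rw [AddMonoidHom.smul_apply, AddMonoidHom.smul_apply, h1, smul_comm]
    · rw [AddMonoidHom.smul_apply, AddMonoidHom.smul_apply, h2, firstVf_star]

variable (O) in
/-- The contravariant functor `P ↦ Hom_{D_Y}(P, D̃_Y)` on left `D_Y`-modules. -/
def homDTilde (n : ℕ) : (ModuleCat.{0} (DOp O))ᵒᵖ ⥤ ModuleCat.{0} (DOp O) where
  obj P := ModuleCat.of (DOp O) (HomDTilde O n P.unop)
  map {P Q} g := ModuleCat.ofHom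
    { toFun := fun φ => ⟨φ.1.comp g.unop.hom.toAddMonoidHom,
        fun f p => by simp [φ.2.1], fun ξ p => by simp [φ.2.2]⟩
      map_add' := fun _ _ => rfl
      map_smul' := fun _ _ => rfl }

instance (n : ℕ) : (homDTilde O n).Additive where
  map_add {P Q g h} := by
    ext φ
    apply Subtype.ext
    apply AddMonoidHom.ext
    intro p
    exact φ.1.map_add _ _

variable (O) in
/-- The left `D_Y`-module `RⁱHom_{D_Y}(M, D̃_Y)`.  For `dim Y = n` the holonomic dual
`Δ_Y M = RHom_{D_Y}(M, D̃_Y)[n]` has this module as its cohomology in degree `i - n`. -/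
def RHomDTilde (n i : ℕ) (M : Type) [AddCommGroup M] [Module (DOp O) M] :
    ModuleCat.{0} (DOp O) :=
  ((homDTilde O n).rightDerived i).obj (Opposite.op (ModuleCat.of (DOp O) M))

end Duality

/-! ### Extension of vector fields to a localization -/

section LocalizedDerivation

variable {A : Type} [CommRing A] [Algebra ℂ A] (S : Submonoid A)

/-- The homomorphism `x ↦ x + ε δ(x)` from a localization to its dual numbers. -/
def locHom (δ : Derivation ℂ A A) :
    Localization S →+* TrivSqZeroExt (Localization S) (Localization S) :=
  IsLocalization.lift (M := S)
    (g := ({ toFun := fun a => TrivSqZeroExt.inl (algebraMap A _ a) +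
                TrivSqZeroExt.inr (algebraMap A _ (δ a))
             map_one' := by simp
             map_mul' := fun a b => by
               ext <;> simp [Algebra.smul_def, TrivSqZeroExt.algebraMap_eq_inl, mul_comm]
             map_zero' := by simp
             map_add' := fun a b => by
               ext <;> simp [Algebra.smul_def] } :
      A →+* TrivSqZeroExt (Localization S) (Localization S)))
    (fun s => by
      rw [TrivSqZeroExt.isUnit_iff_isUnit_fst]
      simpa using IsLocalization.map_units (Localization S) s)

theorem locHom_algebraMap (δ : Derivation ℂ A A) (a : A) :
    locHom S δ (algebraMap A _ a) = TrivSqZeroExt.inl (algebraMap A _ a) +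
                TrivSqZeroExt.inr (algebraMap A _ (δ a)) :=
  IsLocalization.lift_eq _ a

theorem locHom_fst (δ : Derivation ℂ A A) (x : Localization S) : (locHom S δ x).fst = x := by
  have : ((TrivSqZeroExt.fstHom ℂ (Localization S) (Localization S)).toRingHom.comp
      (locHom S δ)) = RingHom.id _ := by
    apply IsLocalization.ringHom_ext S
    ext a
    simp [locHom_algebraMap]
  exact congrArg (fun h => h x) this

/-- The extension of a derivation to a localization. -/
def locDer (δ : Derivation ℂ A A) : Derivation ℂ (Localization S) (Localization S) :=
  Derivation.mk'
    { toFun := fun x => (locHom S δ x).snd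
      map_add' := fun x y => by simp
      map_smul' := fun c x => by
        have h1 : algebraMap ℂ (Localization S) c = algebraMap A _ (algebraMap ℂ A c) :=
          IsScalarTower.algebraMap_apply ℂ A _ c
        rw [Algebra.smul_def, h1, map_mul, locHom_algebraMap]
        simp [locHom_fst, Algebra.smul_def, h1] }
    (fun x y => by simp [locHom_fst, mul_comm])

theorem locDer_algebraMap (δ : Derivation ℂ A A) (a : A) :
    locDer S δ (algebraMap A _ a) = algebraMap A _ (δ a) := by
  simp [locDer, locHom_algebraMap, Algebra.smul_def, TrivSqZeroExt.algebraMap_eq_inl]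

end LocalizedDerivation

/-! ### Constant top forms -/

section Contraction

variable {E : Type} [AddCommGroup E] [Module ℂ E]

/-- Constant top forms on a finite-dimensional space `U` of constant vector fields. -/
abbrev ConstTop (U : Submodule ℂ E) : Type := U [⋀^Fin (finrank ℂ U)]→ₗ[ℂ] ℂ

/-- For `W ⊂ U` of codimension one and `ξ ∈ U`, the map sending a constant top form `ω` on `U`
to the restriction to `W` of `i_ξ ω = ω(ξ, ·)`. -/
def contract {U W : Submodule ℂ E} (hWU : W ≤ U) (h : finrank ℂ U = finrank ℂ W + 1) (ξ : U) :
    ConstTop U →ₗ[ℂ] ConstTop W where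
  toFun ω := ((ω.domDomCongr (finCongr h)).curryLeft ξ).compLinearMap (Submodule.inclusion hWU)
  map_add' _ _ := rfl
  map_smul' _ _ := rfl

theorem contract_apply {U W : Submodule ℂ E} (hWU : W ≤ U)
    (h : finrank ℂ U = finrank ℂ W + 1) (ξ : U) (ω : ConstTop U)
    (t : Fin (finrank ℂ W) → W) :
    contract hWU h ξ ω t = ω.domDomCongr (finCongr h)
      (Fin.cons ξ (fun i => Submodule.inclusion hWU (t i))) := rfl

theorem contract_add {U W : Submodule ℂ E} (hWU : W ≤ U)
    (h : finrank ℂ U = finrank ℂ W + 1) (ξ ξ' : U) (ω : ConstTop U) :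
    contract hWU h (ξ + ξ') ω = contract hWU h ξ ω + contract hWU h ξ' ω := by
  ext t
  exact congrArg (fun η => η (fun i => Submodule.inclusion hWU (t i)))
    ((ω.domDomCongr (finCongr h)).curryLeft.map_add ξ ξ')

theorem contract_smul {U W : Submodule ℂ E} (hWU : W ≤ U)
    (h : finrank ℂ U = finrank ℂ W + 1) (c : ℂ) (ξ : U) (ω : ConstTop U) :
    contract hWU h (c • ξ) ω = c • contract hWU h ξ ω := by
  ext t
  exact congrArg (fun η => η (fun i => Submodule.inclusion hWU (t i)))
    ((ω.domDomCongr (finCongr h)).curryLeft.map_smul c ξ)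

variable [FiniteDimensional ℂ E]

theorem contract_of_mem {U W : Submodule ℂ E} (hWU : W ≤ U)
    (h : finrank ℂ U = finrank ℂ W + 1) (ξ : U) (hξ : (ξ : E) ∈ W) (ω : ConstTop U) :
    contract hWU h ξ ω = 0 := by
  ext t
  rw [contract_apply]
  apply AlternatingMap.map_linearDependent
  intro hli
  have hli' : LinearIndependent ℂ (Fin.cons (⟨ξ, hξ⟩ : W) t : Fin (finrank ℂ W + 1) → W) := by
    apply LinearIndependent.of_comp (Submodule.inclusion hWU)
    have he : (Submodule.inclusion hWU ∘ (Fin.cons (⟨ξ, hξ⟩ : W) t :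
        Fin (finrank ℂ W + 1) → W)) =
        Fin.cons ξ (fun i => Submodule.inclusion hWU (t i)) := by
      funext i
      refine Fin.cases ?_ (fun j => ?_) i
      · exact Subtype.ext rfl
      · rfl
    rw [he]
    exact hli
  have := hli'.fintype_card_le_finrank
  simp at this

theorem exists_basis_cons {U W : Submodule ℂ E} (hWU : W ≤ U)
    (h : finrank ℂ U = finrank ℂ W + 1) (ξ : U) (hξ : (ξ : E) ∉ W) :
    ∃ e : Basis (Fin (finrank ℂ U)) ℂ U, ∀ i, e ((finCongr h).symm i) =
      (Fin.cons ξ (fun i => Submodule.inclusion hWU (finBasis ℂ W i)) :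
        Fin (finrank ℂ W + 1) → U) i := by
  have hli : LinearIndependent ℂ
      (Fin.cons ξ (fun i => Submodule.inclusion hWU (finBasis ℂ W i)) :
        Fin (finrank ℂ W + 1) → U) := by
    rw [linearIndependent_finCons]
    refine ⟨?_, ?_⟩
    · exact (finBasis ℂ W).linearIndependent.map' (Submodule.inclusion hWU)
        (Submodule.ker_inclusion _ _ hWU)
    · intro hmem
      apply hξ
      have hle : Submodule.span ℂ (Set.range fun i =>
          Submodule.inclusion hWU (finBasis ℂ W i)) ≤ W.comap U.subtype := by
        rw [Submodule.span_le]
        rintro _ ⟨i, rfl⟩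
        exact (finBasis ℂ W i).2
      exact hle hmem
  let b := basisOfLinearIndependentOfCardEqFinrank hli (by simp [h])
  refine ⟨b.reindex (finCongr h).symm, fun i => ?_⟩
  simp [b]

theorem contract_bijective {U W : Submodule ℂ E} (hWU : W ≤ U)
    (h : finrank ℂ U = finrank ℂ W + 1) (ξ : U) (hξ : (ξ : E) ∉ W) :
    Function.Bijective (contract hWU h ξ) := by
  obtain ⟨e, he⟩ := exists_basis_cons hWU h ξ hξ
  have key : ∀ ω : ConstTop U, contract hWU h ξ ω (finBasis ℂ W) = ω e := by
    intro ω
    rw [contract_apply, AlternatingMap.domDomCongr_apply]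
    congr 1
    funext i
    simpa using (he (finCongr h i)).symm
  constructor
  · rw [← LinearMap.ker_eq_bot, LinearMap.ker_eq_bot']
    intro ω hω
    have h0 : ω e = 0 := by rw [← key, hω]; rfl
    rw [ω.eq_smul_basis_det e, h0, zero_smul]
  · intro η
    refine ⟨η (finBasis ℂ W) • e.det, ?_⟩
    have h1 := (contract hWU h ξ (η (finBasis ℂ W) • e.det)).eq_smul_basis_det (finBasis ℂ W)
    rw [key] at h1
    rw [h1]
    nth_rewrite 2 [η.eq_smul_basis_det (finBasis ℂ W)]
    simp [Basis.det_self]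

end Contraction

/-! ### Arrangements of hyperplanes -/

/-- An arrangement of finitely many affine hyperplanes in `ℂ^N`. -/
structure Arrangement (N : ℕ) where
  hyps : Finset (AffineSubspace ℂ (Fin N → ℂ))
  nonempty : ∀ H ∈ hyps, (H : Set (Fin N → ℂ)).Nonempty
  codim_one : ∀ H ∈ hyps, finrank ℂ H.direction + 1 = N

/-- Affine functions on `ℂ^N`. -/
abbrev AffineFn (N : ℕ) : Type := (Fin N → ℂ) →ᵃ[ℂ] ℂ

/-- The derivative `⟨ξ, f⟩` of an affine function along a constant vector field. -/
def pair {N : ℕ} (ξ : Fin N → ℂ) (f : AffineFn N) : ℂ := f.linear ξ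

/-- The coordinate ring of `X = ℂ^N`. -/
abbrev PolyRing (N : ℕ) : Type := MvPolynomial (Fin N) ℂ

/-- An affine function as a polynomial: `a₀ + ∑ aᵢ zᵢ`. -/
def affPoly {N : ℕ} (f : AffineFn N) : PolyRing N :=
  MvPolynomial.C (f 0) +
    ∑ i, MvPolynomial.C (pair (Pi.single i 1) f) * MvPolynomial.X i

theorem eval_affPoly {N : ℕ} (f : AffineFn N) (x : Fin N → ℂ) :
    MvPolynomial.eval x (affPoly f) = f x := by
  have h : f.linear x = ∑ i, f.linear (Pi.single i 1) * x i := by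
    conv_lhs => rw [← Finset.univ_sum_single x]
    rw [map_sum]
    refine Finset.sum_congr rfl fun i _ => ?_
    have : (Pi.single i (x i) : Fin N → ℂ) = x i • Pi.single i (1 : ℂ) := by
      rw [← Pi.single_smul]; simp
    rw [this, map_smul, smul_eq_mul, mul_comm]
  have h2 : f x = f.linear x + f 0 := by
    have := f.map_vadd 0 x
    simpa using this
  rw [h2, h]
  simp [affPoly, pair, add_comm]

/-- The constant vector field `∑ ξᵢ ∂/∂zᵢ`. -/
def constVf {N : ℕ} (ξ : Fin N → ℂ) : Derivation ℂ (PolyRing N) (PolyRing N) :=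
  MvPolynomial.mkDerivation ℂ (fun i => MvPolynomial.C (ξ i))

namespace Arrangement

variable {N : ℕ} (C : Arrangement N)

/-- The vertices `α` of the graph of the arrangement are the strata; they are identified with
the closures of the strata, that is, with the non-empty intersections of families of
hyperplanes (the empty family giving the whole space). -/
abbrev Vertex : Type :=
  {S : AffineSubspace ℂ (Fin N → ℂ) // (S : Set (Fin N → ℂ)).Nonempty ∧
    ∃ K : Set (AffineSubspace ℂ (Fin N → ℂ)), K ⊆ (C.hyps : Set _) ∧ S = sInf K}

variable {C}

instance : Finite C.Vertex := by
  have hfin : Finite (Set.powerset (C.hyps : Set (AffineSubspace ℂ (Fin N → ℂ)))) :=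
    C.hyps.finite_toSet.finite_subsets.to_subtype
  let g : C.Vertex → Set.powerset (C.hyps : Set (AffineSubspace ℂ (Fin N → ℂ))) :=
    fun α => ⟨α.2.2.choose, α.2.2.choose_spec.1⟩
  refine Finite.of_injective g fun α β h => Subtype.ext ?_
  have h' : α.2.2.choose = β.2.2.choose := congrArg Subtype.val h
  rw [α.2.2.choose_spec.2, β.2.2.choose_spec.2, h']

instance : Fintype C.Vertex := Fintype.ofFinite _

instance : DecidableEq C.Vertex := Classical.decEq _

variable (C) in
/-- The vertex `∅` of the open stratum, whose closure is the whole space. -/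
def openVertex : C.Vertex :=
  ⟨⊤, ⟨0, trivial⟩, ∅, Set.empty_subset _, sInf_empty.symm⟩

/-- The space `T_α` of constant vector fields parallel to the stratum. -/
abbrev T (α : C.Vertex) : Submodule ℂ (Fin N → ℂ) := α.1.direction

/-- The space `F_α` of affine functions vanishing on the stratum. -/
def F (α : C.Vertex) : Submodule ℂ (AffineFn N) where
  carrier := {f | ∀ x ∈ α.1, f x = 0}
  zero_mem' := fun _ _ => rfl
  add_mem' := fun {f g} hf hg x hx => by simp [hf x hx, hg x hx]
  smul_mem' := fun c f hf x hx => by simp [hf x hx]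

/-- The level `l(α)`: the codimension of the stratum. -/
def level (α : C.Vertex) : ℕ := N - finrank ℂ (T α)

/-- `α ≻ β`: the closure of the stratum `α` contains that of `β`, with codimension one. -/
def Succ (α β : C.Vertex) : Prop :=
  β.1 ≤ α.1 ∧ finrank ℂ (T α) = finrank ℂ (T β) + 1

open Classical in
/-- The sign `ε(α,β)`. -/
def eps (α β : C.Vertex) : ℂ := if Succ α β then 1 else if Succ β α then -1 else 0

theorem Succ.level_eq {α β : C.Vertex} (h : Succ α β) : level β = level α + 1 := by
  have h1 : finrank ℂ (T α) ≤ N := by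
    simpa using Submodule.finrank_le (T α)
  have h2 := h.2
  simp only [level]
  omega

theorem Succ.T_le {α β : C.Vertex} (h : Succ α β) : T β ≤ T α :=
  AffineSubspace.direction_le h.1

/-- The one-dimensional space `Ω̄_α` of top forms on the stratum invariant under translations
along the stratum. -/
abbrev Om (α : C.Vertex) : Type := ConstTop (T α)

variable (C) in
/-- An edge framing: for every edge `α ≻ β` a function `f_{β,α} ∈ F_β ∖ F_α` and a
vector field `ξ_{α,β} ∈ T_α ∖ T_β`. -/
structure EdgeFraming where
  f : C.Vertex → C.Vertex → AffineFn N
  ξ : C.Vertex → C.Vertex → (Fin N → ℂ)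
  f_mem : ∀ {α β}, Succ α β → f β α ∈ F β
  f_not_mem : ∀ {α β}, Succ α β → f β α ∉ F α
  ξ_mem : ∀ {α β}, Succ α β → ξ α β ∈ T α
  ξ_not_mem : ∀ {α β}, Succ α β → ξ α β ∉ T β

section Pi

variable (φ : C.EdgeFraming) {α β : C.Vertex} (h : Succ α β)

/-- The map `π_{β,α} : Ω̄_α → Ω̄_β` for `α ≻ β`, characterized by
`df_{β,α} ∧ π_{β,α}(ω) = ω` (see `piDown_spec`). -/
def piDown : Om α →ₗ[ℂ] Om β :=
  (pair (φ.ξ α β) (φ.f β α))⁻¹ • contract h.T_le h.2 ⟨φ.ξ α β, φ.ξ_mem h⟩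

/-- The map `π_{α,β} : Ω̄_β → Ω̄_α` for `α ≻ β`, characterized by
`i_{ξ_{α,β}}(π_{α,β}(ω)) = ω` (see `piUp_spec`). -/
def piUp : Om β →ₗ[ℂ] Om α :=
  (LinearEquiv.ofBijective (contract h.T_le h.2 ⟨φ.ξ α β, φ.ξ_mem h⟩)
    (contract_bijective h.T_le h.2 ⟨φ.ξ α β, φ.ξ_mem h⟩ (φ.ξ_not_mem h))).symm.toLinearMap

theorem piUp_spec (ω : Om β) (η : Om α) :
    piUp φ h ω = η ↔ contract h.T_le h.2 ⟨φ.ξ α β, φ.ξ_mem h⟩ η = ω := by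
  constructor
  · rintro rfl
    exact (LinearEquiv.ofBijective _ (contract_bijective h.T_le h.2 ⟨φ.ξ α β, φ.ξ_mem h⟩
      (φ.ξ_not_mem h))).apply_symm_apply ω
  · rintro rfl
    exact (LinearEquiv.ofBijective _ (contract_bijective h.T_le h.2 ⟨φ.ξ α β, φ.ξ_mem h⟩
      (φ.ξ_not_mem h))).symm_apply_apply η

theorem pair_eq_zero_of_mem {β : C.Vertex} {f : AffineFn N} (hf : f ∈ F β) {w : Fin N → ℂ}
    (hw : w ∈ T β) : pair w f = 0 := by
  obtain ⟨p, hp⟩ := β.2.1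
  have h1 : f (w +ᵥ p) = 0 := hf _ (AffineSubspace.vadd_mem_of_mem_direction hw hp)
  have h2 : f p = 0 := hf _ hp
  rw [f.map_vadd, h2] at h1
  simpa [pair] using h1

theorem T_decomp (φ : C.EdgeFraming) {α β : C.Vertex} (h : Succ α β) (t : Fin N → ℂ) (ht : t ∈ T α) :
    ∃ c : ℂ, t - c • φ.ξ α β ∈ T β := by
  obtain ⟨e, he⟩ := exists_basis_cons h.T_le h.2 ⟨φ.ξ α β, φ.ξ_mem h⟩ (φ.ξ_not_mem h)
  refine ⟨e.repr ⟨t, ht⟩ ((finCongr h.2).symm 0), ?_⟩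
  have h1 := congrArg (Subtype.val) (e.sum_repr ⟨t, ht⟩)
  rw [← (finCongr h.2).symm.sum_comp, Fin.sum_univ_succ] at h1
  simp only [he, Fin.cons_zero, Fin.cons_succ] at h1
  have h2 : t - e.repr ⟨t, ht⟩ ((finCongr h.2).symm 0) • φ.ξ α β =
      ∑ i : Fin (finrank ℂ (T β)), e.repr ⟨t, ht⟩ ((finCongr h.2).symm i.succ) •
        ((finBasis ℂ (T β) i : T β) : Fin N → ℂ) := by
    rw [sub_eq_iff_eq_add]
    refine h1.symm.trans ?_
    rw [Submodule.coe_add, Submodule.coe_sum, add_comm]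
    rfl
  rw [h2]
  exact Submodule.sum_mem _ fun i _ => Submodule.smul_mem _ _ (finBasis ℂ (T β) i).2

theorem pair_framing_ne_zero (φ : C.EdgeFraming) {α β : C.Vertex} (h : Succ α β) :
    pair (φ.ξ α β) (φ.f β α) ≠ 0 := by
  intro h0
  apply φ.f_not_mem h
  obtain ⟨p, hp⟩ := β.2.1
  intro x hx
  have hxp : x -ᵥ p ∈ T α := AffineSubspace.vsub_mem_direction hx (h.1 hp)
  obtain ⟨c, hc⟩ := T_decomp φ h _ hxp
  have h1 := pair_eq_zero_of_mem (φ.f_mem h) hc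
  have h2 : pair (x -ᵥ p) (φ.f β α) = 0 := by
    simpa [pair, map_sub, map_smul, show (φ.f β α).linear (φ.ξ α β) = 0 from h0] using h1
  have h3 := (φ.f β α).map_vadd p (x -ᵥ p)
  rw [vsub_vadd, φ.f_mem h p hp] at h3
  rw [h3]
  simpa [pair] using h2

/-- The property `df_{β,α} ∧ π_{β,α}(ω) = ω`, evaluated on `(t₀, t₁, …)` with `t₀ ∈ T_α` and
`t₁, … ∈ T_β` (such tuples determine a constant top form on the stratum `α`). -/
theorem piDown_spec (ω : Om α) (t₀ : T α) (t : Fin (finrank ℂ (T β)) → T β) :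
    ω.domDomCongr (finCongr h.2)
        (Fin.cons t₀ (fun i => Submodule.inclusion h.T_le (t i))) =
      pair t₀ (φ.f β α) * piDown φ h ω t := by
  have hne := pair_framing_ne_zero φ h
  obtain ⟨c, hc⟩ := T_decomp φ h t₀ t₀.2
  have h1 : pair (t₀ : Fin N → ℂ) (φ.f β α) = c * pair (φ.ξ α β) (φ.f β α) := by
    have := pair_eq_zero_of_mem (φ.f_mem h) hc
    simpa [pair, map_sub, map_smul, sub_eq_zero] using this
  have h2 : t₀ = (t₀ - c • (⟨φ.ξ α β, φ.ξ_mem h⟩ : T α)) + c • ⟨φ.ξ α β, φ.ξ_mem h⟩ := by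
    simp
  rw [← contract_apply h.T_le h.2 t₀ ω t, h2, contract_add, contract_smul,
    contract_of_mem h.T_le h.2 _ (by simpa using hc), zero_add, ← h2, h1]
  simp only [piDown, LinearMap.smul_apply, AlternatingMap.smul_apply, smul_eq_mul]
  field_simp

end Pi

/-! ### Quivers of an arrangement -/

variable (C) in
/-- A quiver of the graph `Γ` of the arrangement. -/
structure GraphQuiver where
  V : C.Vertex → Type
  [addCommGroup : ∀ α, AddCommGroup (V α)]
  [module : ∀ α, Module ℂ (V α)]
  [finiteDimensional : ∀ α, FiniteDimensional ℂ (V α)]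
  /-- `A α β` is the linear map `A_{α,β} : V_β → V_α`. -/
  A : ∀ α β, V β →ₗ[ℂ] V α
  A_eq_zero : ∀ α β, ¬ Succ α β → ¬ Succ β α → A α β = 0
  comp_two : ∀ α γ, (level α = level γ + 2 ∨ level γ = level α + 2) →
    ∑ β, A α β ∘ₗ A β γ = 0
  comp_same : ∀ α γ δ, level α = level γ → α ≠ γ → Succ α δ → Succ γ δ →
    ∑ β, A α β ∘ₗ A β γ = 0

attribute [instance] GraphQuiver.addCommGroup GraphQuiver.module GraphQuiver.finiteDimensional

theorem eps_down {α β : C.Vertex} (h : Succ α β) : eps α β = 1 := if_pos h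

theorem eps_up {α β : C.Vertex} (h : Succ α β) : eps β α = -1 := by
  have h1 : ¬ Succ β α := fun h2 => by
    have := h.2
    have := h2.2
    omega
  rw [eps, if_neg h1, if_pos h]

theorem GraphQuiver.dual_aux (𝒱 : C.GraphQuiver) (α γ : C.Vertex)
    (h0 : ∑ β, 𝒱.A γ β ∘ₗ 𝒱.A β α = 0) :
    ∑ β, (eps β α • (𝒱.A β α).dualMap) ∘ₗ (eps γ β • (𝒱.A γ β).dualMap) = 0 := by
  have hterm : ∀ β, 𝒱.A γ β ∘ₗ 𝒱.A β α ≠ 0 →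
      eps β α * eps γ β = if level α = level γ then -1 else 1 := by
    intro β hβ
    by_cases h1 : Succ β α
    · have e1 := h1.level_eq
      by_cases h2 : Succ γ β
      · have e2 := h2.level_eq
        rw [eps_down h1, eps_down h2, if_neg (by omega), one_mul]
      · by_cases h3 : Succ β γ
        · have e3 := h3.level_eq
          rw [eps_down h1, eps_up h3, if_pos (by omega), one_mul]
        · exact absurd (by rw [𝒱.A_eq_zero γ β h2 h3, LinearMap.zero_comp]) hβ
    · by_cases h1' : Succ α β
      · have e1 := h1'.level_eq
        by_cases h2 : Succ γ β
        · have e2 := h2.level_eq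
          rw [eps_up h1', eps_down h2, if_pos (by omega), mul_one]
        · by_cases h3 : Succ β γ
          · have e3 := h3.level_eq
            rw [eps_up h1', eps_up h3, if_neg (by omega)]
            norm_num
          · exact absurd (by rw [𝒱.A_eq_zero γ β h2 h3, LinearMap.zero_comp]) hβ
      · exact absurd (by rw [𝒱.A_eq_zero β α h1 h1', LinearMap.comp_zero]) hβ
  have h3 : ∀ β, (eps β α • (𝒱.A β α).dualMap) ∘ₗ (eps γ β • (𝒱.A γ β).dualMap) =
      (if level α = level γ then (-1 : ℂ) else 1) • (𝒱.A γ β ∘ₗ 𝒱.A β α).dualMap := by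
    intro β
    rw [LinearMap.smul_comp, LinearMap.comp_smul, smul_smul, LinearMap.dualMap_comp_dualMap]
    by_cases hβ : 𝒱.A γ β ∘ₗ 𝒱.A β α = 0
    · have hz : (𝒱.A γ β ∘ₗ 𝒱.A β α).dualMap = 0 := by rw [hβ]; ext; simp
      rw [hz, smul_zero, smul_zero]
    · rw [hterm β hβ]
  rw [Finset.sum_congr rfl fun β _ => h3 β, ← Finset.smul_sum]
  have h4 : ∑ β, (𝒱.A γ β ∘ₗ 𝒱.A β α).dualMap = (∑ β, 𝒱.A γ β ∘ₗ 𝒱.A β α).dualMap := by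
    ext φ v
    simp [LinearMap.sum_apply]
  have h5 : (0 : 𝒱.V α →ₗ[ℂ] 𝒱.V γ).dualMap = 0 := by ext; simp
  rw [h4, h0, h5, smul_zero]

/-- The dual quiver `τ(𝒱) = {V_α^*, ε(β,α) A_{β,α}^*}`. -/
def GraphQuiver.dual (𝒱 : C.GraphQuiver) : C.GraphQuiver where
  V α := Module.Dual ℂ (𝒱.V α)
  A α β := eps β α • (𝒱.A β α).dualMap
  A_eq_zero α β h1 h2 := by
    rw [𝒱.A_eq_zero β α h2 h1]
    ext; simp
  comp_two α γ h := 𝒱.dual_aux α γ (𝒱.comp_two γ α h.symm)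
  comp_same α γ δ h1 h2 h3 h4 :=
    𝒱.dual_aux α γ (𝒱.comp_same γ α δ h1.symm h2.symm h4 h3)

variable (C) in
open Classical in
/-- A level zero quiver: operators `A^j` on one vector space, labelled by the hyperplanes, with
`[A^j, ∑_{i ≻ γ} A^i] = 0` for every stratum `γ` of level two and every `j ≻ γ`. -/
structure LevelZeroQuiver where
  V : Type
  [addCommGroup : AddCommGroup V]
  [module : Module ℂ V]
  [finiteDimensional : FiniteDimensional ℂ V]
  A : C.hyps → Module.End ℂ V
  flat : ∀ γ : C.Vertex, level γ = 2 → ∀ j : C.hyps, γ.1 ≤ j.1 →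
    ⁅A j, ∑ i : C.hyps, if γ.1 ≤ i.1 then A i else 0⁆ = 0

attribute [instance] LevelZeroQuiver.addCommGroup LevelZeroQuiver.module
  LevelZeroQuiver.finiteDimensional

open Classical in
/-- The dual level zero quiver `τ(𝒱) = {V^*, -(A^j)^*}`. -/
def LevelZeroQuiver.dual (𝒱 : C.LevelZeroQuiver) : C.LevelZeroQuiver where
  V := Module.Dual ℂ 𝒱.V
  A j := -(𝒱.A j).dualMap
  flat γ hγ j hj := by
    have h := 𝒱.flat γ hγ j hj
    have key : (∑ i : C.hyps, if γ.1 ≤ i.1 then -(𝒱.A i).dualMap else 0) =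
        -(∑ i : C.hyps, if γ.1 ≤ i.1 then 𝒱.A i else 0).dualMap := by
      ext φ v
      simp only [LinearMap.sum_apply, LinearMap.neg_apply, LinearMap.dualMap_apply, map_sum,
        ← Finset.sum_neg_distrib]
      refine Finset.sum_congr rfl fun i _ => ?_
      split_ifs <;> simp
    rw [Ring.lie_def, sub_eq_zero] at h ⊢
    rw [key]
    ext φ v
    have := congrArg (fun g => φ (g v)) h
    simpa using this.symm

/-! ### Quiver D-modules -/

/-- The generators `⨁_α Ω̄_α ⊗ V_α` of a quiver D-module. -/
abbrev GraphQuiver.Gen (𝒱 : C.GraphQuiver) : Type := DirectSum C.Vertex fun α => Om α ⊗[ℂ] 𝒱.V α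

/-- The element `d ⊗ ω̄_α ⊗ v_α` of the free module `R⁰E𝒱 = D_X ⊗ ⨁_α (Ω̄_α ⊗ V_α)`. -/
def GraphQuiver.elt (𝒱 : C.GraphQuiver) (d : DOp (PolyRing N)) (α : C.Vertex) (ω : Om α)
    (v : 𝒱.V α) : DOp (PolyRing N) ⊗[ℂ] 𝒱.Gen :=
  d ⊗ₜ[ℂ] DirectSum.lof ℂ C.Vertex (fun α => Om α ⊗[ℂ] 𝒱.V α) α (ω ⊗ₜ[ℂ] v)

open Classical in
/-- The section
`ξ ⊗ ω̄_α ⊗ v_α - ∑_{β, α ≻ β} ⟨ξ, f_{β,α}⟩ ⊗ π_{β,α}(ω̄_α) ⊗ A_{β,α}(v_α)` of `R⁰E𝒱`. -/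
def GraphQuiver.relVf (𝒱 : C.GraphQuiver) (φ : C.EdgeFraming) (α : C.Vertex) (ξ : T α)
    (ω : Om α) (v : 𝒱.V α) : DOp (PolyRing N) ⊗[ℂ] 𝒱.Gen :=
  𝒱.elt (DOp.vf (constVf (ξ : Fin N → ℂ))) α ω v -
    ∑ β : C.Vertex, if h : Succ α β then
      pair (ξ : Fin N → ℂ) (φ.f β α) • 𝒱.elt 1 β (piDown φ h ω) (𝒱.A β α v) else 0

open Classical in
/-- The section
`f ⊗ ω̄_α ⊗ v_α - ∑_{β, β ≻ α} ⟨ξ_{β,α}, f⟩ ⊗ π_{β,α}(ω̄_α) ⊗ A_{β,α}(v_α)` of `R⁰E𝒱`. -/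
def GraphQuiver.relFn (𝒱 : C.GraphQuiver) (φ : C.EdgeFraming) (α : C.Vertex) (f : F α)
    (ω : Om α) (v : 𝒱.V α) : DOp (PolyRing N) ⊗[ℂ] 𝒱.Gen :=
  𝒱.elt (DOp.fn (affPoly (f : AffineFn N))) α ω v -
    ∑ β : C.Vertex, if h : Succ β α then
      pair (φ.ξ β α) (f : AffineFn N) • 𝒱.elt 1 β (piUp φ h ω) (𝒱.A β α v) else 0

/-- The quiver `D_X`-module `E𝒱`. -/
abbrev GraphQuiver.E (𝒱 : C.GraphQuiver) (φ : C.EdgeFraming) : Type :=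
  (DOp (PolyRing N) ⊗[ℂ] 𝒱.Gen) ⧸ Submodule.span (DOp (PolyRing N))
    ({x | ∃ (α : C.Vertex) (ξ : T α) (ω : Om α) (v : 𝒱.V α), x = 𝒱.relVf φ α ξ ω v} ∪
      {x | ∃ (α : C.Vertex) (f : F α) (ω : Om α) (v : 𝒱.V α), x = 𝒱.relFn φ α f ω v})

/-! ### The open stratum -/

variable (C)

/-- The complement `X⁰` of the hyperplanes. -/
def X0 : Set (Fin N → ℂ) := {x | ∀ H ∈ C.hyps, x ∉ H}

/-- The polynomials without zeros on `X⁰`. -/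
def nonvanishing : Submonoid (PolyRing N) where
  carrier := {p | ∀ x ∈ C.X0, MvPolynomial.eval x p ≠ 0}
  one_mem' := by simp
  mul_mem' := fun {p q} hp hq x hx => by
    rw [map_mul]
    exact mul_ne_zero (hp x hx) (hq x hx)

/-- The coordinate ring of the affine variety `X⁰`: the fractions of polynomials whose
denominators have no zeros on `X⁰`. -/
abbrev O0 : Type := Localization C.nonvanishing

/-- A choice of an equation `f_j = 0` for every hyperplane `H_j`. -/
structure Equations where
  f : C.hyps → AffineFn N
  zero_iff : ∀ (j : C.hyps) (x : Fin N → ℂ), f j x = 0 ↔ x ∈ j.1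

variable {C}

/-- The function `1 / f_j` on `X⁰`. -/
def Equations.inv (φ : C.Equations) (j : C.hyps) : C.O0 :=
  Localization.mk 1 ⟨affPoly (φ.f j), fun x hx => by
    rw [eval_affPoly]
    exact fun h => hx j.1 j.2 ((φ.zero_iff j x).1 h)⟩

/-- The element `d ⊗ ω̄ ⊗ v` of the free module `D_{X⁰} ⊗ Ω̄_∅ ⊗ V`. -/
def LevelZeroQuiver.elt (𝒱 : C.LevelZeroQuiver) (d : DOp C.O0) (ω : Om C.openVertex)
    (v : 𝒱.V) : DOp C.O0 ⊗[ℂ] (Om C.openVertex ⊗[ℂ] 𝒱.V) :=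
  d ⊗ₜ[ℂ] (ω ⊗ₜ[ℂ] v)

/-- The section `ξ ⊗ ω̄ ⊗ v - ∑_j f_j⁻¹ ⊗ ⟨ξ, f_j⟩ ω̄ ⊗ A^j(v)` of `D_{X⁰} ⊗ Ω̄_∅ ⊗ V`. -/
def LevelZeroQuiver.rel (𝒱 : C.LevelZeroQuiver) (φ : C.Equations) (ξ : Fin N → ℂ)
    (ω : Om C.openVertex) (v : 𝒱.V) : DOp C.O0 ⊗[ℂ] (Om C.openVertex ⊗[ℂ] 𝒱.V) :=
  𝒱.elt (DOp.vf (locDer C.nonvanishing (constVf ξ))) ω v -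
    ∑ j : C.hyps, pair ξ (φ.f j) • 𝒱.elt (DOp.fn (φ.inv j)) ω (𝒱.A j v)

/-- The quiver `D_{X⁰}`-module `E⁰𝒱` of a level zero quiver.  (The only affine function
vanishing on the open stratum is zero, so there are no relations with functions.) -/
abbrev LevelZeroQuiver.E (𝒱 : C.LevelZeroQuiver) (φ : C.Equations) : Type :=
  (DOp C.O0 ⊗[ℂ] (Om C.openVertex ⊗[ℂ] 𝒱.V)) ⧸ Submodule.span (DOp C.O0)
    {x | ∃ (ξ : Fin N → ℂ) (ω : Om C.openVertex) (v : 𝒱.V), x = 𝒱.rel φ ξ ω v}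

end Arrangement

end QuiverDMod

end

/-! Both kinds of quiver D-modules are quotients of a free module `D ⊗ W` by the sum of the ranges
of `N` commuting `D`-linear endomorphisms `θ i` that form a regular family: each one is injective
modulo the ranges of the preceding ones. The Koszul complex, built as an iterated mapping cone, is
then a projective resolution of length `N`. Applying `Hom(-, D̃)` to it gives the Koszul complex of
the transposed operators on `D ⊗ W*`. If these are regular as well, cohomology survives only in
degree `N`, where it is the quotient by the ranges of the transposes
(`rightDerived_of_isRegularFamily`, `RHomDTilde_of_isTranspose`). Degree `N` is degree `0` of the
shifted dual, and the transposed operators turn out to present the module of the dual quiver.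

Regularity comes from normal ordering. If `D` has unique normal forms `∑ j(f_α) q^α` and each `θ i`
is right multiplication by `q i` up to terms without `q`, then the monomials in the `θ i` differ
from the normally ordered monomials by a unitriangular map. So `D ⊗ W` is a polynomial module on
which the `θ i` act as the variables (`isRegularFamily_of_normalOrder`).

At level zero `W = V`, the operators are `∂ᵢ - ∑ⱼ (∂ᵢ fⱼ / fⱼ) Aʲ`, and the `q i` are the
derivations. Commutativity is flatness of the logarithmic connection: the Arnold relation combined
with the commutator condition at each stratum of codimension two (`sum_wedge_tmul`).

For a quiver of the graph, `W = ∏ V_α`, and a stratum `α` imposes `dim T_α` differential and `codim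
T_α` functional relations. A complex symmetric form `B` nondegenerate on every `T_α` merges them: a
vector `w` splits orthogonally at each `α`, its tangential part giving the vector field relation and
its normal part the function relation. Thus every `w` gives one operator on all of `D ⊗ W`. Unit
normals along the edges, oriented by compatible volume forms, absorb the edge framing. Commutativity
then needs `∑_β (ν_αβ ∧ ν_βγ) A_γβ A_βα = 0`; it holds because either all contributing wedges agree,
so that a quiver relation applies, or they all vanish (`sum_wedge_smul`). For regularity the leading
part must not depend on `α`: the coordinates `xᵢ` serve as the `q i`, with coefficients in
polynomials in the commuting operators `sB(a,·) - ∂_a`, where `s = ±1`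
(`exists_gauged_normalOrder`). Transposition changes `s = 1` into `s = -1`, and the signs
`(-1)^level` match this with the signs `ε` of the dual quiver. -/

open CategoryTheory TensorProduct Module

/-! ### Derived functors computed from explicit projective resolutions. -/

namespace QuiverDMod

section Homological

variable {R : Type} [Ring R]

/-- The cochain complex in the opposite category of modules attached to a chain complex of
modules. -/
noncomputable def opComplex (K : ℕ → ModuleCat.{0} R) (d : ∀ n, K (n + 1) ⟶ K n)
    (hd : ∀ n, d (n + 1) ≫ d n = 0) : CochainComplex (ModuleCat.{0} R)ᵒᵖ ℕ :=
  CochainComplex.of (fun n => Opposite.op (K n)) (fun n => (d n).op)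
    (fun n => by rw [← op_comp, hd]; rfl)

theorem opComplex_d (K : ℕ → ModuleCat.{0} R) (d : ∀ n, K (n + 1) ⟶ K n)
    (hd : ∀ n, d (n + 1) ≫ d n = 0) (n : ℕ) :
    (opComplex K d hd).d n (n + 1) = (d n).op :=
  CochainComplex.of_d (V := (ModuleCat.{0} R)ᵒᵖ) (fun n => Opposite.op (K n)) (fun n => (d n).op) n

theorem opComplex_condition (K : ℕ → ModuleCat.{0} R) (d : ∀ n, K (n + 1) ⟶ K n)
    (hd : ∀ n, d (n + 1) ≫ d n = 0) {M : ModuleCat.{0} R} (p : K 0 ⟶ M) (hp : d 0 ≫ p = 0) :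
    (show Opposite.op M ⟶ (opComplex K d hd).X 0 from p.op) ≫ (opComplex K d hd).d 0 1 = 0 := by
  rw [opComplex_d]
  exact op_comp.symm.trans (by rw [hp]; rfl)

/-- An exact complex of projective modules resolving `M` gives an injective resolution of `M`
in the opposite category. -/
noncomputable def opResolution (K : ℕ → ModuleCat.{0} R) (d : ∀ n, K (n + 1) ⟶ K n)
    (hd : ∀ n, d (n + 1) ≫ d n = 0) {M : ModuleCat.{0} R} (p : K 0 ⟶ M)
    (hp : d 0 ≫ p = 0) (hsurj : Function.Surjective p.hom)
    (h0 : Function.Exact (d 0).hom p.hom)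
    (hex : ∀ n, Function.Exact (d (n + 1)).hom (d n).hom)
    (hproj : ∀ n, Module.Projective R (K n)) : InjectiveResolution (Opposite.op M) where
  cocomplex := opComplex K d hd
  injective n := by
    have : Projective (K n) := (IsProjective.iff_projective _).1 (hproj n)
    change Injective (Opposite.op (K n))
    infer_instance
  ι := (CochainComplex.fromSingle₀Equiv _ _).symm ⟨p.op, opComplex_condition K d hd p hp⟩
  quasiIso := ⟨fun n => by
    have hepi : Epi p := (ModuleCat.epi_iff_surjective p).2 hsurj
    have e0 : (ShortComplex.mk (d 0) p hp).Exact :=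
      (ShortComplex.ShortExact.moduleCat_exact_iff_function_exact _).2 h0
    have en : ∀ n, (ShortComplex.mk (d (n + 1)) (d n) (hd n)).Exact := fun n =>
      (ShortComplex.ShortExact.moduleCat_exact_iff_function_exact _).2 (hex n)
    cases n
    · rw [CochainComplex.quasiIsoAt₀_iff, ShortComplex.quasiIso_iff_of_zeros]
      · refine (ShortComplex.exact_and_mono_f_iff_of_iso ?_).2
          ⟨e0.op, inferInstanceAs (Mono p.op)⟩
        refine ShortComplex.isoMk (Iso.refl _) (Iso.refl _) (Iso.refl _) ?_ ?_
        · exact (Category.id_comp p.op).trans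
            ((CochainComplex.fromSingle₀Equiv_symm_apply_f_zero
              (C := opComplex K d hd) p.op (opComplex_condition K d hd p hp)).symm.trans (Category.comp_id _).symm)
        · change 𝟙 _ ≫ (opComplex K d hd).d 0 (0 + 1) = (d 0).op ≫ 𝟙 _
          rw [opComplex_d]
          exact (Category.id_comp (d 0).op).trans (Category.comp_id (d 0).op).symm
      all_goals rfl
    · rename_i n
      rw [quasiIsoAt_iff_exactAt]
      · rw [HomologicalComplex.exactAt_iff' _ n (n + 1) (n + 1 + 1) (by simp) (by simp)]
        refine (ShortComplex.exact_iff_of_iso ?_).2 (en n).op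
        refine ShortComplex.isoMk (Iso.refl _) (Iso.refl _) (Iso.refl _) ?_ ?_
        · change 𝟙 _ ≫ (d n).op = (opComplex K d hd).d n (n + 1) ≫ 𝟙 _
          rw [opComplex_d]
          exact (Category.id_comp (d n).op).trans (Category.comp_id (d n).op).symm
        · change 𝟙 _ ≫ (d (n + 1)).op = (opComplex K d hd).d (n + 1) (n + 1 + 1) ≫ 𝟙 _
          rw [opComplex_d]
          exact (Category.id_comp (d (n + 1)).op).trans (Category.comp_id (d (n + 1)).op).symm
      · apply CochainComplex.exactAt_succ_single_obj⟩


section RightDerived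

variable (G : (ModuleCat.{0} R)ᵒᵖ ⥤ ModuleCat.{0} R) [G.Additive]

theorem map_opComplex_d (K : ℕ → ModuleCat.{0} R) (d : ∀ n, K (n + 1) ⟶ K n)
    (hd : ∀ n, d (n + 1) ≫ d n = 0) (n : ℕ) :
    ((G.mapHomologicalComplex _).obj (opComplex K d hd)).d n (n + 1) = G.map (d n).op := by
  rw [Functor.mapHomologicalComplex_obj_d, opComplex_d]
  rfl

/-- The submodule of coboundaries of the cochain complex `G(K)`. -/
def coboundaries (K : ℕ → ModuleCat.{0} R) (d : ∀ n, K (n + 1) ⟶ K n) :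
    ∀ n, Submodule R (G.obj (Opposite.op (K n)))
  | 0 => ⊥
  | n + 1 => LinearMap.range (G.map (d n).op).hom

theorem range_map_opComplex_d (K : ℕ → ModuleCat.{0} R) (d : ∀ n, K (n + 1) ⟶ K n)
    (hd : ∀ n, d (n + 1) ≫ d n = 0) (n : ℕ) :
    LinearMap.range (((G.mapHomologicalComplex _).obj (opComplex K d hd)).d
      ((ComplexShape.up ℕ).prev n) n).hom = coboundaries G K d n := by
  cases n with
  | zero =>
    -- In degree `0` there is no predecessor, so `prev 0` is `0` itself and the differential in
    -- question vanishes by shape; this agrees with the convention that the coboundaries are `⊥`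
    -- there.
    rw [HomologicalComplex.shape _ _ _ (by simp)]
    exact LinearMap.range_zero
  | succ n =>
    have h : (ComplexShape.up ℕ).prev (n + 1) = n := by simp
    rw [h, map_opComplex_d]
    rfl

/-- Reduces vanishing of a derived functor to an elementwise condition on the complex: every cocycle
is a coboundary. -/
theorem isZero_rightDerived_of_exact (K : ℕ → ModuleCat.{0} R) (d : ∀ n, K (n + 1) ⟶ K n)
    (hd : ∀ n, d (n + 1) ≫ d n = 0) {M : ModuleCat.{0} R} (I : InjectiveResolution (Opposite.op M))
    (hI : I.cocomplex = opComplex K d hd) (n : ℕ)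
    (h : LinearMap.ker (G.map (d n).op).hom ≤ coboundaries G K d n) :
    Limits.IsZero ((G.rightDerived n).obj (Opposite.op M)) := by
  refine Limits.IsZero.of_iso ?_ (I.isoRightDerivedObj G n)
  rw [hI]
  refine (HomologicalComplex.exactAt_iff_isZero_homology _ _).1 ?_
  rw [HomologicalComplex.exactAt_iff' _ ((ComplexShape.up ℕ).prev n) n (n + 1) rfl (by simp),
    ShortComplex.moduleCat_exact_iff_ker_sub_range]
  change LinearMap.ker (((G.mapHomologicalComplex _).obj (opComplex K d hd)).d n (n + 1)).hom ≤
    LinearMap.range (((G.mapHomologicalComplex _).obj (opComplex K d hd)).d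
      ((ComplexShape.up ℕ).prev n) n).hom
  rwa [range_map_opComplex_d, map_opComplex_d]

/-- With zero outgoing differential all cochains are cocycles, so cohomology is the cokernel of the
incoming differential. This serves the top degree of a Koszul complex. -/
theorem rightDerived_iso_of_map_eq_zero (K : ℕ → ModuleCat.{0} R) (d : ∀ n, K (n + 1) ⟶ K n)
    (hd : ∀ n, d (n + 1) ≫ d n = 0) {M : ModuleCat.{0} R} (I : InjectiveResolution (Opposite.op M))
    (hI : I.cocomplex = opComplex K d hd) (n : ℕ) (h : G.map (d n).op = 0) :
    Nonempty ((G.rightDerived n).obj (Opposite.op M) ≅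
      ModuleCat.of R (G.obj (Opposite.op (K n)) ⧸ coboundaries G K d n)) := by
  refine ⟨I.isoRightDerivedObj G n ≪≫ ?_⟩
  rw [hI, ← range_map_opComplex_d G K d hd n]
  let L := (G.mapHomologicalComplex _).obj (opComplex K d hd)
  let S := L.sc' ((ComplexShape.up ℕ).prev n) n (n + 1)
  have hg : S.g = 0 := (map_opComplex_d G K d hd n).trans h
  exact ShortComplex.homologyMapIso (L.isoSc' ((ComplexShape.up ℕ).prev n) n (n + 1) rfl (by simp)) ≪≫
    (ShortComplex.LeftHomologyData.ofIsColimitCokernelCofork S hg _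
      (ModuleCat.cokernelIsColimit S.f)).homologyIso

end RightDerived

end Homological
end QuiverDMod

/-! ### Additive contravariant functors and mapping cones. -/

namespace QuiverDMod

section Koszul

variable {R : Type} [Ring R]

/-- The functorial map `G(B) → G(A)` induced by a linear map `A → B`. -/
noncomputable def pull (G : (ModuleCat.{0} R)ᵒᵖ ⥤ ModuleCat.{0} R) {A B : Type} [AddCommGroup A]
    [Module R A] [AddCommGroup B] [Module R B] (f : A →ₗ[R] B) :
    G.obj (Opposite.op (ModuleCat.of R B)) →ₗ[R] G.obj (Opposite.op (ModuleCat.of R A)) :=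
  (G.map (ModuleCat.ofHom f).op).hom

section pull

variable (G : (ModuleCat.{0} R)ᵒᵖ ⥤ ModuleCat.{0} R)
variable {A B E : Type} [AddCommGroup A] [Module R A] [AddCommGroup B] [Module R B]
  [AddCommGroup E] [Module R E]

theorem pull_id : pull G (LinearMap.id : A →ₗ[R] A) = LinearMap.id := by
  unfold pull
  rw [ModuleCat.ofHom_id, op_id, G.map_id]
  rfl

theorem pull_comp (f : A →ₗ[R] B) (g : B →ₗ[R] E) : pull G (g ∘ₗ f) = pull G f ∘ₗ pull G g := by
  unfold pull
  rw [ModuleCat.ofHom_comp, op_comp, G.map_comp]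
  rfl

theorem pull_pull (f : A →ₗ[R] B) (g : B →ₗ[R] E) (x) :
    pull G f (pull G g x) = pull G (g ∘ₗ f) x := by
  rw [pull_comp]; rfl

variable [G.Additive]

theorem pull_add (f g : A →ₗ[R] B) : pull G (f + g) = pull G f + pull G g := by
  unfold pull
  rw [ModuleCat.ofHom_add]
  exact congrArg ModuleCat.Hom.hom (G.map_add (f := (ModuleCat.ofHom f).op)
    (g := (ModuleCat.ofHom g).op))

theorem pull_zero : pull G (0 : A →ₗ[R] B) = 0 := by
  have h := pull_add G (0 : A →ₗ[R] B) 0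
  rwa [add_zero, left_eq_add] at h

theorem pull_neg (f : A →ₗ[R] B) : pull G (-f) = -pull G f := by
  have h := pull_add G f (-f)
  rw [add_neg_cancel, pull_zero] at h
  exact (neg_eq_of_add_eq_zero_right h.symm).symm

/-- An additive functor preserves biproducts: the identity of `A × B` is the sum of its two
idempotents, and this decomposition survives `G`. Together with `pull_prod_exists` it permits
working with pairs. -/
theorem pull_prod_ext {z w : G.obj (Opposite.op (ModuleCat.of R (A × B)))}
    (h1 : pull G (LinearMap.inl R A B) z = pull G (LinearMap.inl R A B) w)
    (h2 : pull G (LinearMap.inr R A B) z = pull G (LinearMap.inr R A B) w) : z = w := by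
  have key : ∀ y, y = pull G (LinearMap.fst R A B) (pull G (LinearMap.inl R A B) y) +
      pull G (LinearMap.snd R A B) (pull G (LinearMap.inr R A B) y) := by
    intro y
    rw [pull_pull, pull_pull, ← LinearMap.add_apply, ← pull_add]
    have : LinearMap.inl R A B ∘ₗ LinearMap.fst R A B + LinearMap.inr R A B ∘ₗ LinearMap.snd R A B
        = LinearMap.id := by
      ext <;> simp
    rw [this, pull_id]
    rfl
  rw [key z, key w, h1, h2]

theorem pull_prod_exists (a : G.obj (Opposite.op (ModuleCat.of R A)))
    (b : G.obj (Opposite.op (ModuleCat.of R B))) :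
    ∃ z, pull G (LinearMap.inl R A B) z = a ∧ pull G (LinearMap.inr R A B) z = b := by
  refine ⟨pull G (LinearMap.fst R A B) a + pull G (LinearMap.snd R A B) b, ?_, ?_⟩
  · rw [map_add, pull_pull, pull_pull, LinearMap.fst_comp_inl, LinearMap.snd_comp_inl, pull_id,
      pull_zero]
    simp
  · rw [map_add, pull_pull, pull_pull, LinearMap.fst_comp_inr, LinearMap.snd_comp_inr, pull_id,
      pull_zero]
    simp

theorem pull_obj_subsingleton [Subsingleton A] (x : G.obj (Opposite.op (ModuleCat.of R A))) :
    x = 0 := by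
  have h : (LinearMap.id : A →ₗ[R] A) = 0 := Subsingleton.elim _ _
  have h2 := congrArg (fun f => f x) (pull_id G (A := A))
  rw [h, pull_zero] at h2
  exact h2.symm

end pull

/-- The terms of the mapping cone of an endomorphism of a chain complex. -/
def coneX (K : ℕ → ModuleCat.{0} R) : ℕ → ModuleCat.{0} R
  | 0 => K 0
  | n + 1 => ModuleCat.of R (K (n + 1) × K n)

/-- The differential of the mapping cone of an endomorphism of a chain complex. -/
def coneD (K : ℕ → ModuleCat.{0} R) (d : ∀ n, K (n + 1) ⟶ K n) (Θ : ∀ n, K n →ₗ[R] K n) :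
    ∀ n, coneX K (n + 1) ⟶ coneX K n
  | 0 => ModuleCat.ofHom ((d 0).hom.coprod (Θ 0))
  | n + 1 => ModuleCat.ofHom (((d (n + 1)).hom.coprod (Θ (n + 1))).prod
      (-((d n).hom ∘ₗ LinearMap.snd R (K (n + 2)) (K (n + 1)))))

/-- The endomorphism of the cone induced by an endomorphism of the complex. -/
def coneΘ (K : ℕ → ModuleCat.{0} R) (Θ : ∀ n, K n →ₗ[R] K n) :
    ∀ n, coneX K n →ₗ[R] coneX K n
  | 0 => Θ 0
  | n + 1 => (Θ (n + 1)).prodMap (Θ n)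

theorem pull_coneD_inl (G : (ModuleCat.{0} R)ᵒᵖ ⥤ ModuleCat.{0} R) [G.Additive]
    (K : ℕ → ModuleCat.{0} R) (d : ∀ n, K (n + 1) ⟶ K n) (Θ : ∀ n, K n →ₗ[R] K n) (n : ℕ)
    (z : G.obj (Opposite.op (coneX K (n + 1)))) :
    pull G (LinearMap.inl R (K (n + 2)) (K (n + 1))) (pull G (coneD K d Θ (n + 1)).hom z) =
      pull G (d (n + 1)).hom (pull G (LinearMap.inl R (K (n + 1)) (K n)) z) := by
  refine (pull_pull G _ _ z).trans (Eq.trans ?_ (pull_pull G _ _ z).symm)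
  congr 2
  apply LinearMap.ext
  intro x
  change ((d (n + 1)).hom x + Θ (n + 1) 0, -((d n).hom 0)) = ((d (n + 1)).hom x, 0)
  simp

theorem pull_coneD_inr (G : (ModuleCat.{0} R)ᵒᵖ ⥤ ModuleCat.{0} R) [G.Additive]
    (K : ℕ → ModuleCat.{0} R) (d : ∀ n, K (n + 1) ⟶ K n) (Θ : ∀ n, K n →ₗ[R] K n) (n : ℕ)
    (z : G.obj (Opposite.op (coneX K (n + 1)))) :
    pull G (LinearMap.inr R (K (n + 2)) (K (n + 1))) (pull G (coneD K d Θ (n + 1)).hom z) =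
      pull G (Θ (n + 1)) (pull G (LinearMap.inl R (K (n + 1)) (K n)) z) -
        pull G (d n).hom (pull G (LinearMap.inr R (K (n + 1)) (K n)) z) := by
  rw [sub_eq_add_neg, ← LinearMap.neg_apply, ← pull_neg]
  refine (pull_pull G _ _ z).trans (Eq.trans ?_ (congrArg₂ (· + ·) (pull_pull G _ _ z).symm
    (pull_pull G _ _ z).symm))
  refine Eq.trans ?_ (LinearMap.congr_fun (pull_add G _ _) z)
  congr 2
  apply LinearMap.ext
  intro x
  change ((d (n + 1)).hom 0 + Θ (n + 1) x, -((d n).hom x)) =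
    (Θ (n + 1) x, 0) + (0, -(d n).hom x)
  simp

theorem pull_coneD_zero_inl (G : (ModuleCat.{0} R)ᵒᵖ ⥤ ModuleCat.{0} R) [G.Additive]
    (K : ℕ → ModuleCat.{0} R) (d : ∀ n, K (n + 1) ⟶ K n) (Θ : ∀ n, K n →ₗ[R] K n)
    (z : G.obj (Opposite.op (K 0))) :
    pull G (LinearMap.inl R (K 1) (K 0)) (pull G (coneD K d Θ 0).hom z) =
      pull G (d 0).hom z := by
  refine (pull_pull G _ _ z).trans ?_
  congr 2
  apply LinearMap.ext
  intro x
  change (d 0).hom x + Θ 0 0 = (d 0).hom x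
  simp

theorem pull_coneD_zero_inr (G : (ModuleCat.{0} R)ᵒᵖ ⥤ ModuleCat.{0} R) [G.Additive]
    (K : ℕ → ModuleCat.{0} R) (d : ∀ n, K (n + 1) ⟶ K n) (Θ : ∀ n, K n →ₗ[R] K n)
    (z : G.obj (Opposite.op (K 0))) :
    pull G (LinearMap.inr R (K 1) (K 0)) (pull G (coneD K d Θ 0).hom z) =
      pull G (Θ 0) z := by
  refine (pull_pull G _ _ z).trans ?_
  congr 2
  apply LinearMap.ext
  intro x
  change (d 0).hom 0 + Θ 0 x = Θ 0 x
  simp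

/-- In coordinates a coboundary of the cone is `(d*a, Θ*a + c)` with `c` a coboundary of the
original complex. Phrasing it with `coboundaries` treats degree `0`, where `c = 0`, together with
the higher degrees. -/
theorem mem_coboundaries_cone (G : (ModuleCat.{0} R)ᵒᵖ ⥤ ModuleCat.{0} R) [G.Additive]
    (K : ℕ → ModuleCat.{0} R) (d : ∀ n, K (n + 1) ⟶ K n) (Θ : ∀ n, K n →ₗ[R] K n) (n : ℕ)
    (z : G.obj (Opposite.op (coneX K (n + 1)))) :
    z ∈ coboundaries G (coneX K) (coneD K d Θ) (n + 1) ↔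
      ∃ a : G.obj (Opposite.op (K n)), ∃ c ∈ coboundaries G K d n,
        pull G (LinearMap.inl R (K (n + 1)) (K n)) z = pull G (d n).hom a ∧
        pull G (LinearMap.inr R (K (n + 1)) (K n)) z = pull G (Θ n) a + c := by
  cases n with
  | zero =>
    constructor
    · rintro ⟨a, rfl⟩
      exact ⟨a, 0, Submodule.zero_mem _, pull_coneD_zero_inl G K d Θ a,
        (pull_coneD_zero_inr G K d Θ a).trans (add_zero _).symm⟩
    · rintro ⟨a, c, hc, h1, h2⟩
      obtain rfl : c = 0 := hc
      refine ⟨a, pull_prod_ext G ?_ ?_⟩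
      · exact (pull_coneD_zero_inl G K d Θ a).trans h1.symm
      · exact (pull_coneD_zero_inr G K d Θ a).trans ((add_zero _).symm.trans h2.symm)
  | succ n =>
    constructor
    · rintro ⟨y, rfl⟩
      refine ⟨pull G (LinearMap.inl R (K (n + 1)) (K n)) y,
        -pull G (d n).hom (pull G (LinearMap.inr R (K (n + 1)) (K n)) y),
        Submodule.neg_mem _ ⟨_, rfl⟩, pull_coneD_inl G K d Θ n y, ?_⟩
      rw [← sub_eq_add_neg]
      exact pull_coneD_inr G K d Θ n y
    · rintro ⟨a, c, ⟨b, rfl⟩, h1, h2⟩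
      obtain ⟨y, hy1, hy2⟩ := pull_prod_exists G a (-b)
      refine ⟨y, pull_prod_ext G ?_ ?_⟩
      · refine (pull_coneD_inl G K d Θ n y).trans (Eq.trans ?_ h1.symm)
        exact congrArg _ hy1
      · refine (pull_coneD_inr G K d Θ n y).trans (Eq.trans ?_ h2.symm)
        refine (congrArg₂ (fun u v => pull G (Θ (n + 1)) u - pull G (d n).hom v) hy1 hy2).trans ?_
        rw [map_neg, sub_neg_eq_add]
        rfl

end Koszul
end QuiverDMod

/-! ### Koszul resolutions of regular families of commuting operators. -/

namespace QuiverDMod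

section Koszul

variable {R : Type} [Ring R]

/-- The sum of the ranges of the first `k` members of a family of endomorphisms. -/
def partialRange {F : Type*} [AddCommGroup F] [Module R F] {N : ℕ} (θ : Fin N → F →ₗ[R] F)
    (k : ℕ) : Submodule R F :=
  ⨆ i : Fin N, ⨆ _ : i.val < k, LinearMap.range (θ i)

theorem partialRange_zero {F : Type*} [AddCommGroup F] [Module R F] {N : ℕ}
    (θ : Fin N → F →ₗ[R] F) : partialRange θ 0 = ⊥ := by
  simp [partialRange]

theorem partialRange_succ {F : Type*} [AddCommGroup F] [Module R F] {N : ℕ}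
    (θ : Fin N → F →ₗ[R] F) (k : Fin N) :
    partialRange θ (k + 1) = partialRange θ k ⊔ LinearMap.range (θ k) := by
  apply le_antisymm
  · refine iSup_le fun i => iSup_le fun hi => ?_
    rcases (Nat.lt_succ_iff_lt_or_eq.1 hi) with h | h
    · exact le_sup_of_le_left (le_iSup_of_le i (le_iSup_of_le h le_rfl))
    · obtain rfl : i = k := Fin.ext h
      exact le_sup_right
  · refine sup_le (iSup_le fun i => iSup_le fun hi => ?_) ?_
    · exact le_iSup_of_le i (le_iSup_of_le (Nat.lt_succ_of_lt hi) le_rfl)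
    · exact le_iSup_of_le k (le_iSup_of_le (Nat.lt_succ_self _) le_rfl)

theorem partialRange_all {F : Type*} [AddCommGroup F] [Module R F] {N : ℕ}
    (θ : Fin N → F →ₗ[R] F) : partialRange θ N = ⨆ i, LinearMap.range (θ i) := by
  simp [partialRange]

/-- A commuting family of endomorphisms is regular if each of them is injective modulo the ranges
of the previous ones. -/
def IsRegularFamily {F : Type*} [AddCommGroup F] [Module R F] {N : ℕ}
    (θ : Fin N → F →ₗ[R] F) : Prop :=
  ∀ (k : Fin N) (x : F), θ k x ∈ partialRange θ k → x ∈ partialRange θ k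

variable (G : (ModuleCat.{0} R)ᵒᵖ ⥤ ModuleCat.{0} R) [G.Additive]

/-- A projective resolution of the quotient of `F` by the ranges of the first `k` operators,
of Koszul type, such that its image under `G` is exact except in degree `k`. -/
structure KoszulDatum (F : Type) [AddCommGroup F] [Module R F] {N : ℕ}
    (θ : Fin N → F →ₗ[R] F) (k : ℕ) where
  K : ℕ → ModuleCat.{0} R
  d : ∀ n, K (n + 1) ⟶ K n
  d_d : ∀ n x, (d n).hom ((d (n + 1)).hom x) = 0
  proj : ∀ n, Module.Projective R (K n)
  Θ : Fin N → ∀ n, K n →ₗ[R] K n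
  Θ_d : ∀ i n x, (d n).hom (Θ i (n + 1) x) = Θ i n ((d n).hom x)
  Θ_comm : ∀ i j n x, Θ i n (Θ j n x) = Θ j n (Θ i n x)
  bot : K 0 ≃ₗ[R] F
  bot_Θ : ∀ i x, bot (Θ i 0 x) = θ i (bot x)
  top : F ≃ₗ[R] K k
  top_Θ : ∀ i x, Θ i k (top x) = top (θ i x)
  subsingleton : ∀ n, k < n → Subsingleton (K n)
  exact_bot : ∀ x, bot x ∈ partialRange θ k ↔ ∃ y, (d 0).hom y = x
  exact : ∀ n x, (d n).hom x = 0 → ∃ y, (d (n + 1)).hom y = x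
  coexact : ∀ n < k, ∀ z, pull G (d n).hom z = 0 → z ∈ coboundaries G K d n
  cotop : ∀ z, z ∈ coboundaries G K d k ↔
    pull G top.toLinearMap z ∈ partialRange (fun i => pull G (θ i)) k

variable {F : Type} [AddCommGroup F] [Module R F] {N : ℕ} {θ : Fin N → F →ₗ[R] F}

/-- The complex with the single term `F`. -/
def singleX (F : Type) [AddCommGroup F] [Module R F] : ℕ → ModuleCat.{0} R
  | 0 => ModuleCat.of R F
  | _ + 1 => ModuleCat.of R PUnit

/-- Endomorphisms of the complex with the single term `F`. -/
def singleΘ (f : F →ₗ[R] F) : ∀ n, singleX (R := R) F n →ₗ[R] singleX (R := R) F n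
  | 0 => f
  | _ + 1 => 0

/-- The Koszul datum for the empty family. -/
def KoszulDatum.zero [Module.Projective R F] (hθ : ∀ i j x, θ i (θ j x) = θ j (θ i x)) :
    KoszulDatum G F θ 0 where
  K := singleX F
  d _ := 0
  d_d _ _ := rfl
  proj n := by
    cases n
    · exact ‹Module.Projective R F›
    · exact inferInstanceAs (Module.Projective R PUnit)
  Θ i := singleΘ (θ i)
  Θ_d i n x := by simp
  Θ_comm i j n x := by
    cases n
    · exact hθ i j x
    · rfl
  bot := LinearEquiv.refl R F
  bot_Θ _ _ := rfl
  top := LinearEquiv.refl R F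
  top_Θ _ _ := rfl
  subsingleton n hn := by
    cases n
    · exact absurd hn (lt_irrefl _)
    · exact inferInstanceAs (Subsingleton PUnit)
  exact_bot x := by
    rw [partialRange_zero, Submodule.mem_bot]
    exact ⟨fun h => ⟨0, h.symm⟩, fun ⟨y, hy⟩ => hy.symm⟩
  exact n x _ := ⟨0, Subsingleton.elim (α := PUnit) _ _⟩
  coexact n hn := absurd hn (Nat.not_lt_zero n)
  cotop z := by
    rw [partialRange_zero, Submodule.mem_bot]
    have h : pull G (LinearEquiv.refl R F).toLinearMap z = z :=
      congrArg (fun f => f z) (pull_id G)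
    exact h.symm ▸ Iff.rfl

variable {G}

theorem KoszulDatum.top_mem {k : ℕ} (D : KoszulDatum G F θ k) (i : Fin N) (z) :
    pull G D.top.toLinearMap (pull G (D.Θ i k) z) =
      pull G (θ i) (pull G D.top.toLinearMap z) := by
  refine (pull_pull G _ _ z).trans (Eq.trans ?_ (pull_pull G _ _ z).symm)
  congr 2
  exact LinearMap.ext fun x => D.top_Θ i x

theorem KoszulDatum.top_surjective {k : ℕ} (D : KoszulDatum G F θ k)
    (y : G.obj (Opposite.op (ModuleCat.of R F))) : ∃ z, pull G D.top.toLinearMap z = y := by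
  refine ⟨pull G D.top.symm.toLinearMap y, ?_⟩
  rw [pull_pull]
  have : D.top.symm.toLinearMap ∘ₗ D.top.toLinearMap = LinearMap.id := by ext; simp
  rw [this, pull_id]
  rfl

theorem KoszulDatum.pull_d_Θ {k : ℕ} (D : KoszulDatum G F θ k) (i : Fin N) (n : ℕ) (c) :
    pull G (D.d n).hom (pull G (D.Θ i n) c) = pull G (D.Θ i (n + 1)) (pull G (D.d n).hom c) := by
  refine (pull_pull G _ _ c).trans (Eq.trans ?_ (pull_pull G _ _ c).symm)
  congr 2
  exact LinearMap.ext fun x => (D.Θ_d i n x).symm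

/-- Below degree `k` the complex is exact after `G`. In degree `k` cohomology is the quotient of
`G(F)` by the first `k` pulled-back operators, on which the next one is injective by regularity. -/
theorem KoszulDatum.mem_coboundaries {k : Fin N} (D : KoszulDatum G F θ k)
    (hreg' : IsRegularFamily fun i => pull G (θ i)) {n : ℕ} (hn : n ≤ k) {z}
    (h1 : pull G (D.d n).hom z = 0) (h2 : pull G (D.Θ k n) z ∈ coboundaries G D.K D.d n) :
    z ∈ coboundaries G D.K D.d n := by
  rcases hn.lt_or_eq with h | rfl
  · exact D.coexact n h z h1
  · rw [D.cotop] at h2 ⊢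
    rw [D.top_mem] at h2
    exact hreg' k _ h2

/-- The mapping cone of the next operator on a Koszul datum. -/
def KoszulDatum.cone {k : Fin N} (D : KoszulDatum G F θ k) (hreg : IsRegularFamily θ)
    (hreg' : IsRegularFamily fun i => pull G (θ i)) : KoszulDatum G F θ (k + 1) where
  K := coneX D.K
  d := coneD D.K D.d (D.Θ k)
  d_d n x := by
    obtain ⟨x, y⟩ := x
    cases n with
    | zero =>
      change (D.d 0).hom ((D.d 1).hom x + D.Θ k 1 y) + D.Θ k 0 (-(D.d 0).hom y) = 0
      rw [map_add, D.d_d, D.Θ_d, map_neg, zero_add, add_neg_cancel]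
    | succ n =>
      change ((D.d (n + 1)).hom ((D.d (n + 2)).hom x + D.Θ k (n + 2) y) +
        D.Θ k (n + 1) (-(D.d (n + 1)).hom y), -(D.d n).hom (-(D.d (n + 1)).hom y)) = 0
      rw [map_add, D.d_d, D.Θ_d, map_neg, zero_add, add_neg_cancel, map_neg, D.d_d, neg_zero,
        neg_zero]
      rfl
  proj n := by
    cases n with
    | zero => exact D.proj 0
    | succ n =>
      have := D.proj n
      have := D.proj (n + 1)
      exact inferInstanceAs (Module.Projective R (D.K (n + 1) × D.K n))
  Θ i := coneΘ D.K (D.Θ i)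
  Θ_d i n x := by
    obtain ⟨x, y⟩ := x
    cases n with
    | zero =>
      change (D.d 0).hom (D.Θ i 1 x) + D.Θ k 0 (D.Θ i 0 y) = D.Θ i 0 ((D.d 0).hom x + D.Θ k 0 y)
      rw [map_add, D.Θ_d, D.Θ_comm]
    | succ n =>
      change ((D.d (n + 1)).hom (D.Θ i (n + 2) x) + D.Θ k (n + 1) (D.Θ i (n + 1) y),
        -(D.d n).hom (D.Θ i (n + 1) y)) =
        (D.Θ i (n + 1) ((D.d (n + 1)).hom x + D.Θ k (n + 1) y), D.Θ i n (-(D.d n).hom y))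
      rw [map_add, D.Θ_d, D.Θ_comm, D.Θ_d, map_neg]
  Θ_comm i j n x := by
    cases n with
    | zero => exact D.Θ_comm i j 0 x
    | succ n => exact Prod.ext (D.Θ_comm i j (n + 1) x.1) (D.Θ_comm i j n x.2)
  bot := D.bot
  bot_Θ := D.bot_Θ
  top :=
    have := D.subsingleton (k + 1) (Nat.lt_succ_self _)
    { toFun := fun x => ((0 : D.K (k + 1)), D.top x)
      map_add' := fun x y => by
        rw [map_add]; exact Prod.ext (add_zero _).symm rfl
      map_smul' := fun c x => by
        rw [map_smul]; exact Prod.ext (smul_zero _).symm rfl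
      invFun := fun z => D.top.symm z.2
      left_inv := fun x => D.top.symm_apply_apply x
      right_inv := fun z => Prod.ext (Subsingleton.elim _ _) (D.top.apply_symm_apply z.2) }
  top_Θ i x := Prod.ext (map_zero (D.Θ i (k + 1))) (D.top_Θ i x)
  subsingleton n hn := by
    cases n with
    | zero => exact absurd hn (Nat.not_lt_zero _)
    | succ n =>
      have := D.subsingleton n (Nat.lt_of_succ_lt_succ hn)
      have := D.subsingleton (n + 1) (Nat.lt_of_succ_lt hn)
      exact inferInstanceAs (Subsingleton (D.K (n + 1) × D.K n))
  exact_bot x := by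
    rw [partialRange_succ, Submodule.mem_sup]
    constructor
    · rintro ⟨a, ha, _, ⟨b, rfl⟩, hab⟩
      obtain ⟨y, hy⟩ := (D.exact_bot (D.bot.symm a)).1 (by rwa [D.bot.apply_symm_apply])
      refine ⟨(y, D.bot.symm b), ?_⟩
      change (D.d 0).hom y + D.Θ k 0 (D.bot.symm b) = x
      apply D.bot.injective
      rw [map_add, hy, D.bot_Θ, D.bot.apply_symm_apply, D.bot.apply_symm_apply]
      exact hab
    · rintro ⟨⟨y, b⟩, hy⟩
      change (D.d 0).hom y + D.Θ k 0 b = x at hy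
      refine ⟨_, (D.exact_bot _).2 ⟨y, rfl⟩, _, ⟨D.bot b, rfl⟩, ?_⟩
      rw [← D.bot_Θ, ← map_add, hy]
      rfl
  exact n x h := by
    obtain ⟨x, y⟩ := x
    have hy : ∃ z, (D.d n).hom z = -y := by
      cases n with
      | zero =>
        change (D.d 0).hom x + D.Θ k 0 y = 0 at h
        -- For a cycle of the cone in lowest degree, `Θ k` carries `y` to a boundary, that is, `θ k`
        -- carries `D.bot y` into the earlier ranges; regularity removes `θ k`.
        have h2 : D.bot y ∈ partialRange θ k := by
          apply hreg
          rw [← D.bot_Θ, D.exact_bot]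
          exact ⟨-x, by rw [map_neg]; exact (eq_neg_of_add_eq_zero_right h).symm⟩
        obtain ⟨z, hz⟩ := (D.exact_bot y).1 h2
        exact ⟨-z, by rw [map_neg, hz]⟩
      | succ n =>
        have h2 : -(D.d n).hom y = 0 := congrArg Prod.snd h
        obtain ⟨z, hz⟩ := D.exact n y (neg_eq_zero.1 h2)
        exact ⟨-z, by rw [map_neg, hz]⟩
    obtain ⟨z, hz⟩ := hy
    have h1 : (D.d n).hom x + D.Θ k n y = 0 := by
      cases n with
      | zero => exact h
      | succ n => exact congrArg Prod.fst h
    -- After correction by the preimage `z` of `-y`, the first component becomes a cycle of the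
    -- original complex.
    obtain ⟨w, hw⟩ := D.exact n (x - D.Θ k (n + 1) z) (by
      rw [map_sub, D.Θ_d, hz, map_neg, sub_neg_eq_add, h1])
    refine ⟨(w, z), ?_⟩
    change ((D.d (n + 1)).hom w + D.Θ k (n + 1) z, -(D.d n).hom z) = (x, y)
    rw [hw, hz, sub_add_cancel, neg_neg]
  coexact n hn z hz := by
    cases n with
    | zero =>
      have h1 : pull G (D.d 0).hom z = 0 := by
        refine (pull_coneD_zero_inl G D.K D.d (D.Θ k) z).symm.trans ?_
        exact (congrArg _ hz).trans (map_zero _)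
      have h2 : pull G (D.Θ k 0) z = 0 := by
        refine (pull_coneD_zero_inr G D.K D.d (D.Θ k) z).symm.trans ?_
        exact (congrArg _ hz).trans (map_zero _)
      exact D.mem_coboundaries hreg' (Nat.zero_le _) h1 (h2 ▸ Submodule.zero_mem _)
    | succ n =>
      have hnk : n < k := Nat.lt_of_succ_lt_succ hn
      have h1 := (pull_coneD_inl G D.K D.d (D.Θ k) n z).symm.trans
        ((congrArg _ hz).trans (map_zero _))
      have h2 := (pull_coneD_inr G D.K D.d (D.Θ k) n z).symm.trans
        ((congrArg _ hz).trans (map_zero _))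
      -- The first component is a cocycle whose image under `Θ k` is a coboundary, hence equals
      -- `d*a` for some `a`. Subtracting the contribution of `a` leaves in the second slot a cocycle
      -- of degree `n < k`, which is a coboundary by `coexact`.
      have h3 := D.mem_coboundaries hreg' hnk h1 (by
        rw [sub_eq_zero.1 h2]
        exact ⟨_, rfl⟩)
      obtain ⟨a, ha⟩ := h3
      refine (mem_coboundaries_cone G D.K D.d (D.Θ k) n z).2
        ⟨a, pull G (LinearMap.inr R (D.K (n + 1)) (D.K n)) z - pull G (D.Θ k n) a,
          D.coexact n hnk _ ?_, ha.symm, (add_sub_cancel _ _).symm⟩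
      rw [map_sub, D.pull_d_Θ, sub_eq_zero, ← sub_eq_zero.1 h2, ← ha]
      rfl
  cotop z := by
    have := D.subsingleton (k + 1) (Nat.lt_succ_self _)
    have htop : ∀ y : G.obj (Opposite.op (coneX D.K (k + 1))),
        pull G (show F →ₗ[R] coneX D.K (k + 1) from
          LinearMap.inr R (D.K (k + 1)) (D.K k) ∘ₗ D.top.toLinearMap) y =
        pull G D.top.toLinearMap (pull G (LinearMap.inr R (D.K (k + 1)) (D.K k)) y) :=
      fun y => (pull_pull G D.top.toLinearMap (LinearMap.inr R (D.K (k + 1)) (D.K k)) y).symm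
    refine (mem_coboundaries_cone G D.K D.d (D.Θ k) k z).trans (Iff.trans ?_
      (iff_of_eq (congrArg (· ∈ partialRange (fun i => pull G (θ i)) (k + 1)) (htop z).symm)))
    rw [partialRange_succ, Submodule.mem_sup]
    constructor
    · rintro ⟨a, c, hc, -, h2⟩
      refine ⟨_, (D.cotop c).1 hc, _, ⟨pull G D.top.toLinearMap a, rfl⟩, ?_⟩
      rw [h2, map_add, D.top_mem, add_comm]
    · rintro ⟨u, hu, _, ⟨v, rfl⟩, huv⟩
      obtain ⟨a, rfl⟩ := D.top_surjective v
      refine ⟨a, pull G (LinearMap.inr R (D.K (k + 1)) (D.K k)) z - pull G (D.Θ k k) a, ?_, ?_,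
        (add_sub_cancel _ _).symm⟩
      · rw [D.cotop, map_sub, D.top_mem, ← huv, add_sub_cancel_right]
        exact hu
      · exact (pull_obj_subsingleton G (A := D.K (k + 1)) _).trans
          (pull_obj_subsingleton G (A := D.K (k + 1)) _).symm

theorem exists_koszulDatum [Module.Projective R F] (hθ : ∀ i j x, θ i (θ j x) = θ j (θ i x))
    (hreg : IsRegularFamily θ) (hreg' : IsRegularFamily fun i => pull G (θ i)) (k : ℕ)
    (hk : k ≤ N) : Nonempty (KoszulDatum G F θ k) := by
  induction k with
  | zero => exact ⟨KoszulDatum.zero G hθ⟩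
  | succ k ih =>
    obtain ⟨D⟩ := ih (Nat.le_of_succ_le hk)
    exact ⟨KoszulDatum.cone (k := ⟨k, hk⟩) D hreg hreg'⟩

variable (G)

/-- The derived functors of `G` at the quotient of a projective module by a regular family of
commuting operators. -/
theorem rightDerived_of_isRegularFamily [Module.Projective R F]
    (hθ : ∀ i j x, θ i (θ j x) = θ j (θ i x)) (hreg : IsRegularFamily θ)
    (hreg' : IsRegularFamily fun i => pull G (θ i)) :
    Nonempty ((G.rightDerived N).obj
        (Opposite.op (ModuleCat.of R (F ⧸ ⨆ i, LinearMap.range (θ i)))) ≅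
      ModuleCat.of R (G.obj (Opposite.op (ModuleCat.of R F)) ⧸
        ⨆ i, LinearMap.range (pull G (θ i)))) ∧
    ∀ n, n ≠ N → Limits.IsZero ((G.rightDerived n).obj
      (Opposite.op (ModuleCat.of R (F ⧸ ⨆ i, LinearMap.range (θ i))))) := by
  obtain ⟨D⟩ := exists_koszulDatum (G := G) hθ hreg hreg' N le_rfl
  have hd : ∀ n, D.d (n + 1) ≫ D.d n = 0 := fun n => by
    ext x
    exact D.d_d n x
  let p : D.K 0 ⟶ ModuleCat.of R (F ⧸ ⨆ i, LinearMap.range (θ i)) :=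
    ModuleCat.ofHom ((⨆ i, LinearMap.range (θ i)).mkQ ∘ₗ D.bot.toLinearMap)
  have hp0 : ∀ x, p.hom x = 0 ↔ ∃ y, (D.d 0).hom y = x := fun x => by
    rw [← D.exact_bot, partialRange_all]
    exact Submodule.Quotient.mk_eq_zero _
  let I := opResolution D.K D.d hd p (by ext y; exact (hp0 _).2 ⟨y, rfl⟩)
    ((Submodule.mkQ_surjective _).comp D.bot.surjective) (fun x => hp0 x)
    (fun n x => ⟨D.exact n x, fun ⟨y, hy⟩ => hy ▸ D.d_d n y⟩) D.proj
  constructor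
  -- The resolution ends in degree `N`: its next term is zero.
  · have hz : G.map (D.d N).op = 0 := by
      have := D.subsingleton (N + 1) (Nat.lt_succ_self _)
      ext z
      exact pull_obj_subsingleton G (A := D.K (N + 1)) _
    obtain ⟨e⟩ := rightDerived_iso_of_map_eq_zero G D.K D.d hd I rfl N hz
    refine ⟨e ≪≫ (Submodule.Quotient.equiv _ _
      (LinearEquiv.ofBijective (pull G D.top.toLinearMap) ⟨?_, D.top_surjective⟩) ?_).toModuleIso⟩
    · intro x y hxy
      have h1 := congrArg (pull G D.top.symm.toLinearMap) hxy
      have h2 : D.top.toLinearMap ∘ₗ D.top.symm.toLinearMap = LinearMap.id := by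
        ext; simp
      rw [pull_pull, pull_pull, h2, pull_id] at h1
      exact h1
    · ext y
      rw [← partialRange_all]
      constructor
      · rintro ⟨z, hz, rfl⟩
        exact (D.cotop z).1 hz
      · intro hy
        obtain ⟨z, rfl⟩ := D.top_surjective y
        exact ⟨z, (D.cotop z).2 hy, rfl⟩
  · intro n hn
    refine isZero_rightDerived_of_exact G D.K D.d hd I rfl n ?_
    intro z hz
    rcases lt_or_gt_of_ne hn with h | h
    · exact D.coexact n h z hz
    · have := D.subsingleton n h
      rw [pull_obj_subsingleton G (A := D.K n) z]
      exact Submodule.zero_mem _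

end Koszul
end QuiverDMod

/-! ### Monomials in commuting elements and multi-indices. -/

namespace QuiverDMod

section CommPow

variable {M : Type*} [Monoid M] {N : ℕ}

/-- Monomials in commuting elements of a monoid. -/
def commPow (q : Fin N → M) (hq : ∀ i j, Commute (q i) (q j)) (α : Fin N → ℕ) : M :=
  MonoidHom.noncommPiCoprod (fun i => powersHom M (q i))
    (fun i j _ x y => by
      rw [powersHom_apply, powersHom_apply]
      exact (hq i j).pow_pow _ _) (fun i => Multiplicative.ofAdd (α i))

variable (q : Fin N → M) (hq : ∀ i j, Commute (q i) (q j))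

theorem commPow_zero : commPow q hq 0 = 1 :=
  map_one (MonoidHom.noncommPiCoprod (fun i => powersHom M (q i)) _)

theorem commPow_add (α β : Fin N → ℕ) :
    commPow q hq (α + β) = commPow q hq α * commPow q hq β :=
  map_mul (MonoidHom.noncommPiCoprod (fun i => powersHom M (q i)) _)
    (fun i => Multiplicative.ofAdd (α i)) (fun i => Multiplicative.ofAdd (β i))

theorem commPow_single (i : Fin N) : commPow q hq (Pi.single i 1) = q i := by
  have h := MonoidHom.noncommPiCoprod_mulSingle (ϕ := fun i => powersHom M (q i))
    (hcomm := fun i j _ x y => by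
      rw [powersHom_apply, powersHom_apply]
      exact (hq i j).pow_pow _ _) i (Multiplicative.ofAdd 1)
  rw [powersHom_apply, toAdd_ofAdd, pow_one] at h
  rw [← h]
  unfold commPow
  congr 1

theorem commPow_add_single (α : Fin N → ℕ) (i : Fin N) :
    commPow q hq (α + Pi.single i 1) = q i * commPow q hq α := by
  rw [add_comm, commPow_add, commPow_single]

theorem commPow_add_single' (α : Fin N → ℕ) (i : Fin N) :
    commPow q hq (α + Pi.single i 1) = commPow q hq α * q i := by
  rw [commPow_add, commPow_single]

/-- The total degree of a multi-index. -/
def mdeg (α : Fin N → ℕ) : ℕ := ∑ i, α i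

theorem mdeg_add_single (α : Fin N → ℕ) (i : Fin N) : mdeg (α + Pi.single i 1) = mdeg α + 1 := by
  simp [mdeg, Finset.sum_add_distrib]

theorem exists_eq_add_single {α : Fin N → ℕ} {i : Fin N} (h : α i ≠ 0) :
    ∃ β : Fin N → ℕ, α = β + Pi.single i 1 := by
  refine ⟨α - Pi.single i 1, ?_⟩
  funext j
  rcases eq_or_ne j i with rfl | hj
  · simp; omega
  · simp [hj]

theorem multiIndex_induction {p : (Fin N → ℕ) → Prop} (h0 : p 0)
    (hs : ∀ α i, p α → p (α + Pi.single i 1)) (α : Fin N → ℕ) : p α := by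
  induction h : mdeg α generalizing α with
  | zero =>
    have : α = 0 := by
      funext i
      have := Finset.sum_eq_zero_iff.1 h i (Finset.mem_univ i)
      simpa using this
    rwa [this]
  | succ n ih =>
    have : ∃ i, α i ≠ 0 := by
      by_contra! hc
      have : mdeg α = 0 := Finset.sum_eq_zero fun i _ => hc i
      omega
    obtain ⟨i, hi⟩ := this
    obtain ⟨β, rfl⟩ := exists_eq_add_single hi
    rw [mdeg_add_single] at h
    exact hs β i (ih β (by omega))

end CommPow

/-! ### The degree filtration and a criterion for regularity. -/

section Regular

variable {N : ℕ} {U : Type*} [AddCommGroup U]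

/-- The families supported in degrees less than `n`. -/
def degLT (N : ℕ) (U : Type*) [AddCommGroup U] (n : ℕ) : AddSubgroup ((Fin N → ℕ) →₀ U) where
  carrier := {c | ∀ α, n ≤ mdeg α → c α = 0}
  zero_mem' := by intro α _; rfl
  add_mem' := by
    intro a b ha hb α h
    rw [Finsupp.add_apply, ha α h, hb α h, add_zero]
  neg_mem' := by
    intro a ha α h
    rw [Finsupp.neg_apply, ha α h, neg_zero]

theorem single_mem_degLT {α : Fin N → ℕ} {u : U} {n : ℕ} (h : mdeg α < n) :
    Finsupp.single α u ∈ degLT N U n := by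
  intro β hβ
  rw [Finsupp.single_apply, if_neg]
  rintro rfl
  omega

theorem degLT_mono {m n : ℕ} (h : m ≤ n) : degLT N U m ≤ degLT N U n :=
  fun _ hc α hα => hc α (h.trans hα)

theorem exists_mem_degLT (c : (Fin N → ℕ) →₀ U) : ∃ n, c ∈ degLT N U n := by
  refine ⟨c.support.sup mdeg + 1, fun α hα => ?_⟩
  by_contra h
  have := Finset.le_sup (f := mdeg) (Finsupp.mem_support_iff.2 h)
  omega

/-- Filtration estimates for additive maps are checked on monomials; this is the form in which every
later degree bound is proved. -/
theorem map_mem_of_single {A : Type*} [AddCommGroup A] (S : AddSubgroup A) (n : ℕ)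
    (f : ((Fin N → ℕ) →₀ U) →+ A) (hf : ∀ α u, mdeg α < n → f (Finsupp.single α u) ∈ S)
    {c : (Fin N → ℕ) →₀ U} (hc : c ∈ degLT N U n) : f c ∈ S := by
  rw [← Finsupp.sum_single c, Finsupp.sum, map_sum]
  refine AddSubgroup.sum_mem _ fun α hα => hf α _ ?_
  by_contra h
  exact (Finsupp.mem_support_iff.1 hα) (hc α (not_lt.1 h))

/-- Such a map is unitriangular for the degree filtration. Induction on the degree shows that the
kernel vanishes and that preimages are obtained by successive correction of lower order terms. -/
theorem bijective_of_sub_mem_degLT (E : ((Fin N → ℕ) →₀ U) →+ ((Fin N → ℕ) →₀ U))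
    (hE : ∀ α u, E (Finsupp.single α u) - Finsupp.single α u ∈ degLT N U (mdeg α)) :
    Function.Bijective E := by
  have key : ∀ n c, c ∈ degLT N U (n + 1) → E c - c ∈ degLT N U n := fun n c hc =>
    map_mem_of_single (degLT N U n) (n + 1) (E - AddMonoidHom.id _)
      (fun α u h => degLT_mono (Nat.le_of_lt_succ h) (hE α u)) hc
  have h0 : ∀ c, c ∈ degLT N U 0 → c = 0 := fun c hc => Finsupp.ext fun α => hc α (Nat.zero_le _)
  constructor
  · rw [injective_iff_map_eq_zero]
    intro c hc
    obtain ⟨n, hn⟩ := exists_mem_degLT c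
    induction n with
    | zero => exact h0 c hn
    | succ n ih =>
      refine ih ?_
      have := key n c hn
      rw [hc, zero_sub] at this
      simpa using (degLT N U n).neg_mem this
  · intro c
    obtain ⟨n, hn⟩ := exists_mem_degLT c
    induction n generalizing c with
    | zero => exact ⟨0, by rw [h0 c hn, map_zero]⟩
    | succ n ih =>
      obtain ⟨y, hy⟩ := ih _ (key n c hn)
      exact ⟨c - y, by rw [map_sub, hy, sub_sub_cancel]⟩

variable {R : Type} [Ring R] {F : Type*} [AddCommGroup F] [Module R F]

/-- Through `E` the operators become multiplication by the variables on polynomials with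
coefficients in `U`, and the variables form a regular sequence. Only additivity of `E` is needed. -/
theorem isRegularFamily_of_equiv {θ : Fin N → F →ₗ[R] F} (E : ((Fin N → ℕ) →₀ U) ≃+ F)
    (hE : ∀ i α u, E (Finsupp.single (α + Pi.single i 1) u) = θ i (E (Finsupp.single α u))) :
    IsRegularFamily θ := by
  have hE' : ∀ i c, E (Finsupp.mapDomain (· + Pi.single i 1) c) = θ i (E c) := by
    intro i c
    induction c using Finsupp.induction_linear with
    | zero => simp
    | add a b ha hb => rw [Finsupp.mapDomain_add, map_add, ha, hb, map_add, map_add]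
    | single α u => rw [Finsupp.mapDomain_single, hE]
  -- The ideal of the first `k` variables: no monomial free of all of them occurs. Multiplication by
  -- a later variable does not affect this condition.
  have hmem : ∀ (k : ℕ) (c : (Fin N → ℕ) →₀ U), E c ∈ partialRange θ k ↔
      ∀ α, (∀ i : Fin N, i.val < k → α i = 0) → c α = 0 := by
    intro k c
    constructor
    · suffices h : ∀ x ∈ partialRange θ k, ∀ α : Fin N → ℕ,
          (∀ i : Fin N, i.val < k → α i = 0) → E.symm x α = 0 by
        intro hc
        simpa using h _ hc
      intro x hx
      refine Submodule.iSup_induction _ (motive := fun x => ∀ α : Fin N → ℕ,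
          (∀ i : Fin N, i.val < k → α i = 0) → E.symm x α = 0) hx ?_ ?_ ?_
      · intro i y hy α hα
        by_cases hi : i.val < k
        · rw [iSup_pos hi] at hy
          obtain ⟨z, rfl⟩ := hy
          obtain ⟨c, rfl⟩ := E.surjective z
          rw [← hE', E.symm_apply_apply]
          apply Finsupp.mapDomain_of_notMem_range
          rintro ⟨β, rfl⟩
          simpa using hα i hi
        · rw [iSup_neg hi] at hy
          rw [(Submodule.mem_bot R).1 hy, map_zero]; rfl
      · intro α _
        rw [map_zero]; rfl
      · intro x y hx hy α hα
        rw [map_add, Finsupp.add_apply, hx α hα, hy α hα, add_zero]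
    · intro h
      rw [← Finsupp.sum_single c, Finsupp.sum, map_sum]
      refine Submodule.sum_mem _ fun α hα => ?_
      have : ∃ i : Fin N, i.val < k ∧ α i ≠ 0 := by
        by_contra! hc
        exact (Finsupp.mem_support_iff.1 hα) (h α hc)
      obtain ⟨i, hi, hαi⟩ := this
      obtain ⟨β, rfl⟩ := exists_eq_add_single hαi
      rw [hE]
      exact Submodule.mem_iSup_of_mem i (Submodule.mem_iSup_of_mem hi ⟨_, rfl⟩)
  intro k x hx
  obtain ⟨c, rfl⟩ := E.surjective x
  rw [← hE', hmem] at hx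
  rw [hmem]
  intro α hα
  have h := hx (α + Pi.single k 1) (fun i hi => by
    have hik : i ≠ k := fun h => by rw [h] at hi; exact lt_irrefl _ hi
    simp [hα i hi, hik])
  rwa [Finsupp.mapDomain_apply (add_left_injective _)] at h

/-- A commuting family that differs from a family of shifts by terms of smaller degree is
regular. -/
theorem isRegularFamily_of_shift {θ : Fin N → F →ₗ[R] F} (hθ : ∀ i j, Commute (θ i) (θ j))
    (Ψ : ((Fin N → ℕ) →₀ U) ≃+ F)
    (h : ∀ i α u, Ψ.symm (θ i (Ψ (Finsupp.single α u))) - Finsupp.single (α + Pi.single i 1) u ∈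
      degLT N U (mdeg α + 1)) : IsRegularFamily θ := by
  -- `E` replaces the monomial of exponent `α` by `θ^α` applied to the constant, so it intertwines
  -- shifts with the `θ i` exactly.
  let E : ((Fin N → ℕ) →₀ U) →+ F := Finsupp.liftAddHom fun α =>
    (commPow (M := Module.End R F) θ hθ α).toAddMonoidHom.comp
      (Ψ.toAddMonoidHom.comp (Finsupp.singleAddHom 0))
  have hE : ∀ α u, E (Finsupp.single α u) =
      commPow (M := Module.End R F) θ hθ α (Ψ (Finsupp.single 0 u)) := by
    intro α u
    simp [E]
  have hstep : ∀ i n c, c ∈ degLT N U n →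
      Ψ.symm (θ i (Ψ c)) - Finsupp.mapDomain (· + Pi.single i 1) c ∈ degLT N U n := by
    intro i n c hc
    refine map_mem_of_single (degLT N U n) n
      (Ψ.symm.toAddMonoidHom.comp ((θ i).toAddMonoidHom.comp Ψ.toAddMonoidHom) -
        Finsupp.mapDomain.addMonoidHom (· + Pi.single i 1)) (fun α u hα => ?_) hc
    have := degLT_mono (Nat.succ_le_of_lt hα) (h i α u)
    simpa [Finsupp.mapDomain_single] using this
  have hshift : ∀ i n c, c ∈ degLT N U n →
      Ψ.symm (θ i (Ψ c)) ∈ degLT N U (n + 1) := by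
    intro i n c hc
    have h1 := degLT_mono n.le_succ (hstep i n c hc)
    have h2 : Finsupp.mapDomain (· + Pi.single i 1) c ∈ degLT N U (n + 1) := by
      refine map_mem_of_single (degLT N U (n + 1)) n
        (Finsupp.mapDomain.addMonoidHom (· + Pi.single i 1)) (fun α u hα => ?_) hc
      have := single_mem_degLT (u := u) (by
        rw [mdeg_add_single]; omega : mdeg (α + Pi.single i 1) < n + 1)
      simpa [Finsupp.mapDomain_single] using this
    simpa using (degLT N U (n + 1)).add_mem h1 h2
  -- Each application of `θ i` agrees with the shift up to lower degree, so by induction on `α` the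
  -- composite is unitriangular.
  have hbij : Function.Bijective (Ψ.symm.toAddMonoidHom.comp E) := by
    refine bijective_of_sub_mem_degLT _ fun α u => ?_
    change Ψ.symm (E (Finsupp.single α u)) - _ ∈ _
    rw [hE]
    induction α using multiIndex_induction with
    | h0 =>
      rw [commPow_zero]
      simp
    | hs α i ih =>
      rw [commPow_add_single, mdeg_add_single]
      change Ψ.symm (θ i (commPow (M := Module.End R F) θ hθ α (Ψ (Finsupp.single 0 u)))) - _ ∈ _
      have h1 := hshift i _ _ ih
      rw [map_sub, map_sub, map_sub, Ψ.apply_symm_apply] at h1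
      simpa using (degLT N U _).add_mem h1 (h i α u)
  refine isRegularFamily_of_equiv (AddEquiv.ofBijective E ?_) fun i α u => ?_
  · exact (Function.Bijective.of_comp_iff' Ψ.symm.bijective _).1 hbij
  · change E _ = θ i (E _)
    rw [hE, hE, commPow_add_single]
    rfl

end Regular
end QuiverDMod

/-! ### Normal ordering in algebras of Weyl type. -/

namespace QuiverDMod

noncomputable section PBW

variable {O D : Type} [CommRing O] [Algebra ℂ O] [Ring D] [Algebra ℂ D] {N : ℕ}

/-- Normal ordering: the elements `∑ j(f_α) q^α` for a homomorphism `j` and commuting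
elements `q`. -/
def normalOrder (j : O →ₐ[ℂ] D) (q : Fin N → D) (hq : ∀ i k, Commute (q i) (q k)) :
    ((Fin N → ℕ) →₀ O) →ₗ[ℂ] D :=
  Finsupp.lsum ℂ fun α => LinearMap.mulRight ℂ (commPow q hq α) ∘ₗ j.toLinearMap

theorem normalOrder_single (j : O →ₐ[ℂ] D) (q : Fin N → D) (hq : ∀ i k, Commute (q i) (q k))
    (α : Fin N → ℕ) (f : O) :
    normalOrder j q hq (Finsupp.single α f) = j f * commPow q hq α := by
  simp [normalOrder]

variable {j : O →ₐ[ℂ] D} {q : Fin N → D} {hq : ∀ i k, Commute (q i) (q k)}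

/-- The elements of filtration less than `n`. -/
def pbwFil (j : O →ₐ[ℂ] D) (q : Fin N → D) (hq : ∀ i k, Commute (q i) (q k)) (n : ℕ) :
    AddSubgroup D :=
  (degLT N O n).map (normalOrder j q hq).toAddMonoidHom

theorem single_mem_pbwFil (f : O) {α : Fin N → ℕ} {n : ℕ} (h : mdeg α < n) :
    j f * commPow q hq α ∈ pbwFil j q hq n :=
  ⟨_, single_mem_degLT h, normalOrder_single j q hq α f⟩

theorem mul_mem_pbwFil (f : O) {n : ℕ} {d : D} (hd : d ∈ pbwFil j q hq n) :
    j f * d ∈ pbwFil j q hq n := by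
  obtain ⟨c, hc, rfl⟩ := hd
  refine map_mem_of_single (pbwFil j q hq n) n
    ((AddMonoidHom.mulLeft (j f)).comp (normalOrder j q hq).toAddMonoidHom) (fun α u h => ?_) hc
  change j f * normalOrder j q hq (Finsupp.single α u) ∈ _
  rw [normalOrder_single, ← mul_assoc, ← map_mul]
  exact single_mem_pbwFil _ h

theorem gen_mul_mem_pbwFil (hskew : ∀ i f, ∃ g, q i * j f = j f * q i + j g)
    (i : Fin N) {n : ℕ} {d : D} (hd : d ∈ pbwFil j q hq n) :
    q i * d ∈ pbwFil j q hq (n + 1) := by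
  obtain ⟨c, hc, rfl⟩ := hd
  refine map_mem_of_single (pbwFil j q hq (n + 1)) n
    ((AddMonoidHom.mulLeft (q i)).comp (normalOrder j q hq).toAddMonoidHom) (fun α u h => ?_) hc
  change q i * normalOrder j q hq (Finsupp.single α u) ∈ _
  obtain ⟨g, hg⟩ := hskew i u
  rw [normalOrder_single, ← mul_assoc, hg, add_mul, mul_assoc, ← commPow_add_single]
  refine AddSubgroup.add_mem _ (single_mem_pbwFil _ ?_) (single_mem_pbwFil _ ?_)
  · rw [mdeg_add_single]; omega
  · omega

/-- Moving a coefficient to the left through the `q i` creates only terms of lower order, so right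
multiplication by a coefficient does not raise the filtration. -/
theorem commPow_mul_mem_pbwFil (hskew : ∀ i f, ∃ g, q i * j f = j f * q i + j g)
    (α : Fin N → ℕ) (g : O) :
    commPow q hq α * j g ∈ pbwFil j q hq (mdeg α + 1) := by
  induction α using multiIndex_induction with
  | h0 =>
    have := single_mem_pbwFil (j := j) (q := q) (hq := hq) g
      (Nat.lt_succ_self (mdeg (0 : Fin N → ℕ)))
    rw [commPow_zero, mul_one] at this
    rwa [commPow_zero, one_mul]
  | hs α i ih =>
    rw [commPow_add_single, mdeg_add_single, mul_assoc]
    exact gen_mul_mem_pbwFil hskew i ih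

variable {W : Type} [AddCommGroup W] [Module ℂ W]

/-- The normal ordering isomorphism with coefficients in a vector space. -/
def normalOrderTensor (hbij : Function.Bijective (normalOrder j q hq)) (W : Type)
    [AddCommGroup W] [Module ℂ W] : ((Fin N → ℕ) →₀ (O ⊗[ℂ] W)) ≃ₗ[ℂ] D ⊗[ℂ] W :=
  (TensorProduct.finsuppLeft ℂ ℂ O W (Fin N → ℕ)).symm ≪≫ₗ
    TensorProduct.congr (LinearEquiv.ofBijective _ hbij) (LinearEquiv.refl ℂ W)

theorem normalOrderTensor_single (hbij : Function.Bijective (normalOrder j q hq))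
    (α : Fin N → ℕ) (f : O) (w : W) :
    normalOrderTensor hbij W (Finsupp.single α (f ⊗ₜ w)) = (j f * commPow q hq α) ⊗ₜ w := by
  rw [← normalOrder_single]
  simp [normalOrderTensor]

theorem normalOrderTensor_symm_mem (hbij : Function.Bijective (normalOrder j q hq)) {n : ℕ}
    {d : D} (hd : d ∈ pbwFil j q hq n) (w : W) :
    (normalOrderTensor hbij W).symm (d ⊗ₜ w) ∈ degLT N (O ⊗[ℂ] W) n := by
  obtain ⟨c, hc, rfl⟩ := hd
  refine map_mem_of_single (degLT N (O ⊗[ℂ] W) n) n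
    ((normalOrderTensor hbij W).symm.toLinearMap.toAddMonoidHom.comp
      (((TensorProduct.mk ℂ D W).flip w).toAddMonoidHom.comp
        (normalOrder j q hq).toAddMonoidHom)) (fun α u h => ?_) hc
  change (normalOrderTensor hbij W).symm (normalOrder j q hq (Finsupp.single α u) ⊗ₜ w) ∈ _
  rw [normalOrder_single, ← normalOrderTensor_single hbij, LinearEquiv.symm_apply_apply]
  exact single_mem_degLT h

/-- Commuting endomorphisms of `D ⊗ W` of the form `w ↦ qᵢ w + (terms in O ⊗ W)` form a regular
family. -/
theorem isRegularFamily_of_normalOrder (hskew : ∀ i f, ∃ g, q i * j f = j f * q i + j g)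
    (hbij : Function.Bijective (normalOrder j q hq))
    {θ : Fin N → D ⊗[ℂ] W →ₗ[D] D ⊗[ℂ] W} (hθ : ∀ i k, Commute (θ i) (θ k))
    (h : ∀ i w, ∃ y : O ⊗[ℂ] W,
      θ i (1 ⊗ₜ w) = q i ⊗ₜ w + TensorProduct.map j.toLinearMap LinearMap.id y) :
    IsRegularFamily θ := by
  refine isRegularFamily_of_shift hθ (normalOrderTensor hbij W).toAddEquiv fun i α u => ?_
  change (normalOrderTensor hbij W).symm (θ i (normalOrderTensor hbij W (Finsupp.single α u))) -
    _ ∈ _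
  have hsub : ∀ a b c : (Fin N → ℕ) →₀ (O ⊗[ℂ] W), a = c + b →
      b ∈ degLT N (O ⊗[ℂ] W) (mdeg α + 1) → a - c ∈ degLT N (O ⊗[ℂ] W) (mdeg α + 1) := by
    intro a b c h hb
    have e : a - c = b := Finsupp.ext fun x => by
      rw [Finsupp.sub_apply, h, Finsupp.add_apply]
      exact add_sub_cancel_left _ _
    rwa [e]
  induction u using TensorProduct.induction_on with
  | zero => exact hsub _ 0 _ (by simp) (AddSubgroup.zero_mem _)
  | add u v hu hv =>
    have := AddSubgroup.add_mem _ hu hv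
    rw [Finsupp.single_add, Finsupp.single_add, map_add, map_add, map_add]
    convert this using 1
    abel
  | tmul f w =>
    obtain ⟨y, hy⟩ := h i w
    -- By left `D`-linearity, `θ i` acts on the right of the coefficient: it appends `q i` to the
    -- monomial and adds a term `j(f) q^α y` with `y` free of `q`, whose order is at most the degree
    -- of `α`.
    have e1 : θ i (normalOrderTensor hbij W (Finsupp.single α (f ⊗ₜ w))) =
        normalOrderTensor hbij W (Finsupp.single (α + Pi.single i 1) (f ⊗ₜ w)) +
          (j f * commPow q hq α) • TensorProduct.map j.toLinearMap LinearMap.id y := by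
      have : (j f * commPow q hq α) ⊗ₜ[ℂ] w = (j f * commPow q hq α) • ((1 : D) ⊗ₜ[ℂ] w) := by
        rw [TensorProduct.smul_tmul', smul_eq_mul, mul_one]
      rw [normalOrderTensor_single, normalOrderTensor_single, this, map_smul, hy, smul_add,
        TensorProduct.smul_tmul', smul_eq_mul, mul_assoc, ← commPow_add_single']
    refine hsub _ _ _ (by rw [e1, map_add, LinearEquiv.symm_apply_apply]) ?_
    clear e1 hy
    induction y using TensorProduct.induction_on with
    | zero =>
      rw [map_zero, smul_zero, map_zero]
      exact AddSubgroup.zero_mem _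
    | add u v hu hv =>
      rw [map_add, smul_add, map_add]
      exact AddSubgroup.add_mem _ hu hv
    | tmul g w' =>
      rw [TensorProduct.map_tmul, TensorProduct.smul_tmul', smul_eq_mul]
      refine normalOrderTensor_symm_mem hbij ?_ _
      rw [mul_assoc]
      exact mul_mem_pbwFil f (commPow_mul_mem_pbwFil hskew α g)

end PBW
end QuiverDMod

/-! ### Differential operators on a variety with global coordinates. -/

namespace QuiverDMod

noncomputable section DiffOps

variable {O : Type} [CommRing O] [Algebra ℂ O] {N : ℕ}

variable (O) in
/-- The inclusion of functions into differential operators. -/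
def DOp.fnHom : O →ₐ[ℂ] DOp O where
  toFun := DOp.fn
  map_one' := DOp.fn_one
  map_mul' := DOp.fn_mul
  map_zero' := DOp.fn_zero
  map_add' := DOp.fn_add
  commutes' c := by
    apply Subtype.ext
    ext g
    exact (Algebra.smul_def c g).symm

theorem DOp.fnHom_apply (f : O) : DOp.fnHom O f = DOp.fn f := rfl

variable (O) in
/-- Vector fields as differential operators. -/
def DOp.vfHom : Derivation ℂ O O →ₗ[ℂ] DOp O where
  toFun := DOp.vf
  map_add' _ _ := rfl
  map_smul' _ _ := rfl

theorem DOp.vf_add (ξ η : Derivation ℂ O O) : DOp.vf (ξ + η) = DOp.vf ξ + DOp.vf η := rfl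

theorem DOp.vf_sum {ι : Type*} (s : Finset ι) (ξ : ι → Derivation ℂ O O) :
    DOp.vf (∑ i ∈ s, ξ i) = ∑ i ∈ s, DOp.vf (ξ i) :=
  map_sum (DOp.vfHom O) ξ s

theorem DOp.fn_injective : Function.Injective (DOp.fn : O → DOp O) := by
  intro f g h
  have h2 := congrArg (fun d : DOp O => d.1 (1 : O)) h
  change f * 1 = g * 1 at h2
  simpa using h2

variable (O N) in
/-- Coordinates on a variety: functions `xᵢ` and vector fields `∂ᵢ` with `∂ᵢ xⱼ = δᵢⱼ`, such that
a vector field killing all `xᵢ` is zero. -/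
structure Coordinates where
  x : Fin N → O
  der : Fin N → Derivation ℂ O O
  der_x : ∀ i j, der i (x j) = if i = j then 1 else 0
  eq_zero : ∀ ξ : Derivation ℂ O O, (∀ j, ξ (x j) = 0) → ξ = 0

namespace Coordinates

variable (c : Coordinates O N)

theorem ext_der {ξ η : Derivation ℂ O O} (h : ∀ j, ξ (c.x j) = η (c.x j)) : ξ = η :=
  sub_eq_zero.1 (c.eq_zero _ fun j => by rw [Derivation.sub_apply, h j, sub_self])

theorem lie_der (i j : Fin N) : ⁅c.der i, c.der j⁆ = 0 := by
  refine c.eq_zero _ fun k => ?_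
  rw [Derivation.commutator_apply, c.der_x, c.der_x]
  split_ifs <;> simp

theorem eq_sum (ξ : Derivation ℂ O O) : ξ = ∑ i, ξ (c.x i) • c.der i := by
  refine c.ext_der fun j => ?_
  have h : ∀ (s : Finset (Fin N)) (g : Fin N → Derivation ℂ O O) (y : O),
      (∑ i ∈ s, g i) y = ∑ i ∈ s, g i y := by
    intro s g y
    rw [← Derivation.coeFnAddMonoidHom_apply, map_sum, Finset.sum_apply]
    rfl
  rw [h]
  simp [c.der_x]

/-- The coordinate vector fields as differential operators. -/
def pd (i : Fin N) : DOp O := DOp.vf (c.der i)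

theorem commute (i j : Fin N) : Commute (c.pd i) (c.pd j) := by
  apply Subtype.ext
  ext g
  change c.der i (c.der j g) = c.der j (c.der i g)
  have h := congrArg (fun ξ => ξ g) (c.lie_der i j)
  rw [Derivation.commutator_apply] at h
  exact sub_eq_zero.1 h

theorem pd_mul_fn (i : Fin N) (f : O) :
    c.pd i * DOp.fn f = DOp.fn f * c.pd i + DOp.fn (c.der i f) :=
  DOp.vf_mul_fn _ _

theorem vf_eq (ξ : Derivation ℂ O O) : DOp.vf ξ = ∑ i, DOp.fn (ξ (c.x i)) * c.pd i := by
  conv_lhs => rw [c.eq_sum ξ]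
  rw [DOp.vf_sum]
  rfl

/-- Vector fields are combinations of the `∂ᵢ` with function coefficients, so left multiplications
by functions and by the `∂ᵢ` reach all of `D` from `1`. This is the induction principle for `D` used
below. -/
theorem mem_of_closed (S : AddSubgroup (DOp O)) (h1 : 1 ∈ S)
    (hf : ∀ f, ∀ d ∈ S, DOp.fn f * d ∈ S) (hd : ∀ i, ∀ d ∈ S, c.pd i * d ∈ S) (d : DOp O) :
    d ∈ S := by
  suffices h : ∀ e (he : e ∈ diffOps O), ∀ d ∈ S, (show DOp O from ⟨e, he⟩) * d ∈ S by
    have := h d.1 d.2 1 h1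
    rw [mul_one] at this
    exact this
  intro e he
  refine Algebra.adjoin_induction (p := fun e he => ∀ d ∈ S, (show DOp O from ⟨e, he⟩) * d ∈ S)
    ?_ ?_ ?_ ?_ he
  · rintro _ (⟨f, rfl⟩ | ⟨ξ, rfl⟩) d hdS
    · exact hf f d hdS
    · change DOp.vf ξ * d ∈ S
      rw [c.vf_eq, Finset.sum_mul]
      refine S.sum_mem fun i _ => ?_
      rw [mul_assoc]
      exact hf _ _ (hd i d hdS)
  · intro r d hdS
    have h2 := hf (algebraMap ℂ O r) d hdS
    have h3 : (show DOp O from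
        ⟨algebraMap ℂ (Module.End ℂ O) r, (diffOps O).algebraMap_mem r⟩) =
        DOp.fn (algebraMap ℂ O r) := ((DOp.fnHom O).commutes r).symm
    rwa [h3]
  · intro a b ha hb iha ihb d hdS
    have := S.add_mem (iha d hdS) (ihb d hdS)
    rw [← add_mul] at this
    exact this
  · intro a b ha hb iha ihb d hdS
    have := iha _ (ihb d hdS)
    rw [← mul_assoc] at this
    exact this

theorem skew (i : Fin N) (f : O) :
    ∃ g, c.pd i * DOp.fnHom O f = DOp.fnHom O f * c.pd i + DOp.fnHom O g :=
  ⟨_, c.pd_mul_fn i f⟩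

/-- Normal ordering of differential operators. -/
abbrev normalOrd : ((Fin N → ℕ) →₀ O) →ₗ[ℂ] DOp O := normalOrder (DOp.fnHom O) c.pd c.commute

theorem surjective_normalOrd : Function.Surjective c.normalOrd := by
  intro d
  refine c.mem_of_closed c.normalOrd.toAddMonoidHom.range ?_ ?_ ?_ d
  · refine ⟨Finsupp.single 0 1, ?_⟩
    change c.normalOrd _ = 1
    rw [normalOrder_single, commPow_zero, map_one, one_mul]
  · rintro f _ ⟨a, rfl⟩
    obtain ⟨n, hn⟩ := exists_mem_degLT a
    obtain ⟨b, -, hb⟩ := mul_mem_pbwFil (j := DOp.fnHom O) (q := c.pd) (hq := c.commute) f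
      ⟨a, hn, rfl⟩
    exact ⟨b, hb⟩
  · rintro i _ ⟨a, rfl⟩
    obtain ⟨n, hn⟩ := exists_mem_degLT a
    obtain ⟨b, -, hb⟩ := gen_mul_mem_pbwFil (hq := c.commute) c.skew i ⟨a, hn, rfl⟩
    exact ⟨b, hb⟩

theorem commPow_mul_x (α : Fin N → ℕ) (i : Fin N) :
    commPow c.pd c.commute α * DOp.fn (c.x i) = DOp.fn (c.x i) * commPow c.pd c.commute α +
      α i • commPow c.pd c.commute (α - Pi.single i 1) := by
  induction α using multiIndex_induction with
  | h0 => simp [commPow_zero]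
  | hs α j ih =>
    rw [commPow_add_single, mul_assoc, ih, mul_add, ← mul_assoc, c.pd_mul_fn, c.der_x, add_mul,
      mul_assoc, add_assoc]
    congr 1
    rw [mul_smul_comm]
    rcases eq_or_ne j i with rfl | hji
    · have e1 : α + Pi.single j 1 - Pi.single j 1 = α := by
        funext k; simp
      rw [if_pos rfl, DOp.fn_one, one_mul, e1]
      rcases Nat.eq_zero_or_pos (α j) with h0 | h0
      · simp [h0]
      · obtain ⟨β, rfl⟩ := exists_eq_add_single h0.ne'
        have e2 : β + Pi.single j 1 - Pi.single j 1 = β := by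
          funext k; simp
        rw [e2, ← commPow_add_single]
        simp only [Pi.add_apply, Pi.single_eq_same, add_smul, one_smul]
        abel
    · have e0 : (α + Pi.single j 1 : Fin N → ℕ) i = α i := by simp [hji.symm]
      rw [if_neg hji, DOp.fn_zero, zero_mul, zero_add, e0]
      rcases Nat.eq_zero_or_pos (α i) with h0 | h0
      · simp [h0]
      · obtain ⟨β, rfl⟩ := exists_eq_add_single h0.ne'
        have e2 : β + Pi.single i 1 - Pi.single i 1 = β := by
          funext k; simp
        have e3 : β + Pi.single i 1 + Pi.single j 1 - Pi.single i 1 = β + Pi.single j 1 := by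
          funext k; simp only [Pi.add_apply, Pi.sub_apply]; omega
        rw [e2, e3, commPow_add_single]

/-- The derivative of a symbol with respect to the `i`-th variable. -/
def lower (i : Fin N) : ((Fin N → ℕ) →₀ O) →+ ((Fin N → ℕ) →₀ O) :=
  Finsupp.liftAddHom fun α =>
    α i • Finsupp.singleAddHom (α - Pi.single i 1)

theorem lower_single (i : Fin N) (α : Fin N → ℕ) (f : O) :
    lower i (Finsupp.single α f) = α i • Finsupp.single (α - Pi.single i 1) f := by
  simp [lower]

theorem lower_apply (i : Fin N) (a : (Fin N → ℕ) →₀ O) (β : Fin N → ℕ) :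
    lower i a β = (β i + 1) • a (β + Pi.single i 1) := by
  induction a using Finsupp.induction_linear with
  | zero => simp
  | add a b ha hb => rw [map_add, Finsupp.add_apply, ha, hb, Finsupp.add_apply, smul_add]
  | single α f =>
    rw [lower_single, Finsupp.smul_apply]
    by_cases h : α = β + Pi.single i 1
    · subst h
      have e2 : β + Pi.single i 1 - Pi.single i 1 = β := by
        funext k; simp
      rw [e2, Finsupp.single_eq_same, Finsupp.single_eq_same]
      simp
    · rw [Finsupp.single_eq_of_ne (Ne.symm h), smul_zero]
      rcases Nat.eq_zero_or_pos (α i) with h0 | h0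
      · simp [h0]
      · obtain ⟨γ, rfl⟩ := exists_eq_add_single h0.ne'
        have e2 : γ + Pi.single i 1 - Pi.single i 1 = γ := by
          funext k; simp
        rw [e2, Finsupp.single_eq_of_ne, smul_zero]
        rintro rfl
        exact h rfl

/-- The commutator with `xᵢ` differentiates the symbol in the `i`-th dual variable, and so gives a
means of lowering the order. -/
theorem normalOrd_lower (i : Fin N) (a : (Fin N → ℕ) →₀ O) :
    c.normalOrd (lower i a) =
      c.normalOrd a * DOp.fn (c.x i) - DOp.fn (c.x i) * c.normalOrd a := by
  induction a using Finsupp.induction_linear with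
  | zero => simp
  | add a b ha hb => rw [map_add, map_add, ha, hb, map_add, add_mul, mul_add]; abel
  | single α f =>
    rw [lower_single, map_nsmul, normalOrder_single, normalOrder_single, mul_assoc,
      c.commPow_mul_x, mul_add, ← mul_assoc, ← mul_assoc, DOp.fnHom_apply, ← DOp.fn_mul,
      ← DOp.fn_mul, mul_comm f, mul_smul_comm, add_sub_cancel_left]

/-- If a symbol represents zero, so do its derivatives, which have smaller degree. By induction they
vanish; in characteristic zero the symbol is then constant, and a function is determined by its
multiplication operator. -/
theorem injective_normalOrd : Function.Injective c.normalOrd := by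
  suffices h : ∀ n, ∀ a ∈ degLT N O n, c.normalOrd a = 0 → a = 0 by
    refine (injective_iff_map_eq_zero _).2 fun a ha => ?_
    obtain ⟨n, hn⟩ := exists_mem_degLT a
    exact h n a hn ha
  intro n
  induction n with
  | zero => exact fun a ha _ => Finsupp.ext fun α => ha α (Nat.zero_le _)
  | succ n ih =>
    intro a ha h0
    have h1 : ∀ i, lower i a = 0 := by
      intro i
      refine ih _ ?_ ?_
      · intro β hβ
        rw [lower_apply, ha _ (by rw [mdeg_add_single]; omega), smul_zero]
      · rw [normalOrd_lower, h0, zero_mul, mul_zero, sub_zero]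
    have h2 : a = Finsupp.single 0 (a 0) := by
      ext α
      by_cases hα : α = 0
      · rw [hα, Finsupp.single_eq_same]
      · rw [Finsupp.single_eq_of_ne (by simpa using hα)]
        have : ∃ i, α i ≠ 0 := by
          by_contra! hc
          exact hα (funext hc)
        obtain ⟨i, hi⟩ := this
        obtain ⟨β, rfl⟩ := exists_eq_add_single hi
        have h3 := lower_apply i a β
        rw [h1, Finsupp.zero_apply] at h3
        have h4 : ((β i + 1 : ℕ) : ℂ) • a (β + Pi.single i 1) = 0 := by
          rw [Nat.cast_smul_eq_nsmul]; exact h3.symm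
        have h5 : ((β i + 1 : ℕ) : ℂ) ≠ 0 := Nat.cast_ne_zero.2 (Nat.succ_ne_zero _)
        rw [← one_smul ℂ (a (β + Pi.single i 1)), ← inv_mul_cancel₀ h5, mul_smul, h4, smul_zero]
    rw [h2, normalOrder_single, commPow_zero, mul_one, DOp.fnHom_apply, ← DOp.fn_zero] at h0
    rw [h2, DOp.fn_injective h0, Finsupp.single_zero]

theorem bijective_normalOrd : Function.Bijective c.normalOrd :=
  ⟨c.injective_normalOrd, c.surjective_normalOrd⟩

/-- Operators satisfying the commutation rules of functions and coordinate vector fields define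
an action of differential operators. -/
theorem exists_action {M : Type*} [AddCommGroup M] (ρ : O →+* AddMonoid.End M)
    (s : Fin N → AddMonoid.End M) (hs : ∀ i j, Commute (s i) (s j))
    (hρ : ∀ i f, s i * ρ f = ρ f * s i + ρ (c.der i f)) (m : M) :
    ∃ φ : DOp O →+ M, φ 1 = m ∧ (∀ f d, φ (DOp.fn f * d) = ρ f (φ d)) ∧
      ∀ i d, φ (c.pd i * d) = s i (φ d) := by
  let e := AddEquiv.ofBijective c.normalOrd.toAddMonoidHom c.bijective_normalOrd
  -- The action on `m` must send `f ∂^α` to `ρ(f) s^α m`. Uniqueness of normal forms makes this a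
  -- definition, and the hypothesis `hρ` makes it compatible with left multiplication by `∂ᵢ`.
  let ψ : ((Fin N → ℕ) →₀ O) →+ M := Finsupp.liftAddHom fun α =>
    (AddMonoidHom.eval (commPow s hs α m)).comp ρ.toAddMonoidHom
  have hψ : ∀ α f, ψ (Finsupp.single α f) = ρ f (commPow s hs α m) := by
    intro α f
    simp only [ψ, Finsupp.liftAddHom_apply_single]
    rfl
  have he : ∀ a, e.symm (c.normalOrd a) = a := fun a => e.symm_apply_apply a
  have hmem : ∀ (S : AddSubgroup (DOp O)), (∀ α f, c.normalOrd (Finsupp.single α f) ∈ S) →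
      ∀ d, d ∈ S := by
    intro S hS d
    obtain ⟨a, rfl⟩ := c.surjective_normalOrd d
    obtain ⟨n, hn⟩ := exists_mem_degLT a
    exact map_mem_of_single S n c.normalOrd.toAddMonoidHom (fun α u _ => hS α u) hn
  refine ⟨ψ.comp e.symm.toAddMonoidHom, ?_, ?_, ?_⟩
  · have h1 : c.normalOrd (Finsupp.single 0 1) = 1 := by
      rw [normalOrder_single, commPow_zero, map_one, one_mul]
    change ψ (e.symm 1) = m
    rw [← h1, he, hψ, commPow_zero, map_one]
    rfl
  · intro f d
    refine hmem (AddMonoidHom.eqLocus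
      ((ψ.comp e.symm.toAddMonoidHom).comp (AddMonoidHom.mulLeft (DOp.fn f)))
      ((ρ f).comp (ψ.comp e.symm.toAddMonoidHom))) (fun α g => ?_) d
    change ψ (e.symm (DOp.fn f * c.normalOrd (Finsupp.single α g))) =
      ρ f (ψ (e.symm (c.normalOrd (Finsupp.single α g))))
    have h1 : DOp.fn f * c.normalOrd (Finsupp.single α g) =
        c.normalOrd (Finsupp.single α (f * g)) := by
      rw [normalOrder_single, normalOrder_single, map_mul, mul_assoc]
      rfl
    rw [h1, he, he, hψ, hψ, map_mul]
    rfl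
  · intro i d
    refine hmem (AddMonoidHom.eqLocus
      ((ψ.comp e.symm.toAddMonoidHom).comp (AddMonoidHom.mulLeft (c.pd i)))
      ((s i).comp (ψ.comp e.symm.toAddMonoidHom))) (fun α g => ?_) d
    change ψ (e.symm (c.pd i * c.normalOrd (Finsupp.single α g))) =
      s i (ψ (e.symm (c.normalOrd (Finsupp.single α g))))
    have h1 : c.pd i * c.normalOrd (Finsupp.single α g) =
        c.normalOrd (Finsupp.single (α + Pi.single i 1) g + Finsupp.single α (c.der i g)) := by
      rw [map_add, normalOrder_single, normalOrder_single, normalOrder_single, ← mul_assoc,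
        DOp.fnHom_apply, c.pd_mul_fn, add_mul, mul_assoc, commPow_add_single]
      rfl
    rw [h1, he, he, map_add, hψ, hψ, hψ, commPow_add_single]
    have h2 := congrArg (fun u => u (commPow s hs α m)) (hρ i g)
    exact h2.symm

end Coordinates

end DiffOps
end QuiverDMod

/-! ### Transposition of differential operators and the dual of a free module. -/

namespace QuiverDMod

noncomputable section Duality

variable {O : Type} [CommRing O] [Algebra ℂ O] {N : ℕ}

theorem DOp.fn_algebraMap_mul (r : ℂ) (d : DOp O) : DOp.fn (algebraMap ℂ O r) * d = r • d := by
  rw [← DOp.fnHom_apply, AlgHom.commutes, Algebra.smul_def]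

theorem DOp.mul_fn_algebraMap (r : ℂ) (d : DOp O) : d * DOp.fn (algebraMap ℂ O r) = r • d := by
  rw [← DOp.fnHom_apply, AlgHom.commutes, Algebra.smul_def, Algebra.commutes]

namespace Coordinates

variable (c : Coordinates O N)

/-- Right multiplications by functions and by `-∂ᵢ` satisfy the relations between functions and
`∂ᵢ`, so `exists_action` applies with `M = D` and the vector `1`. -/
theorem exists_transpose : ∃ φ : DOp O →+ DOp O, φ 1 = 1 ∧
    (∀ f d, φ (DOp.fn f * d) = φ d * DOp.fn f) ∧ ∀ i d, φ (c.pd i * d) = -(φ d * c.pd i) :=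
  c.exists_action (M := DOp O)
    { toFun := fun f => AddMonoidHom.mulRight (DOp.fn f)
      map_one' := by ext d; exact (congrArg (d * ·) DOp.fn_one).trans (mul_one d)
      map_mul' := fun f g => by
        ext d
        change d * DOp.fn (f * g) = d * DOp.fn g * DOp.fn f
        rw [mul_comm f g, DOp.fn_mul, mul_assoc]
      map_zero' := by ext d; exact (congrArg (d * ·) DOp.fn_zero).trans (mul_zero d)
      map_add' := fun f g => by
        ext d
        exact (congrArg (d * ·) (DOp.fn_add f g)).trans (mul_add d _ _) }
    (fun i => -AddMonoidHom.mulRight (c.pd i))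
    (fun i j => by
      ext d
      change -(-(d * c.pd j) * c.pd i) = -(-(d * c.pd i) * c.pd j)
      rw [neg_mul, neg_mul, mul_assoc, mul_assoc, (c.commute i j).eq])
    (fun i f => by
      ext d
      change -(d * DOp.fn f * c.pd i) = -(d * c.pd i) * DOp.fn f + d * DOp.fn (c.der i f)
      rw [neg_mul, mul_assoc, mul_assoc, c.pd_mul_fn, mul_add]
      abel) 1

/-- The formal transpose of differential operators: the anti-automorphism fixing the functions and
sending `∂ᵢ` to `-∂ᵢ`. -/
def transpose : DOp O →ₗ[ℂ] DOp O :=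
  { c.exists_transpose.choose with
    map_smul' := fun r d => by
      change c.exists_transpose.choose (r • d) = r • c.exists_transpose.choose d
      rw [← DOp.fn_algebraMap_mul, c.exists_transpose.choose_spec.2.1, DOp.mul_fn_algebraMap] }

theorem transpose_one : c.transpose 1 = 1 := c.exists_transpose.choose_spec.1

theorem transpose_fn_mul (f : O) (d : DOp O) :
    c.transpose (DOp.fn f * d) = c.transpose d * DOp.fn f :=
  c.exists_transpose.choose_spec.2.1 f d

theorem transpose_pd_mul (i : Fin N) (d : DOp O) :
    c.transpose (c.pd i * d) = -(c.transpose d * c.pd i) :=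
  c.exists_transpose.choose_spec.2.2 i d

theorem transpose_fn (f : O) : c.transpose (DOp.fn f) = DOp.fn f := by
  rw [← mul_one (DOp.fn f), transpose_fn_mul, transpose_one, one_mul, mul_one]

theorem transpose_pd (i : Fin N) : c.transpose (c.pd i) = -c.pd i := by
  rw [← mul_one (c.pd i), transpose_pd_mul, transpose_one, one_mul, mul_one]

theorem transpose_mul (a b : DOp O) : c.transpose (a * b) = c.transpose b * c.transpose a := by
  refine c.mem_of_closed (AddMonoidHom.eqLocus
    (c.transpose.toAddMonoidHom.comp (AddMonoidHom.mulRight b))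
    ((AddMonoidHom.mulLeft (c.transpose b)).comp c.transpose.toAddMonoidHom)) ?_ ?_ ?_ a
  · change c.transpose (1 * b) = c.transpose b * c.transpose 1
    rw [transpose_one, one_mul, mul_one]
  · intro f d (hd : c.transpose (d * b) = c.transpose b * c.transpose d)
    change c.transpose (DOp.fn f * d * b) = c.transpose b * c.transpose (DOp.fn f * d)
    rw [mul_assoc, transpose_fn_mul, hd, transpose_fn_mul, mul_assoc]
  · intro i d (hd : c.transpose (d * b) = c.transpose b * c.transpose d)
    change c.transpose (c.pd i * d * b) = c.transpose b * c.transpose (c.pd i * d)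
    rw [mul_assoc, transpose_pd_mul, hd, transpose_pd_mul, mul_assoc, mul_neg]

/-- The divergence of a vector field. -/
def div (ξ : Derivation ℂ O O) : O := ∑ i, c.der i (ξ (c.x i))

theorem transpose_vf (ξ : Derivation ℂ O O) :
    c.transpose (DOp.vf ξ) = -DOp.vf ξ - DOp.fn (c.div ξ) := by
  have h : DOp.fn (c.div ξ) = ∑ i, DOp.fn (c.der i (ξ (c.x i))) :=
    map_sum (DOp.fnHom O) _ _
  rw [h, c.vf_eq ξ, map_sum, ← Finset.sum_neg_distrib, ← Finset.sum_sub_distrib]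
  refine Finset.sum_congr rfl fun i _ => ?_
  rw [transpose_fn_mul, transpose_pd, neg_mul, c.pd_mul_fn]
  abel

/-- The coordinate vector fields form a basis of the module of vector fields. -/
def derBasis : Basis (Fin N) O (Derivation ℂ O O) :=
  Basis.ofEquivFun
    { toFun := fun ξ i => ξ (c.x i)
      map_add' := fun _ _ => rfl
      map_smul' := fun _ _ => rfl
      invFun := fun g => ∑ i, g i • c.der i
      left_inv := fun ξ => (c.eq_sum ξ).symm
      right_inv := fun g => by
        funext j
        change (∑ i, g i • c.der i) (c.x j) = g j
        rw [← Derivation.coeFnAddMonoidHom_apply, map_sum, Finset.sum_apply]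
        simp [c.der_x] }

theorem derBasis_apply (i : Fin N) : c.derBasis i = c.der i := by
  simp only [derBasis, Basis.coe_ofEquivFun]
  change ∑ k, (Pi.single i 1 : Fin N → O) k • c.der k = c.der i
  simp [Pi.single_apply]

theorem coe_derBasis : ⇑c.derBasis = c.der := funext c.derBasis_apply

/-- The section of `Ω⁻¹` dual to the coordinate volume form. -/
def invVolume : InvTopForm O N where
  toFun ω := ω c.der
  map_add' _ _ := rfl
  map_smul' _ _ := rfl

theorem invVolume_apply (ω : TopForm O N) : c.invVolume ω = ω c.der := rfl

/-- The trivialization of `Ω⁻¹` by coordinates. -/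
def invEquiv : InvTopForm O N ≃ₗ[O] O where
  toFun ψ := ψ c.derBasis.det
  map_add' _ _ := rfl
  map_smul' _ _ := rfl
  invFun f := f • c.invVolume
  left_inv ψ := by
    ext ω
    have h := ω.eq_smul_basis_det c.derBasis
    rw [LinearMap.smul_apply, invVolume_apply, smul_eq_mul, mul_comm]
    conv_rhs => rw [h]
    rw [map_smul, coe_derBasis, smul_eq_mul]
  right_inv f := by
    change (f • c.invVolume) c.derBasis.det = f
    rw [LinearMap.smul_apply, invVolume_apply, ← coe_derBasis, Basis.det_self, smul_eq_mul, mul_one]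

/-- The trivialization of `D ⊗ Ω⁻¹` by coordinates. -/
def tildeEquiv : DOpR O ≃ₗ[O] DTilde O N :=
  (TensorProduct.rid O (DOpR O)).symm ≪≫ₗ
    TensorProduct.congr (LinearEquiv.refl O (DOpR O)) c.invEquiv.symm

/-- The trivialization of `D ⊗ Ω⁻¹` by coordinates, on differential operators. -/
def toTilde (d : DOp O) : DTilde O N := c.tildeEquiv (DOpR.of d)

theorem toTilde_eq (d : DOp O) : c.toTilde d = DOpR.of d ⊗ₜ[O] c.invVolume := by
  have h : c.invEquiv.symm 1 = c.invVolume := one_smul O c.invVolume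
  simp [toTilde, tildeEquiv, h]

theorem toTilde_bijective : Function.Bijective c.toTilde := c.tildeEquiv.bijective

theorem toTilde_add (d e : DOp O) : c.toTilde (d + e) = c.toTilde d + c.toTilde e :=
  map_add c.tildeEquiv (DOpR.of d) (DOpR.of e)

theorem toTilde_mul (d e : DOp O) : c.toTilde (d * e) = d • c.toTilde e := by
  rw [toTilde_eq, toTilde_eq, TensorProduct.smul_tmul']
  rfl

theorem smul_toTilde (f : O) (d : DOp O) : f • c.toTilde d = c.toTilde (d * DOp.fn f) := by
  unfold toTilde
  rw [← map_smul]
  rfl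

/-- In the brackets `[ξ, ∂ⱼ]` only the `∂ⱼ`-component survives in an alternating form evaluated on
the coordinate frame; these components add up to minus the divergence. -/
theorem lieInv_invVolume (ξ : Derivation ℂ O O) :
    lieInv ξ c.invVolume = -(c.div ξ • c.invVolume) := by
  ext ω
  rw [lieInv_apply, LinearMap.neg_apply, LinearMap.smul_apply, invVolume_apply, invVolume_apply,
    lieForm_apply, sub_sub_cancel, smul_eq_mul, div, Finset.sum_mul, ← Finset.sum_neg_distrib]
  refine Finset.sum_congr rfl fun j _ => ?_
  have h : ⁅ξ, c.der j⁆ = ∑ i, -(c.der j (ξ (c.x i))) • c.der i := by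
    rw [c.eq_sum ⁅ξ, c.der j⁆]
    refine Finset.sum_congr rfl fun i _ => ?_
    congr 1
    rw [Derivation.commutator_apply, c.der_x]
    split_ifs <;> simp
  rw [h, AlternatingMap.map_update_sum, Finset.sum_eq_single j]
  · rw [AlternatingMap.map_update_smul, Function.update_eq_self, smul_eq_mul, neg_mul]
  · intro i _ hij
    rw [AlternatingMap.map_update_smul, ω.map_update_self c.der hij.symm, smul_zero]
  · simp

/-- The divergence in `Lie_ξ` of the inverse volume is the correction term in `ξᵗ = -ξ - div ξ`.
Hence, after trivialization, the first structure on `D̃` is right multiplication by transposes. -/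
theorem firstVf_toTilde (ξ : Derivation ℂ O O) (d : DOp O) :
    firstVf ξ (c.toTilde d) = c.toTilde (d * c.transpose (DOp.vf ξ)) := by
  have h1 : c.toTilde (d * c.transpose (DOp.vf ξ)) =
      -(DOpR.of (d * DOp.vf ξ) ⊗ₜ[O] c.invVolume) - c.div ξ • c.toTilde d := by
    rw [smul_toTilde, transpose_vf, mul_sub, mul_neg, sub_eq_add_neg, toTilde_add,
      sub_eq_add_neg, ← toTilde_eq]
    have hneg : ∀ e, c.toTilde (-e) = -c.toTilde e := fun e => map_neg c.tildeEquiv (DOpR.of e)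
    rw [hneg, hneg]
  rw [h1, toTilde_eq, firstVf_tmul, lieInv_invVolume, TensorProduct.tmul_neg,
    TensorProduct.tmul_smul, ← sub_eq_add_neg]
  rfl

end Coordinates

section Transpose

variable (c : Coordinates O N) (W : Type) [AddCommGroup W] [Module ℂ W] [FiniteDimensional ℂ W]

/-- `D ⊗ W* ≃ Hom(W, D)`. -/
def dualHomEquiv : DOp O ⊗[ℂ] Dual ℂ W ≃ₗ[ℂ] (W →ₗ[ℂ] DOp O) :=
  TensorProduct.comm ℂ _ _ ≪≫ₗ dualTensorHomEquiv ℂ W (DOp O)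

variable {W}

theorem dualHomEquiv_tmul (d : DOp O) (l : Dual ℂ W) (w : W) :
    dualHomEquiv W (d ⊗ₜ l) w = l w • d := by
  simp [dualHomEquiv]

theorem dualHomEquiv_smul (d : DOp O) (x : DOp O ⊗[ℂ] Dual ℂ W) (w : W) :
    dualHomEquiv W (d • x) w = d * dualHomEquiv W x w := by
  induction x using TensorProduct.induction_on with
  | zero => simp
  | add x y hx hy => rw [smul_add, map_add, LinearMap.add_apply, hx, hy, map_add,
      LinearMap.add_apply, mul_add]
  | tmul e l =>
    rw [TensorProduct.smul_tmul', dualHomEquiv_tmul, dualHomEquiv_tmul, smul_eq_mul, mul_smul_comm]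

/-- The bilinear form `(e, w) ↦ x(w) eᵗ`. -/
def dualPairing (x : DOp O ⊗[ℂ] Dual ℂ W) : DOp O ⊗[ℂ] W →ₗ[ℂ] DOp O :=
  TensorProduct.lift ((LinearMap.mul ℂ (DOp O)).flip.compl₂ (dualHomEquiv W x) ∘ₗ c.transpose)

theorem dualPairing_tmul (x : DOp O ⊗[ℂ] Dual ℂ W) (e : DOp O) (w : W) :
    dualPairing c x (e ⊗ₜ w) = dualHomEquiv W x w * c.transpose e := rfl

theorem dualPairing_smul (x : DOp O ⊗[ℂ] Dual ℂ W) (d : DOp O) (p : DOp O ⊗[ℂ] W) :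
    dualPairing c x (d • p) = dualPairing c x p * c.transpose d := by
  induction p using TensorProduct.induction_on with
  | zero => simp
  | add p q hp hq => rw [smul_add, map_add, hp, hq, map_add, add_mul]
  | tmul e w =>
    rw [TensorProduct.smul_tmul', dualPairing_tmul, dualPairing_tmul, smul_eq_mul,
      c.transpose_mul, mul_assoc]

/-- The homomorphism `D ⊗ W → D̃` attached to an element of `D ⊗ W*`. -/
def dualHom (x : DOp O ⊗[ℂ] Dual ℂ W) : HomDTilde O N (DOp O ⊗[ℂ] W) :=
  ⟨c.tildeEquiv.toLinearMap.toAddMonoidHom.comp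
      (show DOp O ⊗[ℂ] W →+ DOpR O from (dualPairing c x).toAddMonoidHom),
    fun f p => by
      change c.toTilde (dualPairing c x (DOp.fn f • p)) = f • c.toTilde (dualPairing c x p)
      rw [dualPairing_smul, c.transpose_fn, c.smul_toTilde],
    fun ξ p => by
      change c.toTilde (dualPairing c x (DOp.vf ξ • p)) = firstVf ξ (c.toTilde (dualPairing c x p))
      rw [dualPairing_smul, c.firstVf_toTilde]⟩

/-- The elements `1 ⊗ w` generate, and the locus where two homomorphisms agree is closed under
functions and the `∂ᵢ`. -/
theorem HomDTilde_ext (c : Coordinates O N) {W : Type} [AddCommGroup W] [Module ℂ W] (φ ψ : HomDTilde O N (DOp O ⊗[ℂ] W))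
    (h : ∀ w, φ.1 (1 ⊗ₜ w) = ψ.1 (1 ⊗ₜ w)) : φ = ψ := by
  apply Subtype.ext
  apply AddMonoidHom.ext
  intro p
  induction p using TensorProduct.induction_on with
  | zero => simp
  | add p q hp hq => rw [map_add, map_add, hp, hq]
  | tmul e w =>
    refine c.mem_of_closed (AddMonoidHom.eqLocus
      (φ.1.comp ((TensorProduct.mk ℂ (DOp O) W).flip w).toAddMonoidHom)
      (ψ.1.comp ((TensorProduct.mk ℂ (DOp O) W).flip w).toAddMonoidHom)) (h w) ?_ ?_ e
    · intro f d (hd : φ.1 (d ⊗ₜ w) = ψ.1 (d ⊗ₜ w))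
      have e1 : (DOp.fn f * d) ⊗ₜ[ℂ] w = DOp.fn f • (d ⊗ₜ[ℂ] w) := rfl
      change φ.1 ((DOp.fn f * d) ⊗ₜ w) = ψ.1 ((DOp.fn f * d) ⊗ₜ w)
      rw [e1, φ.2.1, ψ.2.1, hd]
    · intro i d (hd : φ.1 (d ⊗ₜ w) = ψ.1 (d ⊗ₜ w))
      have e1 : (c.pd i * d) ⊗ₜ[ℂ] w = DOp.vf (c.der i) • (d ⊗ₜ[ℂ] w) := rfl
      change φ.1 ((c.pd i * d) ⊗ₜ w) = ψ.1 ((c.pd i * d) ⊗ₜ w)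
      rw [e1, φ.2.2, ψ.2.2, hd]

variable (W) in
/-- `D ⊗ W* ≃ Hom_D(D ⊗ W, D̃)`. -/
def dualEquiv : DOp O ⊗[ℂ] Dual ℂ W ≃ₗ[DOp O] HomDTilde O N (DOp O ⊗[ℂ] W) :=
  LinearEquiv.ofBijective
    { toFun := dualHom c
      map_add' := fun x y => HomDTilde_ext c _ _ fun w => by
        change c.toTilde (dualHomEquiv W (x + y) w * c.transpose 1) =
          c.toTilde (dualHomEquiv W x w * c.transpose 1) +
          c.toTilde (dualHomEquiv W y w * c.transpose 1)
        rw [map_add, LinearMap.add_apply, add_mul, c.toTilde_add]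
      map_smul' := fun d x => HomDTilde_ext c _ _ fun w => by
        change c.toTilde (dualHomEquiv W (d • x) w * c.transpose 1) =
          d • c.toTilde (dualHomEquiv W x w * c.transpose 1)
        rw [dualHomEquiv_smul, mul_assoc, c.toTilde_mul] }
    (by
      constructor
      · intro x y hxy
        apply (dualHomEquiv W).injective
        ext w : 1
        have h := congrArg (fun φ => φ.1 (1 ⊗ₜ w)) hxy
        change c.toTilde (dualHomEquiv W x w * c.transpose 1) =
          c.toTilde (dualHomEquiv W y w * c.transpose 1) at h
        have := c.toTilde_bijective.1 h
        simpa [c.transpose_one] using this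
      · intro φ
        -- The preimage of `φ` is read off from its values on the generators `1 ⊗ w`, transported to
        -- `D` by the trivialization.
        let g : W →ₗ[ℂ] DOp O :=
          { toFun := fun w => c.tildeEquiv.symm (φ.1 (1 ⊗ₜ w))
            map_add' := fun w w' => by
              rw [TensorProduct.tmul_add, map_add, map_add]; rfl
            map_smul' := fun r w => by
              have e1 : (1 : DOp O) ⊗ₜ[ℂ] (r • w) =
                  DOp.fn (algebraMap ℂ O r) • ((1 : DOp O) ⊗ₜ[ℂ] w) := by
                rw [← TensorProduct.smul_tmul, ← DOp.fn_algebraMap_mul]; rfl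
              rw [e1, φ.2.1, map_smul, DOpR.smul_def]
              exact DOp.mul_fn_algebraMap r _ }
        refine ⟨(dualHomEquiv W).symm g, HomDTilde_ext c _ _ fun w => ?_⟩
        change c.toTilde (dualHomEquiv W ((dualHomEquiv W).symm g) w * c.transpose 1) = _
        rw [LinearEquiv.apply_symm_apply, c.transpose_one, mul_one]
        exact c.tildeEquiv.apply_symm_apply _)

end Transpose

end Duality
end QuiverDMod

/-! ### The holonomic dual of a Koszul quotient. -/

namespace QuiverDMod

noncomputable section Duality

theorem map_partialRange {R A B : Type} [Ring R] [AddCommGroup A] [Module R A] [AddCommGroup B]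
    [Module R B] {N : ℕ} {θ : Fin N → A →ₗ[R] A} {θ' : Fin N → B →ₗ[R] B} (e : A ≃ₗ[R] B)
    (h : ∀ i x, e (θ i x) = θ' i (e x)) (k : ℕ) :
    (partialRange θ k).map e.toLinearMap = partialRange θ' k := by
  simp only [partialRange, Submodule.map_iSup]
  refine iSup_congr fun i => iSup_congr fun _ => ?_
  ext y
  constructor
  · rintro ⟨_, ⟨x, rfl⟩, rfl⟩
    exact ⟨e x, (h i x).symm⟩
  · rintro ⟨x, rfl⟩
    exact ⟨θ i (e.symm x), ⟨_, rfl⟩, (h i _).trans (by rw [e.apply_symm_apply])⟩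

theorem IsRegularFamily.of_equiv {R A B : Type} [Ring R] [AddCommGroup A] [Module R A]
    [AddCommGroup B] [Module R B] {N : ℕ} {θ : Fin N → A →ₗ[R] A} {θ' : Fin N → B →ₗ[R] B}
    (hreg : IsRegularFamily θ) (e : A ≃ₗ[R] B) (h : ∀ i x, e (θ i x) = θ' i (e x)) :
    IsRegularFamily θ' := by
  intro k x hx
  obtain ⟨y, rfl⟩ := e.surjective x
  rw [← h, ← map_partialRange e h] at hx
  rw [← map_partialRange e h]
  obtain ⟨z, hz, hzy⟩ := hx
  obtain rfl : z = θ k y := e.injective hzy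
  exact ⟨y, hreg k y hz, rfl⟩

section Transpose

variable {O : Type} [CommRing O] [Algebra ℂ O] {N : ℕ}
variable (c : Coordinates O N) {W : Type} [AddCommGroup W] [Module ℂ W]

/-- The endomorphism `d ⊗ w ↦ da ⊗ Aw` of `D ⊗ W`. -/
def rmap (a : DOp O) {W' : Type} [AddCommGroup W'] [Module ℂ W'] (A : W →ₗ[ℂ] W') :
    DOp O ⊗[ℂ] W →ₗ[DOp O] DOp O ⊗[ℂ] W' :=
  TensorProduct.AlgebraTensorModule.map (LinearMap.toSpanSingleton (DOp O) (DOp O) a) A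

theorem rmap_tmul (a : DOp O) {W' : Type} [AddCommGroup W'] [Module ℂ W'] (A : W →ₗ[ℂ] W')
    (d : DOp O) (w : W) : rmap a A (d ⊗ₜ[ℂ] w) = (d * a) ⊗ₜ[ℂ] A w := rfl

theorem tensor_hom_ext {W M : Type} [AddCommGroup W] [Module ℂ W] [AddCommGroup M]
    [Module (DOp O) M] {f g : DOp O ⊗[ℂ] W →ₗ[DOp O] M}
    (h : ∀ w, f (1 ⊗ₜ w) = g (1 ⊗ₜ w)) : f = g := by
  apply LinearMap.ext
  intro x
  induction x using TensorProduct.induction_on with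
  | zero => simp
  | add x y hx hy => rw [map_add, map_add, hx, hy]
  | tmul d w =>
    have e : d ⊗ₜ[ℂ] w = d • ((1 : DOp O) ⊗ₜ[ℂ] w) := by
      rw [TensorProduct.smul_tmul', smul_eq_mul, mul_one]
    rw [e, map_smul, map_smul, h]

variable [FiniteDimensional ℂ W]

/-- `θ'` is the transpose of `θ`, with respect to the transposition of differential operators. -/
def IsTranspose (θ : DOp O ⊗[ℂ] W →ₗ[DOp O] DOp O ⊗[ℂ] W)
    (θ' : DOp O ⊗[ℂ] Dual ℂ W →ₗ[DOp O] DOp O ⊗[ℂ] Dual ℂ W) : Prop :=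
  ∀ x w, dualHomEquiv W (θ' x) w = dualPairing c x (θ (1 ⊗ₜ w))

variable {c}

theorem IsTranspose.sub {θ η : DOp O ⊗[ℂ] W →ₗ[DOp O] DOp O ⊗[ℂ] W}
    {θ' η' : DOp O ⊗[ℂ] Dual ℂ W →ₗ[DOp O] DOp O ⊗[ℂ] Dual ℂ W} (h : IsTranspose c θ θ')
    (h' : IsTranspose c η η') : IsTranspose c (θ - η) (θ' - η') := fun x w => by
  rw [LinearMap.sub_apply, map_sub, LinearMap.sub_apply, h, h', LinearMap.sub_apply, map_sub]

theorem IsTranspose.sum {ι : Type*} (s : Finset ι)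
    {θ : ι → DOp O ⊗[ℂ] W →ₗ[DOp O] DOp O ⊗[ℂ] W}
    {θ' : ι → DOp O ⊗[ℂ] Dual ℂ W →ₗ[DOp O] DOp O ⊗[ℂ] Dual ℂ W}
    (h : ∀ i, IsTranspose c (θ i) (θ' i)) :
    IsTranspose c (∑ i ∈ s, θ i) (∑ i ∈ s, θ' i) := fun x w => by
  rw [LinearMap.sum_apply, LinearMap.sum_apply, map_sum, map_sum, LinearMap.sum_apply]
  exact Finset.sum_congr rfl fun i _ => h i x w

variable (c) in
theorem isTranspose_rmap (a : DOp O) (A : W →ₗ[ℂ] W) :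
    IsTranspose c (rmap a A) (rmap (c.transpose a) A.dualMap) := fun x w => by
  rw [rmap_tmul, one_mul, dualPairing_tmul]
  induction x using TensorProduct.induction_on with
  | zero => simp
  | add x y hx hy => rw [map_add, map_add, LinearMap.add_apply, hx, hy, map_add,
      LinearMap.add_apply, add_mul]
  | tmul d l =>
    rw [rmap_tmul, dualHomEquiv_tmul, dualHomEquiv_tmul, smul_mul_assoc]
    rfl

/-- This links the concrete transpose with the functor: under `dualEquiv` the operator `θ'` becomes
precomposition with `θ`. -/
theorem IsTranspose.dualEquiv_apply {θ : DOp O ⊗[ℂ] W →ₗ[DOp O] DOp O ⊗[ℂ] W}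
    {θ' : DOp O ⊗[ℂ] Dual ℂ W →ₗ[DOp O] DOp O ⊗[ℂ] Dual ℂ W} (h : IsTranspose c θ θ') (x) :
    dualEquiv c W (θ' x) = pull (homDTilde O N) θ (dualEquiv c W x) := by
  refine HomDTilde_ext c _ _ fun w => ?_
  change c.toTilde (dualHomEquiv W (θ' x) w * c.transpose 1) =
    c.toTilde (dualPairing c x (θ (1 ⊗ₜ w)))
  rw [h, c.transpose_one, mul_one]

/-- The holonomic dual of the quotient of a free module by a regular family of commuting
operators. -/
theorem RHomDTilde_of_isTranspose {θ : Fin N → DOp O ⊗[ℂ] W →ₗ[DOp O] DOp O ⊗[ℂ] W}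
    {θ' : Fin N → DOp O ⊗[ℂ] Dual ℂ W →ₗ[DOp O] DOp O ⊗[ℂ] Dual ℂ W}
    (ht : ∀ i, IsTranspose c (θ i) (θ' i)) (hθ : ∀ i j, Commute (θ i) (θ j))
    (hreg : IsRegularFamily θ) (hreg' : IsRegularFamily θ') :
    Nonempty (RHomDTilde O N N (DOp O ⊗[ℂ] W ⧸ ⨆ i, LinearMap.range (θ i)) ≅
      ModuleCat.of (DOp O) (DOp O ⊗[ℂ] Dual ℂ W ⧸ ⨆ i, LinearMap.range (θ' i))) ∧
    ∀ n, n ≠ N → Limits.IsZero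
      (RHomDTilde O N n (DOp O ⊗[ℂ] W ⧸ ⨆ i, LinearMap.range (θ i))) := by
  have h1 := rightDerived_of_isRegularFamily (homDTilde O N)
    (fun i j x => congrArg (fun f => f x) (hθ i j).eq) hreg
    (hreg'.of_equiv (dualEquiv c W) fun i x => (ht i).dualEquiv_apply x)
  obtain ⟨⟨e⟩, h2⟩ := h1
  refine ⟨⟨e ≪≫ (Submodule.Quotient.equiv _ _ (dualEquiv c W) ?_).symm.toModuleIso⟩, h2⟩
  rw [← partialRange_all, ← partialRange_all]
  exact map_partialRange (θ := θ') (θ' := fun i => pull (homDTilde O N) (θ i))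
    (dualEquiv c W) (fun i x => (ht i).dualEquiv_apply x) N

/-- The transposes are conjugate to pullbacks, and a contravariant functor carries commuting
endomorphisms to commuting ones. -/
theorem commute_of_isTranspose {θ : Fin N → DOp O ⊗[ℂ] W →ₗ[DOp O] DOp O ⊗[ℂ] W}
    {θ' : Fin N → DOp O ⊗[ℂ] Dual ℂ W →ₗ[DOp O] DOp O ⊗[ℂ] Dual ℂ W}
    (ht : ∀ i, IsTranspose c (θ i) (θ' i)) (hθ : ∀ i j, Commute (θ i) (θ j)) (i j : Fin N) :
    Commute (θ' i) (θ' j) := by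
  apply LinearMap.ext
  intro x
  apply (dualEquiv c W).injective
  change dualEquiv c W (θ' i (θ' j x)) = dualEquiv c W (θ' j (θ' i x))
  rw [(ht i).dualEquiv_apply, (ht j).dualEquiv_apply, (ht j).dualEquiv_apply,
    (ht i).dualEquiv_apply]
  refine (pull_pull (homDTilde O N) (θ i) (θ j) _).trans
    (Eq.trans ?_ (pull_pull (homDTilde O N) (θ j) (θ i) _).symm)
  exact congrArg (fun f : DOp O ⊗[ℂ] W →ₗ[DOp O] DOp O ⊗[ℂ] W =>
    pull (homDTilde O N) f (dualEquiv c W x)) (hθ j i).eq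

/-- Isomorphic modules have isomorphic duals. -/
def RHomDTilde_congr (n i : ℕ) {M M' : Type} [AddCommGroup M] [Module (DOp O) M]
    [AddCommGroup M'] [Module (DOp O) M'] (e : M ≃ₗ[DOp O] M') :
    RHomDTilde O n i M ≅ RHomDTilde O n i M' :=
  ((homDTilde O n).rightDerived i).mapIso e.toModuleIso.symm.op

end Transpose

end Duality
end QuiverDMod

/-! ### Coordinates on affine space and its localizations; comparison of relation modules. -/

namespace QuiverDMod

noncomputable section Coords

theorem constVf_X {N : ℕ} (ξ : Fin N → ℂ) (i : Fin N) :
    constVf ξ (MvPolynomial.X i) = MvPolynomial.C (ξ i) :=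
  MvPolynomial.mkDerivation_X _ _ _

/-- The coordinates of affine space. -/
def polyCoords (N : ℕ) : Coordinates (PolyRing N) N where
  x := MvPolynomial.X
  der i := constVf (Pi.single i 1)
  der_x i j := by
    rw [constVf_X, Pi.single_apply]
    simp only [eq_comm]
    split_ifs <;> simp
  eq_zero ξ h := MvPolynomial.derivation_ext fun i => by simpa using h i

/-- Differentiating `z s = a` leaves `s ξ(z) = 0` with `s` invertible. -/
theorem derivation_localization_eq_zero {A : Type} [CommRing A] [Algebra ℂ A] (S : Submonoid A)
    (ξ : Derivation ℂ (Localization S) (Localization S)) (h : ∀ a, ξ (algebraMap A _ a) = 0) :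
    ξ = 0 := by
  ext z
  obtain ⟨⟨a, s⟩, hz⟩ := IsLocalization.surj S z
  have h1 := congrArg ξ hz
  rw [Derivation.leibniz, h, h, smul_zero, zero_add] at h1
  exact (IsLocalization.map_units (Localization S) s).mul_right_eq_zero.1 h1

/-- The coordinates on the complement of a hypersurface in affine space. -/
def locCoords {N : ℕ} (S : Submonoid (PolyRing N)) : Coordinates (Localization S) N where
  x i := algebraMap (PolyRing N) _ (MvPolynomial.X i)
  der i := locDer S (constVf (Pi.single i 1))
  der_x i j := by
    rw [locDer_algebraMap, constVf_X, Pi.single_apply]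
    simp only [eq_comm]
    split_ifs <;> simp
  eq_zero ξ h := by
    refine derivation_localization_eq_zero S ξ fun a => ?_
    have h1 : (ξ.compAlgebraMap (PolyRing N)) = 0 :=
      MvPolynomial.derivation_ext fun i => by simpa using h i
    exact congrArg (fun δ => δ a) h1

theorem constVf_eq_sum {N : ℕ} (ξ : Fin N → ℂ) :
    constVf ξ = ∑ i, ξ i • constVf (Pi.single i 1) := by
  rw [(polyCoords N).eq_sum (constVf ξ)]
  refine Finset.sum_congr rfl fun i _ => ?_
  change constVf ξ (MvPolynomial.X i) • _ = _
  rw [constVf_X]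
  ext1 j
  rw [Derivation.smul_apply, Derivation.smul_apply, MvPolynomial.smul_eq_C_mul]
  rfl

theorem locDer_constVf_eq_sum {N : ℕ} (S : Submonoid (PolyRing N)) (ξ : Fin N → ℂ) :
    locDer S (constVf ξ) = ∑ i, ξ i • locDer S (constVf (Pi.single i 1)) := by
  rw [(locCoords S).eq_sum (locDer S (constVf ξ))]
  refine Finset.sum_congr rfl fun i _ => ?_
  change locDer S (constVf ξ) (algebraMap _ _ (MvPolynomial.X i)) • _ = _
  rw [locDer_algebraMap, constVf_X]
  ext z
  rw [Derivation.smul_apply, Derivation.smul_apply, Algebra.smul_def (ξ i),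
    IsScalarTower.algebraMap_apply ℂ (PolyRing N) (Localization S)]
  rfl

theorem constVf_affPoly {N : ℕ} (ξ : Fin N → ℂ) (f : AffineFn N) :
    constVf ξ (affPoly f) = MvPolynomial.C (pair ξ f) := by
  have h : f.linear ξ = ∑ i, f.linear (Pi.single i 1) * ξ i := by
    conv_lhs => rw [← Finset.univ_sum_single ξ]
    rw [map_sum]
    refine Finset.sum_congr rfl fun i _ => ?_
    have : (Pi.single i (ξ i) : Fin N → ℂ) = ξ i • Pi.single i (1 : ℂ) := by
      rw [← Pi.single_smul]; simp
    rw [this, map_smul, smul_eq_mul, mul_comm]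
  have hC : ∀ a : ℂ, constVf ξ (MvPolynomial.C a) = 0 := fun a => (constVf ξ).map_algebraMap a
  rw [affPoly, map_add, hC, zero_add, map_sum, pair, h, map_sum]
  refine Finset.sum_congr rfl fun i _ => ?_
  rw [Derivation.leibniz, constVf_X, hC, smul_zero, add_zero, smul_eq_mul, ← map_mul]
  rfl

end Coords

noncomputable section ConstTop

/-- Constant top forms form a line. -/
def constTopEquiv {E : Type} [AddCommGroup E] [Module ℂ E] (U : Submodule ℂ E)
    [FiniteDimensional ℂ U] : ConstTop U ≃ₗ[ℂ] ℂ where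
  toFun ω := ω (finBasis ℂ U)
  map_add' _ _ := rfl
  map_smul' _ _ := rfl
  invFun a := a • (finBasis ℂ U).det
  left_inv ω := (ω.eq_smul_basis_det (finBasis ℂ U)).symm
  right_inv a := by simp [Basis.det_self]

theorem map_span_eq_iSup_range {D F F' : Type} {ι : Type*} [Ring D] [AddCommGroup F] [Module D F]
    [AddCommGroup F'] [Module D F'] (e : F ≃ₗ[D] F') (s : Set F) (θ : ι → F' →ₗ[D] F')
    (h1 : ∀ x ∈ s, e x ∈ ⨆ i, LinearMap.range (θ i))
    (h2 : ∀ i, LinearMap.range (θ i) ≤ (Submodule.span D s).map e.toLinearMap) :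
    (Submodule.span D s).map e.toLinearMap = ⨆ i, LinearMap.range (θ i) := by
  refine le_antisymm ?_ (iSup_le h2)
  rw [Submodule.map_span, Submodule.span_le]
  rintro _ ⟨x, hx, rfl⟩
  exact h1 x hx

theorem range_le_of_tmul {O : Type} [CommRing O] [Algebra ℂ O] {W : Type} [AddCommGroup W]
    [Module ℂ W] {M : Type} [AddCommGroup M] [Module (DOp O) M]
    (θ : DOp O ⊗[ℂ] W →ₗ[DOp O] M) (S : Submodule (DOp O) M)
    (h : ∀ w, θ (1 ⊗ₜ w) ∈ S) : LinearMap.range θ ≤ S := by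
  rintro _ ⟨x, rfl⟩
  induction x using TensorProduct.induction_on with
  | zero => rw [map_zero]; exact S.zero_mem
  | add x y hx hy => rw [map_add]; exact S.add_mem hx hy
  | tmul d w =>
    have e : d ⊗ₜ[ℂ] w = d • ((1 : DOp O) ⊗ₜ[ℂ] w) := by
      rw [TensorProduct.smul_tmul', smul_eq_mul, mul_one]
    rw [e, map_smul]
    exact S.smul_mem _ (h w)

end ConstTop
end QuiverDMod

/-! ### The Arnold relation and flatness of the logarithmic connection. -/

namespace QuiverDMod

theorem sum_sum_sub_swap {ι M : Type*} [Fintype ι] [AddCommGroup M] (f g : ι → ι → M) :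
    ∑ j, ∑ l, (f j l - g l j) = ∑ j, (∑ l, f j l - ∑ l, g j l) := by
  simp only [Finset.sum_sub_distrib]
  rw [Finset.sum_comm (f := fun j l => g l j)]

noncomputable section Affine

variable {N : ℕ}

theorem affPoly_add (f g : AffineFn N) : affPoly (f + g) = affPoly f + affPoly g := by
  simp only [affPoly, pair, AffineMap.coe_add, Pi.add_apply, AffineMap.add_linear,
    LinearMap.add_apply, map_add, add_mul, Finset.sum_add_distrib]
  abel

theorem affPoly_smul (a : ℂ) (f : AffineFn N) : affPoly (a • f) = a • affPoly f := by
  simp only [affPoly, pair, AffineMap.coe_smul, Pi.smul_apply, AffineMap.smul_linear,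
    LinearMap.smul_apply, smul_add, Finset.smul_sum, MvPolynomial.smul_eq_C_mul, smul_eq_mul,
    map_mul, mul_assoc]

theorem affPoly_zero : affPoly (0 : AffineFn N) = 0 := by
  have := affPoly_smul 0 (0 : AffineFn N)
  rwa [zero_smul, zero_smul] at this

theorem affineFn_vadd (f : AffineFn N) (v p : Fin N → ℂ) : f (v +ᵥ p) = pair v f + f p :=
  f.map_vadd p v

/-- Three affine functions vanishing on an affine subspace of codimension two are dependent. -/
theorem affine_three_dependent (S : AffineSubspace ℂ (Fin N → ℂ)) (hS : (S : Set (Fin N → ℂ)).Nonempty)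
    (hd : finrank ℂ S.direction + 2 = N) (f : Fin 3 → AffineFn N)
    (hf : ∀ i, ∀ x ∈ S, f i x = 0) (ξ η : Fin N → ℂ) :
    (pair ξ (f 1) * pair η (f 2) - pair η (f 1) * pair ξ (f 2)) • f 0 +
    (pair ξ (f 2) * pair η (f 0) - pair η (f 2) * pair ξ (f 0)) • f 1 +
    (pair ξ (f 0) * pair η (f 1) - pair η (f 0) * pair ξ (f 1)) • f 2 = 0 := by
  obtain ⟨p, hp⟩ := hS
  have hker : ∀ i, ∀ v ∈ S.direction, pair v (f i) = 0 := fun i v hv => by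
    have := affineFn_vadd (f i) v p
    rw [hf i p hp, hf i _ (AffineSubspace.vadd_mem_of_mem_direction hv hp)] at this
    simpa using this.symm
  have hlin : ∀ v, (pair ξ (f 1) * pair η (f 2) - pair η (f 1) * pair ξ (f 2)) * pair v (f 0) +
    (pair ξ (f 2) * pair η (f 0) - pair η (f 2) * pair ξ (f 0)) * pair v (f 1) +
    (pair ξ (f 0) * pair η (f 1) - pair η (f 0) * pair ξ (f 1)) * pair v (f 2) = 0 := by
    intro v
    have hq : finrank ℂ ((Fin N → ℂ) ⧸ S.direction) = 2 := by
      have := S.direction.finrank_quotient_add_finrank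
      rw [finrank_fin_fun] at this
      omega
    have hdep : ¬ LinearIndependent ℂ (fun i => S.direction.mkQ ((![v, ξ, η] : Fin 3 → _) i)) := by
      intro h
      have := h.fintype_card_le_finrank
      rw [hq] at this
      simp at this
    obtain ⟨g, hg, i, hi⟩ := Fintype.not_linearIndependent_iff.1 hdep
    -- Modulo the direction of `S`, of codimension two, the vectors `v, ξ, η` are dependent, and the
    -- derivatives of the `f i` factor through this quotient. Expansion along the column of `v` is
    -- the asserted identity of linear parts.
    have hdet : (Matrix.of fun i j => pair ((![v, ξ, η] : Fin 3 → _) j) (f i)).det = 0 := by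
      refine Matrix.exists_mulVec_eq_zero_iff.1 ⟨g, fun h => hi (by rw [h]; rfl), ?_⟩
      funext k
      have hmem : ∑ j, g j • (![v, ξ, η] : Fin 3 → _) j ∈ S.direction := by
        rw [← S.direction.ker_mkQ, LinearMap.mem_ker, map_sum]
        simpa using hg
      have := hker k _ hmem
      simp only [pair, map_sum, map_smul, smul_eq_mul] at this
      exact (Finset.sum_congr rfl fun j _ =>
        mul_comm (pair ((![v, ξ, η] : Fin 3 → Fin N → ℂ) j) (f k)) (g j)).trans this
    rw [Matrix.det_fin_three] at hdet
    simp [Matrix.of_apply] at hdet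
    linear_combination hdet
  ext x
  have hx : ∀ i, f i x = pair (x -ᵥ p) (f i) := fun i => by
    conv_lhs => rw [← vsub_vadd x p]
    rw [affineFn_vadd, hf i p hp, add_zero]
  simpa [hx] using hlin (x -ᵥ p)

end Affine

namespace Arrangement

noncomputable section Equations

variable {N : ℕ} {C : Arrangement N}

namespace Equations

variable (φ : C.Equations)

theorem inv_mul (j : C.hyps) : φ.inv j * algebraMap _ C.O0 (affPoly (φ.f j)) = 1 := by
  rw [← Localization.mk_one_eq_algebraMap, inv, Localization.mk_mul, one_mul, mul_one]
  exact Localization.mk_self (⟨affPoly (φ.f j), _⟩ : C.nonvanishing)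

theorem locDer_inv (ξ : Fin N → ℂ) (j : C.hyps) :
    locDer C.nonvanishing (constVf ξ) (φ.inv j) =
      -(algebraMap ℂ C.O0 (pair ξ (φ.f j)) * φ.inv j ^ 2) := by
  have h := congrArg (locDer C.nonvanishing (constVf ξ)) (φ.inv_mul j)
  rw [Derivation.leibniz, locDer_algebraMap, constVf_affPoly, Derivation.map_one_eq_zero,
    smul_eq_mul, smul_eq_mul] at h
  have h2 := φ.inv_mul j
  have h3 : algebraMap ℂ C.O0 (pair ξ (φ.f j)) =
    algebraMap (PolyRing N) C.O0 (MvPolynomial.C (pair ξ (φ.f j))) :=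
    IsScalarTower.algebraMap_apply ℂ (PolyRing N) C.O0 _
  rw [h3]
  linear_combination φ.inv j * h - locDer C.nonvanishing (constVf ξ) (φ.inv j) * h2

/-- The function `⟨ξ ∧ η, df_j ∧ df_l⟩ / (f_j f_l)`. -/
def wedge (ξ η : Fin N → ℂ) (j l : C.hyps) : C.O0 :=
  algebraMap ℂ C.O0 (pair ξ (φ.f j) * pair η (φ.f l) - pair η (φ.f j) * pair ξ (φ.f l)) *
    φ.inv j * φ.inv l

theorem eq_zero_of_le {γ : C.Vertex} {j : C.hyps} (h : γ.1 ≤ j.1) (x : Fin N → ℂ)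
    (hx : x ∈ γ.1) : φ.f j x = 0 :=
  (φ.zero_iff j x).2 (h hx)

/-- The Arnold relation. -/
theorem wedge_cocycle (ξ η : Fin N → ℂ) {γ : C.Vertex} (hγ : level γ = 2) {i j l : C.hyps}
    (hi : γ.1 ≤ i.1) (hj : γ.1 ≤ j.1) (hl : γ.1 ≤ l.1) :
    φ.wedge ξ η j l = φ.wedge ξ η j i - φ.wedge ξ η l i := by
  have hd : finrank ℂ (T γ) + 2 = N := by
    have h1 : finrank ℂ (T γ) ≤ N := by simpa using Submodule.finrank_le (T γ)
    rw [level] at hγ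
    omega
  have h := affine_three_dependent γ.1 γ.2.1 hd ![φ.f i, φ.f j, φ.f l]
    (fun k => by
      fin_cases k
      · exact φ.eq_zero_of_le hi
      · exact φ.eq_zero_of_le hj
      · exact φ.eq_zero_of_le hl) ξ η
  have h' := congrArg (fun g => algebraMap (PolyRing N) C.O0 (affPoly g)) h
  simp only [Matrix.cons_val_zero, Matrix.cons_val_one, Matrix.cons_val, affPoly_add, affPoly_smul,
    affPoly_zero, map_add, map_zero, Algebra.smul_def, map_mul,
    ← IsScalarTower.algebraMap_apply ℂ (PolyRing N) C.O0, map_sub] at h'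
  simp only [wedge, map_sub, map_mul]
  have hi' := φ.inv_mul i
  have hj' := φ.inv_mul j
  have hl' := φ.inv_mul l
  generalize algebraMap (PolyRing N) C.O0 (affPoly (φ.f i)) = Fi at *
  generalize algebraMap (PolyRing N) C.O0 (affPoly (φ.f j)) = Fj at *
  generalize algebraMap (PolyRing N) C.O0 (affPoly (φ.f l)) = Fl at *
  generalize algebraMap ℂ C.O0 (pair ξ (φ.f i)) = xi at *
  generalize algebraMap ℂ C.O0 (pair ξ (φ.f j)) = xj at *
  generalize algebraMap ℂ C.O0 (pair ξ (φ.f l)) = xl at *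
  generalize algebraMap ℂ C.O0 (pair η (φ.f i)) = yi at *
  generalize algebraMap ℂ C.O0 (pair η (φ.f j)) = yj at *
  generalize algebraMap ℂ C.O0 (pair η (φ.f l)) = yl at *
  generalize φ.inv i = a at *
  generalize φ.inv j = b at *
  generalize φ.inv l = c at *
  -- The affine dependence is divided by the product of the three equations.
  linear_combination a * b * c * h' - (xj * yl - yj * xl) * b * c * hi' -
    (xl * yi - yl * xi) * a * c * hj' - (xi * yj - yi * xj) * a * b * hl'

/-- Two hyperplanes with independent equations meet in a stratum of level two. -/
theorem exists_level_two {ξ η : Fin N → ℂ} {j l : C.hyps}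
    (h : pair ξ (φ.f j) * pair η (φ.f l) - pair η (φ.f j) * pair ξ (φ.f l) ≠ 0) :
    ∃ γ : C.Vertex, level γ = 2 ∧ γ.1 ≤ j.1 ∧ γ.1 ≤ l.1 ∧
      ∀ γ' : C.Vertex, level γ' = 2 → γ'.1 ≤ j.1 → γ'.1 ≤ l.1 → γ' = γ := by
  set m := pair ξ (φ.f j) * pair η (φ.f l) - pair η (φ.f j) * pair ξ (φ.f l) with hm
  -- Cramer's rule in the span of `ξ` and `η`, with determinant `m ≠ 0`.
  have hsolve : ∀ a b : ℂ, ∃ v : Fin N → ℂ, pair v (φ.f j) = a ∧ pair v (φ.f l) = b := by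
    intro a b
    refine ⟨((a * pair η (φ.f l) - b * pair η (φ.f j)) / m) • ξ +
      ((b * pair ξ (φ.f j) - a * pair ξ (φ.f l)) / m) • η, ?_, ?_⟩ <;>
    · simp only [pair, map_add, map_smul, smul_eq_mul] at *
      field_simp
      rw [hm]
      ring
  obtain ⟨p, hpj, hpl⟩ : ∃ p, φ.f j p = 0 ∧ φ.f l p = 0 := by
    obtain ⟨v, h1, h2⟩ := hsolve (-φ.f j 0) (-φ.f l 0)
    refine ⟨v +ᵥ (0 : Fin N → ℂ), ?_, ?_⟩
    · rw [affineFn_vadd, h1, neg_add_cancel]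
    · rw [affineFn_vadd, h2, neg_add_cancel]
  have hp : p ∈ j.1 ⊓ l.1 := ⟨(φ.zero_iff j p).1 hpj, (φ.zero_iff l p).1 hpl⟩
  let γ : C.Vertex := ⟨j.1 ⊓ l.1, ⟨p, hp⟩, {j.1, l.1}, by
    rintro _ (rfl | rfl)
    · exact j.2
    · exact l.2, (sInf_pair).symm⟩
  have hT : T γ = LinearMap.ker ((φ.f j).linear.prod (φ.f l).linear) := by
    ext v
    rw [← AffineSubspace.vadd_mem_iff_mem_direction v hp]
    change (v +ᵥ p ∈ j.1 ∧ v +ᵥ p ∈ l.1) ↔ _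
    rw [← φ.zero_iff, ← φ.zero_iff, affineFn_vadd, affineFn_vadd, hpj, hpl, add_zero, add_zero,
      LinearMap.mem_ker]
    exact Prod.mk_eq_zero.symm
  have hrank : finrank ℂ (T γ) + 2 = N := by
    have h1 := LinearMap.finrank_range_add_finrank_ker ((φ.f j).linear.prod (φ.f l).linear)
    have h2 : LinearMap.range ((φ.f j).linear.prod (φ.f l).linear) = ⊤ := by
      rw [LinearMap.range_eq_top]
      rintro ⟨a, b⟩
      obtain ⟨v, h1, h2⟩ := hsolve a b
      exact ⟨v, Prod.ext h1 h2⟩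
    rw [h2, finrank_top, finrank_prod, finrank_self, finrank_fin_fun, ← hT] at h1
    omega
  refine ⟨γ, by rw [level]; omega, inf_le_left, inf_le_right, fun γ' h1 h2 h3 => ?_⟩
  have hle : γ'.1 ≤ γ.1 := le_inf h2 h3
  have h4 : finrank ℂ (T γ') + 2 = N := by
    have h5 : finrank ℂ (T γ') ≤ N := by simpa using Submodule.finrank_le (T γ')
    rw [level] at h1
    omega
  refine Subtype.ext (AffineSubspace.eq_of_direction_eq_of_nonempty_of_le ?_ γ'.2.1 hle)
  exact Submodule.eq_of_le_of_finrank_eq (AffineSubspace.direction_le hle)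
    (show finrank ℂ (T γ') = finrank ℂ (T γ) by omega)

open Classical in
/-- The flatness of the logarithmic connection. -/
theorem sum_wedge_tmul (𝒱 : C.LevelZeroQuiver) (ξ η : Fin N → ℂ) :
    ∑ j, ∑ l, φ.wedge ξ η j l ⊗ₜ[ℂ] (𝒱.A j * 𝒱.A l) = 0 := by
  have hlocal : ∀ γ : C.Vertex, level γ = 2 → ∑ j, ∑ l, (if γ.1 ≤ j.1 ∧ γ.1 ≤ l.1 then
      φ.wedge ξ η j l ⊗ₜ[ℂ] (𝒱.A j * 𝒱.A l) else 0) = 0 := by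
    intro γ hγ
    by_cases hex : ∃ i : C.hyps, γ.1 ≤ i.1
    swap
    · refine Finset.sum_eq_zero fun j _ => Finset.sum_eq_zero fun l _ => ?_
      rw [if_neg fun h => hex ⟨j, h.1⟩]
    obtain ⟨i, hi⟩ := hex
    set S : End ℂ 𝒱.V := ∑ i : C.hyps, if γ.1 ≤ i.1 then 𝒱.A i else 0 with hS
    -- With a third hyperplane `i` through `γ` fixed, the Arnold relation splits the coefficient
    -- into a part depending on `j` and a part depending on `l`. After the second part is reindexed,
    -- each `j` contributes `wedge j i ⊗ [A j, S]`, which is zero by the quiver relation.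
    have h1 : ∀ j l : C.hyps, (if γ.1 ≤ j.1 ∧ γ.1 ≤ l.1 then
        φ.wedge ξ η j l ⊗ₜ[ℂ] (𝒱.A j * 𝒱.A l) else 0) =
        (if γ.1 ≤ j.1 then φ.wedge ξ η j i else 0) ⊗ₜ[ℂ]
          (𝒱.A j * (if γ.1 ≤ l.1 then 𝒱.A l else 0)) -
        (if γ.1 ≤ l.1 then φ.wedge ξ η l i else 0) ⊗ₜ[ℂ]
          ((if γ.1 ≤ j.1 then 𝒱.A j else 0) * 𝒱.A l) := by
      intro j l
      by_cases hj : γ.1 ≤ j.1 <;> by_cases hl : γ.1 ≤ l.1 <;> simp [hj, hl]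
      rw [φ.wedge_cocycle ξ η hγ hi hj hl, TensorProduct.sub_tmul]
    rw [Finset.sum_congr rfl fun j _ => Finset.sum_congr rfl fun l _ => h1 j l,
      sum_sum_sub_swap (fun j l => (if γ.1 ≤ j.1 then φ.wedge ξ η j i else 0) ⊗ₜ[ℂ]
          (𝒱.A j * (if γ.1 ≤ l.1 then 𝒱.A l else 0)))
        (fun l j => (if γ.1 ≤ l.1 then φ.wedge ξ η l i else 0) ⊗ₜ[ℂ]
          ((if γ.1 ≤ j.1 then 𝒱.A j else 0) * 𝒱.A l))]
    refine Finset.sum_eq_zero fun j _ => ?_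
    rw [← TensorProduct.tmul_sum, ← TensorProduct.tmul_sum, ← Finset.mul_sum, ← Finset.sum_mul,
      ← hS, ← TensorProduct.tmul_sub]
    by_cases hj : γ.1 ≤ j.1
    · have := 𝒱.flat γ hγ j hj
      rw [Ring.lie_def] at this
      rw [hS, this, TensorProduct.tmul_zero]
    · rw [if_neg hj, TensorProduct.zero_tmul]
  -- A pair with nonzero coefficient lies over exactly one stratum of level two, so the whole sum is
  -- the sum of the local ones.
  have hsplit : ∀ j l : C.hyps, φ.wedge ξ η j l ⊗ₜ[ℂ] (𝒱.A j * 𝒱.A l) =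
      ∑ γ : C.Vertex, if level γ = 2 then (if γ.1 ≤ j.1 ∧ γ.1 ≤ l.1 then
        φ.wedge ξ η j l ⊗ₜ[ℂ] (𝒱.A j * 𝒱.A l) else 0) else 0 := by
    intro j l
    by_cases h : pair ξ (φ.f j) * pair η (φ.f l) - pair η (φ.f j) * pair ξ (φ.f l) = 0
    · simp [wedge, h]
    · obtain ⟨γ, h1, h2, h3, h4⟩ := φ.exists_level_two h
      rw [Finset.sum_eq_single γ]
      · rw [if_pos h1, if_pos ⟨h2, h3⟩]
      · intro γ' _ hne
        split_ifs with h5 h6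
        · exact absurd (h4 γ' h5 h6.1 h6.2) hne
        · rfl
        · rfl
      · simp
  rw [Finset.sum_congr rfl fun j _ => (Finset.sum_congr rfl fun l _ => hsplit j l).trans
    Finset.sum_comm, Finset.sum_comm]
  refine Finset.sum_eq_zero fun γ _ => ?_
  by_cases hγ : level γ = 2
  · simp only [hγ, if_true]
    exact hlocal γ hγ
  · simp [hγ]

end Equations

end Equations

end Arrangement
end QuiverDMod

/-! ### Duality for level zero quivers. -/

namespace QuiverDMod

theorem neg_sub_sum_neg {ι M : Type*} [Fintype ι] [AddCommGroup M] (x : M) (f : ι → M) :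
    -(x - ∑ i, -f i) = -x - ∑ i, f i := by
  rw [Finset.sum_neg_distrib]
  abel

noncomputable section Rmap

theorem partialRange_neg {R F : Type} [Ring R] [AddCommGroup F] [Module R F] {N : ℕ}
    (θ : Fin N → F →ₗ[R] F) (k : ℕ) : partialRange (fun i => -θ i) k = partialRange θ k := by
  simp only [partialRange, LinearMap.range_neg]

theorem IsRegularFamily.neg {R F : Type} [Ring R] [AddCommGroup F] [Module R F] {N : ℕ}
    {θ : Fin N → F →ₗ[R] F} (h : IsRegularFamily θ) : IsRegularFamily fun i => -θ i := by
  intro k x hx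
  rw [partialRange_neg] at hx ⊢
  rw [LinearMap.neg_apply, neg_mem_iff] at hx
  exact h k x hx

variable {O : Type} [CommRing O] [Algebra ℂ O] {W W' : Type} [AddCommGroup W] [Module ℂ W]
  [AddCommGroup W'] [Module ℂ W']

theorem rmap_neg_left (a : DOp O) (A : W →ₗ[ℂ] W') : rmap (-a) A = -rmap a A :=
  tensor_hom_ext fun w => by
    rw [LinearMap.neg_apply, rmap_tmul, rmap_tmul, mul_neg, TensorProduct.neg_tmul]

theorem rmap_neg_right (a : DOp O) (A : W →ₗ[ℂ] W') : rmap a (-A) = -rmap a A :=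
  tensor_hom_ext fun w => by
    rw [LinearMap.neg_apply, rmap_tmul, rmap_tmul, LinearMap.neg_apply, TensorProduct.tmul_neg]

end Rmap

namespace Arrangement

noncomputable section LevelZero

variable {N : ℕ} {C : Arrangement N} (φ : C.Equations) (𝒱 : C.LevelZeroQuiver)

namespace LevelZeroQuiver

/-- The endomorphism of the free module `D ⊗ V` whose image is spanned by the relations of the
quiver D-module attached to a constant vector field. -/
def relMap (ξ : Fin N → ℂ) : DOp C.O0 ⊗[ℂ] 𝒱.V →ₗ[DOp C.O0] DOp C.O0 ⊗[ℂ] 𝒱.V :=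
  rmap (DOp.vf (locDer C.nonvanishing (constVf ξ))) LinearMap.id -
    ∑ j, rmap (DOp.fn (pair ξ (φ.f j) • φ.inv j)) (𝒱.A j)

theorem relMap_tmul (ξ : Fin N → ℂ) (d : DOp C.O0) (v : 𝒱.V) :
    𝒱.relMap φ ξ (d ⊗ₜ v) = (d * DOp.vf (locDer C.nonvanishing (constVf ξ))) ⊗ₜ v -
      ∑ j, (d * DOp.fn (pair ξ (φ.f j) • φ.inv j)) ⊗ₜ 𝒱.A j v := by
  rw [relMap, LinearMap.sub_apply, LinearMap.sum_apply]
  rfl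

theorem relMap_eq_sum (ξ : Fin N → ℂ) (v : 𝒱.V) :
    𝒱.relMap φ ξ (1 ⊗ₜ v) = ∑ i, ξ i • 𝒱.relMap φ (Pi.single i 1) (1 ⊗ₜ v) := by
  have h1 : DOp.vf (locDer C.nonvanishing (constVf ξ)) =
      ∑ i, ξ i • DOp.vf (locDer C.nonvanishing (constVf (Pi.single i 1))) := by
    conv_lhs => rw [locDer_constVf_eq_sum, DOp.vf_sum]
    exact Finset.sum_congr rfl fun i _ => (DOp.vfHom (O := C.O0)).map_smul _ _
  have h2 : ∀ j, DOp.fn (pair ξ (φ.f j) • φ.inv j) =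
      ∑ i, ξ i • DOp.fn (pair (Pi.single i 1) (φ.f j) • φ.inv j) := by
    intro j
    have h3 : pair ξ (φ.f j) = ∑ i, ξ i * pair (Pi.single i 1) (φ.f j) := by
      conv_lhs => rw [pair, ← Finset.univ_sum_single ξ, map_sum]
      refine Finset.sum_congr rfl fun i _ => ?_
      rw [pair, ← smul_eq_mul, ← map_smul, ← Pi.single_smul, smul_eq_mul, mul_one]
    simp only [← DOp.fnHom_apply, ← map_smul, ← map_sum, smul_smul, ← Finset.sum_smul, h3]
  simp only [relMap_tmul, one_mul, smul_sub, Finset.sum_sub_distrib, Finset.smul_sum]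
  rw [h1, TensorProduct.sum_tmul, Finset.sum_comm]
  simp only [TensorProduct.smul_tmul']
  congr 1
  refine Finset.sum_congr rfl fun j _ => ?_
  rw [h2, TensorProduct.sum_tmul]

/-- The composite is arranged so that everything except the first term and the final double sum is
visibly symmetric in `ξ` and `η`; the derivative of `1/f_j` gives a symmetric term too. -/
theorem relMap_relMap (ξ η : Fin N → ℂ) (w : 𝒱.V) :
    𝒱.relMap φ ξ (𝒱.relMap φ η (1 ⊗ₜ w)) =
      (DOp.vf (locDer C.nonvanishing (constVf η)) *
        DOp.vf (locDer C.nonvanishing (constVf ξ))) ⊗ₜ w -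
      ∑ j, (DOp.fn (pair ξ (φ.f j) • φ.inv j) * DOp.vf (locDer C.nonvanishing (constVf η)) +
        DOp.fn (pair η (φ.f j) • φ.inv j) * DOp.vf (locDer C.nonvanishing (constVf ξ)) -
        DOp.fn ((pair ξ (φ.f j) * pair η (φ.f j)) • φ.inv j ^ 2)) ⊗ₜ 𝒱.A j w +
      ∑ j, ∑ l, DOp.fn ((pair ξ (φ.f j) * pair η (φ.f l)) • (φ.inv j * φ.inv l)) ⊗ₜ
        𝒱.A j (𝒱.A l w) := by
  have h1 : ∀ j, DOp.vf (locDer C.nonvanishing (constVf η)) *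
      DOp.fn (pair ξ (φ.f j) • φ.inv j) =
      DOp.fn (pair ξ (φ.f j) • φ.inv j) * DOp.vf (locDer C.nonvanishing (constVf η)) -
        DOp.fn ((pair ξ (φ.f j) * pair η (φ.f j)) • φ.inv j ^ 2) := by
    intro j
    rw [DOp.vf_mul_fn, sub_eq_add_neg]
    congr 1
    rw [Derivation.map_smul, φ.locDer_inv, ← DOp.fnHom_apply, ← DOp.fnHom_apply, ← map_neg,
      ← Algebra.smul_def, smul_neg, smul_smul]
  rw [relMap_tmul, map_sub, map_sum, relMap_tmul]
  simp only [one_mul, relMap_tmul, Finset.sum_sub_distrib, h1, TensorProduct.sub_tmul,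
    TensorProduct.add_tmul, Finset.sum_add_distrib]
  rw [Finset.sum_comm]
  have h2 : ∀ j l, DOp.fn (pair η (φ.f l) • φ.inv l) * DOp.fn (pair ξ (φ.f j) • φ.inv j) =
      DOp.fn ((pair ξ (φ.f j) * pair η (φ.f l)) • (φ.inv j * φ.inv l)) := by
    intro j l
    rw [← DOp.fn_mul, smul_mul_smul_comm, mul_comm (pair η _), mul_comm (φ.inv l)]
  simp only [h2]
  abel

/-- Constant vector fields commute, so the two composites differ by the antisymmetrized double sum.
That is the image of `sum_wedge_tmul` under evaluation at `w`. -/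
theorem relMap_commute (i k : Fin N) :
    Commute (𝒱.relMap φ (Pi.single i 1)) (𝒱.relMap φ (Pi.single k 1)) := by
  refine tensor_hom_ext fun w => ?_
  change 𝒱.relMap φ _ (𝒱.relMap φ _ _) = 𝒱.relMap φ _ (𝒱.relMap φ _ _)
  generalize hξ : (Pi.single i 1 : Fin N → ℂ) = ξ
  generalize hη : (Pi.single k 1 : Fin N → ℂ) = η
  have hc : DOp.vf (locDer C.nonvanishing (constVf η)) *
        DOp.vf (locDer C.nonvanishing (constVf ξ)) = DOp.vf (locDer C.nonvanishing (constVf ξ)) *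
        DOp.vf (locDer C.nonvanishing (constVf η)) := by
    rw [← hξ, ← hη]
    exact (locCoords C.nonvanishing).commute k i
  have hflat := congrArg (TensorProduct.map (DOp.fnHom C.O0).toLinearMap (LinearMap.applyₗ w))
    (φ.sum_wedge_tmul 𝒱 ξ η)
  rw [relMap_relMap, relMap_relMap, hc]
  have h1 : ∀ a b c : DOp C.O0, a + b - c = b + a - c := fun a b c => by rw [add_comm a b]
  rw [Finset.sum_congr rfl fun j _ => congrArg (· ⊗ₜ[ℂ] 𝒱.A j w) (h1 _ _ _)]
  simp only [mul_comm (pair η _)]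
  congr 1
  rw [← sub_eq_zero, ← Finset.sum_sub_distrib, ← map_zero
    (TensorProduct.map (DOp.fnHom C.O0).toLinearMap (LinearMap.applyₗ w)), ← hflat, map_sum]
  refine Finset.sum_congr rfl fun j _ => ?_
  rw [← Finset.sum_sub_distrib, map_sum]
  refine Finset.sum_congr rfl fun l _ => ?_
  rw [← TensorProduct.sub_tmul, TensorProduct.map_tmul, ← DOp.fnHom_apply, ← DOp.fnHom_apply,
    ← map_sub]
  have hw : (pair ξ (φ.f j) * pair η (φ.f l)) • (φ.inv j * φ.inv l) -
      (pair ξ (φ.f l) * pair η (φ.f j)) • (φ.inv j * φ.inv l) = φ.wedge ξ η j l := by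
    rw [Equations.wedge, ← Algebra.smul_def, smul_mul_assoc, mul_comm (pair ξ (φ.f l))]
    exact (sub_smul _ _ _).symm
  rw [hw]
  rfl

/-- Here functions are the coefficients and the `∂ᵢ` are the leading variables; the connection terms
have order zero. -/
theorem relMap_isRegularFamily : IsRegularFamily fun i => 𝒱.relMap φ (Pi.single i 1) := by
  refine isRegularFamily_of_normalOrder (j := DOp.fnHom C.O0) (locCoords C.nonvanishing).skew
    (locCoords C.nonvanishing).bijective_normalOrd (𝒱.relMap_commute φ) fun i w =>
      ⟨∑ j, (pair (Pi.single i 1) (φ.f j) • φ.inv j) ⊗ₜ (-𝒱.A j w), ?_⟩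
  rw [relMap_tmul, one_mul, map_sum, sub_eq_add_neg, ← Finset.sum_neg_distrib]
  simp only [one_mul, TensorProduct.map_tmul, LinearMap.id_apply, ← TensorProduct.tmul_neg]
  rfl

/-- Transposition negates `∂ᵢ` and fixes functions, while the dual quiver negates `(Aʲ)*`. The two
conventions differ by an overall sign, which does not change ranges. -/
theorem relMap_isTranspose (i : Fin N) :
    IsTranspose (locCoords C.nonvanishing) (𝒱.relMap φ (Pi.single i 1))
      (-𝒱.dual.relMap φ (Pi.single i 1)) := by
  have h := (isTranspose_rmap (locCoords C.nonvanishing)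
    (DOp.vf (locDer C.nonvanishing (constVf (Pi.single i 1)))) (LinearMap.id (M := 𝒱.V))).sub
      (IsTranspose.sum Finset.univ fun j => isTranspose_rmap (locCoords C.nonvanishing)
        (DOp.fn (pair (Pi.single i 1) (φ.f j) • φ.inv j)) (𝒱.A j))
  have h1 : (locCoords C.nonvanishing).transpose
      (DOp.vf (locDer C.nonvanishing (constVf (Pi.single i 1)))) =
      -DOp.vf (locDer C.nonvanishing (constVf (Pi.single i 1))) :=
    (locCoords C.nonvanishing).transpose_pd i
  have h2 : -(rmap (DOp.vf (locDer C.nonvanishing (constVf (Pi.single i 1))))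
        (LinearMap.id (M := 𝒱.V)).dualMap -
      ∑ j, rmap (DOp.fn (pair (Pi.single i 1) (φ.f j) • φ.inv j)) (-(𝒱.A j).dualMap)) =
      rmap (-DOp.vf (locDer C.nonvanishing (constVf (Pi.single i 1)))) LinearMap.id.dualMap -
      ∑ j, rmap (DOp.fn (pair (Pi.single i 1) (φ.f j) • φ.inv j)) (𝒱.A j).dualMap := by
    simp only [rmap_neg_right, rmap_neg_left]
    exact neg_sub_sum_neg
      (M := DOp C.O0 ⊗[ℂ] Dual ℂ 𝒱.V →ₗ[DOp C.O0] DOp C.O0 ⊗[ℂ] Dual ℂ 𝒱.V) _ _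
  simp only [h1, Coordinates.transpose_fn] at h
  rw [← h2] at h
  exact h

/-- The quiver D-module as a quotient of `D ⊗ V`. -/
theorem exists_equiv_E : Nonempty (𝒱.E φ ≃ₗ[DOp C.O0]
    (DOp C.O0 ⊗[ℂ] 𝒱.V) ⧸ ⨆ i, LinearMap.range (𝒱.relMap φ (Pi.single i 1))) := by
  let κ := constTopEquiv (T C.openVertex)
  let e : DOp C.O0 ⊗[ℂ] (Om C.openVertex ⊗[ℂ] 𝒱.V) ≃ₗ[DOp C.O0] DOp C.O0 ⊗[ℂ] 𝒱.V :=
    TensorProduct.AlgebraTensorModule.congr (LinearEquiv.refl _ _)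
      (TensorProduct.congr κ (LinearEquiv.refl _ _) ≪≫ₗ TensorProduct.lid ℂ 𝒱.V)
  have he : ∀ d ω v, e (𝒱.elt d ω v) = d ⊗ₜ (κ ω • v) := fun d ω v => rfl
  have hrel : ∀ ξ ω v, e (𝒱.rel φ ξ ω v) = 𝒱.relMap φ ξ (1 ⊗ₜ (κ ω • v)) := by
    intro ξ ω v
    rw [rel, map_sub, map_sum, he, relMap_tmul, one_mul]
    congr 1
    refine Finset.sum_congr rfl fun j _ => ?_
    rw [show pair ξ (φ.f j) • 𝒱.elt (DOp.fn (φ.inv j)) ω (𝒱.A j v) =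
      𝒱.elt (pair ξ (φ.f j) • DOp.fn (φ.inv j)) ω (𝒱.A j v) from TensorProduct.smul_tmul' _ _ _,
      he, one_mul, map_smul, ← DOp.fnHom_apply, ← DOp.fnHom_apply, map_smul]
  refine ⟨Submodule.Quotient.equiv _ _ e (map_span_eq_iSup_range e _ _ ?_ fun i => ?_)⟩
  · rintro _ ⟨ξ, ω, v, rfl⟩
    rw [hrel, relMap_eq_sum]
    refine Submodule.sum_mem _ fun i _ => Submodule.smul_of_tower_mem _ _ ?_
    exact Submodule.mem_iSup_of_mem i ⟨_, rfl⟩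
  · refine range_le_of_tmul _ _ fun w => ?_
    refine ⟨𝒱.rel φ (Pi.single i 1) (κ.symm 1) w, Submodule.subset_span ⟨_, _, _, rfl⟩, ?_⟩
    refine (hrel _ _ _).trans ?_
    rw [κ.apply_symm_apply, one_smul]

end LevelZeroQuiver

theorem RHomDTilde_levelZero :
    Nonempty (RHomDTilde C.O0 N N (𝒱.E φ) ≅ ModuleCat.of (DOp C.O0) (𝒱.dual.E φ)) ∧
      ∀ i : ℕ, i ≠ N → Limits.IsZero (RHomDTilde C.O0 N i (𝒱.E φ)) := by
  obtain ⟨e⟩ := 𝒱.exists_equiv_E φ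
  obtain ⟨e'⟩ := 𝒱.dual.exists_equiv_E φ
  obtain ⟨⟨g⟩, h⟩ := RHomDTilde_of_isTranspose (𝒱.relMap_isTranspose φ) (𝒱.relMap_commute φ)
    (𝒱.relMap_isRegularFamily φ) (𝒱.dual.relMap_isRegularFamily φ).neg
  refine ⟨⟨RHomDTilde_congr N N e ≪≫ g ≪≫ LinearEquiv.toModuleIso
    ((Submodule.quotEquivOfEq _ _ ?_).trans e'.symm)⟩,
    fun i hi => (h i hi).of_iso (RHomDTilde_congr N i e)⟩
  exact iSup_congr fun i => LinearMap.range_neg _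

end LevelZero

end Arrangement
end QuiverDMod

/-! ### The Weyl algebra and normal ordering in a changed polarization. -/

namespace QuiverDMod

noncomputable section Weyl

/-- The mixed commutators contribute `S i j` and `S j i` with opposite signs, so symmetry of `S`
makes them cancel. -/
theorem sum_smul_commute_comm {D : Type} [Ring D] [Algebra ℂ D] {N : ℕ} {x y : Fin N → D}
    (hx : ∀ i j, Commute (x i) (x j))
    (hxy : ∀ i j, y i * x j = x j * y i + if i = j then 1 else 0)
    (hy : ∀ i j, Commute (y i) (y j))
    {S : Matrix (Fin N) (Fin N) ℂ} (hS : ∀ i j, S i j = S j i) (i j : Fin N) :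
    Commute ((∑ k, S i k • x k) - y i) ((∑ k, S j k • x k) - y j) := by
  have h1 : ∀ i j, y i * ∑ k, S j k • x k = (∑ k, S j k • x k) * y i + S j i • 1 := by
    intro i j
    rw [Finset.mul_sum, Finset.sum_mul]
    simp only [mul_smul_comm, hxy, smul_add, Finset.sum_add_distrib, smul_mul_assoc]
    simp
  have h2 : Commute (∑ k, S i k • x k) (∑ k, S j k • x k) :=
    Commute.sum_left _ _ _ fun k _ => Commute.sum_right _ _ _ fun l _ =>
      ((hx k l).smul_left _).smul_right _
  have h3 := h2.eq
  have h4 := (hy i j).eq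
  have h5 := h1 i j
  have h6 := h1 j i
  rw [hS j i] at h5
  change _ * _ = _ * _
  simp only [mul_sub, sub_mul]
  rw [h3, h4, h5, h6]
  abel

variable {N : ℕ}

theorem DOp.fn_C_mul (a : ℂ) (d : DOp (PolyRing N)) : DOp.fn (MvPolynomial.C a) * d = a • d :=
  DOp.fn_algebraMap_mul a d

/-- A subgroup of the Weyl algebra stable under left multiplication by scalars and by the
generators. -/
theorem weyl_mem_of_closed (S : AddSubgroup (DOp (PolyRing N))) (h1 : 1 ∈ S)
    (hC : ∀ a : ℂ, ∀ d ∈ S, a • d ∈ S) (hx : ∀ i, ∀ d ∈ S, DOp.fn (MvPolynomial.X i) * d ∈ S)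
    (hd : ∀ i, ∀ d ∈ S, (polyCoords N).pd i * d ∈ S) (d : DOp (PolyRing N)) : d ∈ S := by
  refine (polyCoords N).mem_of_closed S h1 (fun f => ?_) hd d
  induction f using MvPolynomial.induction_on with
  | C a =>
    intro d hdS
    rw [DOp.fn_C_mul]
    exact hC a d hdS
  | add f g hf hg =>
    intro d hdS
    rw [DOp.fn_add, add_mul]
    exact S.add_mem (hf d hdS) (hg d hdS)
  | mul_X f i hf =>
    intro d hdS
    rw [DOp.fn_mul, mul_assoc]
    exact hf _ (hx i d hdS)

/-- Evaluation of polynomials at commuting elements of a noncommutative algebra. -/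
theorem exists_aeval_of_commute {D : Type} [Ring D] [Algebra ℂ D] {x : Fin N → D}
    (hx : ∀ i j, Commute (x i) (x j)) :
    ∃ j : PolyRing N →ₐ[ℂ] D, ∀ i, j (MvPolynomial.X i) = x i := by
  let R := Algebra.adjoin ℂ (Set.range x)
  have : IsMulCommutative R := Algebra.isMulCommutative_adjoin ℂ (by
    rintro _ ⟨i, rfl⟩ _ ⟨j, rfl⟩
    exact hx i j)
  let : CommRing R := { (inferInstance : Ring R) with mul_comm := this.is_comm.comm }
  let f : PolyRing N →ₐ[ℂ] R :=
    MvPolynomial.aeval fun i => (⟨x i, Algebra.subset_adjoin ⟨i, rfl⟩⟩ : R)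
  exact ⟨R.val.comp f, fun i => congrArg Subtype.val (MvPolynomial.aeval_X _ i)⟩

theorem commutator_aeval {D : Type} [Ring D] [Algebra ℂ D] {x y : Fin N → D}
    (hxy : ∀ i j, y i * x j = x j * y i + if i = j then 1 else 0)
    {j : PolyRing N →ₐ[ℂ] D} (hj : ∀ i, j (MvPolynomial.X i) = x i) (i : Fin N) (f : PolyRing N) :
    y i * j f = j f * y i + j ((polyCoords N).der i f) := by
  induction f using MvPolynomial.induction_on with
  | C a =>
    have h1 : j (MvPolynomial.C a) = algebraMap ℂ D a := j.commutes a
    have h2 : (polyCoords N).der i (MvPolynomial.C a) = 0 := ((polyCoords N).der i).map_algebraMap a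
    rw [h2, map_zero, add_zero, h1, Algebra.commutes]
  | add f g hf hg =>
    rw [map_add, mul_add, hf, hg, map_add, map_add, add_mul]
    abel
  | mul_X f k hf =>
    have h1 : (polyCoords N).der i (MvPolynomial.X k) = if i = k then 1 else 0 :=
      (polyCoords N).der_x i k
    have h2 : j (MvPolynomial.X k * (polyCoords N).der i f) = j ((polyCoords N).der i f) * x k := by
      rw [mul_comm, map_mul, hj]
    have h3 : j (if i = k then 1 else 0) = if i = k then 1 else 0 := by split_ifs <;> simp
    rw [Derivation.leibniz, h1, smul_eq_mul, smul_eq_mul, map_add, h2, map_mul, map_mul, hj, h3,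
      ← mul_assoc, hf, add_mul, mul_assoc, hxy, mul_add]
    simp only [mul_assoc, add_assoc]

/-- The universal property of the Weyl algebra. -/
theorem exists_weyl_hom {D : Type} [Ring D] [Algebra ℂ D] {x y : Fin N → D}
    (hxy : ∀ i j, y i * x j = x j * y i + if i = j then 1 else 0)
    (hy : ∀ i j, Commute (y i) (y j))
    {j : PolyRing N →ₐ[ℂ] D} (hj : ∀ i, j (MvPolynomial.X i) = x i) :
    ∃ σ : DOp (PolyRing N) →+ D, σ 1 = 1 ∧ (∀ f d, σ (DOp.fn f * d) = j f * σ d) ∧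
      ∀ i d, σ ((polyCoords N).pd i * d) = y i * σ d :=
  (polyCoords N).exists_action
    { toFun := fun f => AddMonoidHom.mulLeft (j f)
      map_one' := by ext d; exact (congrArg (· * d) (map_one j)).trans (one_mul d)
      map_mul' := fun f g => by
        ext d
        exact (congrArg (· * d) (map_mul j f g)).trans (mul_assoc _ _ d)
      map_zero' := by ext d; exact (congrArg (· * d) (map_zero j)).trans (zero_mul d)
      map_add' := fun f g => by
        ext d
        exact (congrArg (· * d) (map_add j f g)).trans (add_mul _ _ d) }
    (fun i => AddMonoidHom.mulLeft (y i))
    (fun i k => by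
      ext d
      change y i * (y k * d) = y k * (y i * d)
      rw [← mul_assoc, ← mul_assoc, (hy i k).eq])
    (fun i f => by
      ext d
      change y i * (j f * d) = j f * (y i * d) + j _ * d
      rw [← mul_assoc, ← mul_assoc, commutator_aeval hxy hj, add_mul]) 1

theorem pd_mul_X (i k : Fin N) : (polyCoords N).pd i * DOp.fn (MvPolynomial.X k) =
    DOp.fn (MvPolynomial.X k) * (polyCoords N).pd i + if i = k then 1 else 0 := by
  have h1 : (polyCoords N).der i (MvPolynomial.X k) = if i = k then 1 else 0 :=
    (polyCoords N).der_x i k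
  rw [(polyCoords N).pd_mul_fn, h1]
  split_ifs
  · rw [DOp.fn_one]
  · rw [DOp.fn_zero]

theorem X_commute (i k : Fin N) :
    Commute (DOp.fn (MvPolynomial.X i : PolyRing N)) (DOp.fn (MvPolynomial.X k)) := by
  change _ * _ = _ * _
  rw [← DOp.fn_mul, ← DOp.fn_mul, mul_comm]

/-- The operators `∑ₖ Sⱼₖ xₖ - ∂ⱼ`. -/
def gaugedPd (S : Matrix (Fin N) (Fin N) ℂ) (j : Fin N) : DOp (PolyRing N) :=
  (∑ k, S j k • DOp.fn (MvPolynomial.X k)) - (polyCoords N).pd j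

variable {S : Matrix (Fin N) (Fin N) ℂ}

theorem gaugedPd_commute (hS : ∀ i j, S i j = S j i) (i j : Fin N) :
    Commute (gaugedPd S i) (gaugedPd S j) :=
  sum_smul_commute_comm X_commute pd_mul_X (polyCoords N).commute hS i j

theorem X_mul_gaugedPd (i k : Fin N) : DOp.fn (MvPolynomial.X i) * gaugedPd S k =
    gaugedPd S k * DOp.fn (MvPolynomial.X i) + if i = k then 1 else 0 := by
  have h : DOp.fn (MvPolynomial.X i) * (∑ l, S k l • DOp.fn (MvPolynomial.X l : PolyRing N)) =
      (∑ l, S k l • DOp.fn (MvPolynomial.X l)) * DOp.fn (MvPolynomial.X i) := by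
    rw [Finset.mul_sum, Finset.sum_mul]
    simp only [mul_smul_comm, smul_mul_assoc, (X_commute i _).eq]
  rw [gaugedPd, mul_sub, sub_mul, h, pd_mul_X]
  simp only [eq_comm (a := i)]
  abel

/-- Differential operators can be written uniquely as polynomials in the operators
`∑ₖ Sⱼₖ xₖ - ∂ⱼ` followed by polynomials in the coordinates. -/
theorem exists_gauged_normalOrder (hS : ∀ i j, S i j = S j i) :
    ∃ j : PolyRing N →ₐ[ℂ] DOp (PolyRing N), (∀ i, j (MvPolynomial.X i) = gaugedPd S i) ∧
      (∀ i f, ∃ g, DOp.fn (MvPolynomial.X i) * j f = j f * DOp.fn (MvPolynomial.X i) + j g) ∧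
      Function.Bijective
        (normalOrder j (fun i => DOp.fn (MvPolynomial.X i : PolyRing N)) X_commute) := by
  obtain ⟨j, hj⟩ := exists_aeval_of_commute (gaugedPd_commute hS)
  obtain ⟨j', hj'⟩ := exists_aeval_of_commute (polyCoords N).commute
  -- `σ` is the endomorphism `xᵢ ↦ gaugedPd S i`, `∂ᵢ ↦ xᵢ`, a variant of the Fourier transform. It
  -- carries the standard normal ordering to the required one, so it remains to invert it.
  obtain ⟨σ, h1, hf, hd⟩ := exists_weyl_hom X_mul_gaugedPd X_commute hj
  have hrel : ∀ i k, ((∑ l, S i l • (polyCoords N).pd l) - DOp.fn (MvPolynomial.X i)) *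
      (polyCoords N).pd k = (polyCoords N).pd k *
      ((∑ l, S i l • (polyCoords N).pd l) - DOp.fn (MvPolynomial.X i)) +
      if i = k then 1 else 0 := by
    intro i k
    have h : (polyCoords N).pd k * (∑ l, S i l • (polyCoords N).pd l) =
        (∑ l, S i l • (polyCoords N).pd l) * (polyCoords N).pd k := by
      rw [Finset.mul_sum, Finset.sum_mul]
      simp only [mul_smul_comm, smul_mul_assoc, ((polyCoords N).commute k _).eq]
    rw [mul_sub, sub_mul, h, pd_mul_X]
    simp only [eq_comm (a := k)]
    abel
  have hcomm : ∀ i k, Commute ((∑ l, S i l • (polyCoords N).pd l) - DOp.fn (MvPolynomial.X i))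
      ((∑ l, S k l • (polyCoords N).pd l) - DOp.fn (MvPolynomial.X k)) := by
    intro i k
    have := sum_smul_commute_comm (x := (polyCoords N).pd)
      (y := fun i => -DOp.fn (MvPolynomial.X i : PolyRing N)) (S := fun i k => -S i k)
      (polyCoords N).commute
      (fun i k => by
        rw [mul_neg, pd_mul_X, neg_mul]
        simp only [eq_comm (a := i)]
        abel) (fun i k => ((X_commute i k).neg_left).neg_right) (fun i k => by rw [hS]) i k
    simp only [neg_smul, Finset.sum_neg_distrib, sub_neg_eq_add] at this
    have := this.neg_left.neg_right
    simpa only [neg_add, neg_neg, ← sub_eq_add_neg] using this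
  -- The inverse: `xᵢ ↦ ∂ᵢ` and `∂ᵢ ↦ ∑ₗ Sᵢₗ ∂ₗ - xᵢ`, the second formula being forced by solving
  -- the definition of `gaugedPd` for the remaining coordinate.
  obtain ⟨τ, t1, tf, td⟩ := exists_weyl_hom hrel hcomm hj'
  have hsm : ∀ (r : ℂ) d, σ (r • d) = r • σ d := fun r d => by
    rw [← DOp.fn_C_mul, hf, show j (MvPolynomial.C r) = algebraMap ℂ _ r from j.commutes r,
      Algebra.smul_def]
  have tsm : ∀ (r : ℂ) d, τ (r • d) = r • τ d := fun r d => by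
    rw [← DOp.fn_C_mul, tf, show j' (MvPolynomial.C r) = algebraMap ℂ _ r from j'.commutes r,
      Algebra.smul_def]
  have hστ : ∀ d, σ (τ d) = d := by
    intro d
    refine weyl_mem_of_closed (AddMonoidHom.eqLocus (σ.comp τ) (AddMonoidHom.id _)) ?_ ?_ ?_ ?_ d
    · change σ (τ 1) = 1
      rw [t1, h1]
    · intro a d (hd : σ (τ d) = d)
      change σ (τ (a • d)) = a • d
      rw [tsm, hsm, hd]
    · intro i d (hd' : σ (τ d) = d)
      change σ (τ (_ * d)) = _ * d
      rw [tf, hj', hd, hd']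
    · intro i d (hd' : σ (τ d) = d)
      change σ (τ (_ * d)) = _ * d
      rw [td, sub_mul, map_sub, hf, hj, Finset.sum_mul, map_sum, hd', gaugedPd, sub_mul,
        Finset.sum_mul]
      simp only [smul_mul_assoc, hsm, hd, hd']
      abel
  have hτσ : ∀ d, τ (σ d) = d := by
    intro d
    refine weyl_mem_of_closed (AddMonoidHom.eqLocus (τ.comp σ) (AddMonoidHom.id _)) ?_ ?_ ?_ ?_ d
    · change τ (σ 1) = 1
      rw [h1, t1]
    · intro a d (hd : τ (σ d) = d)
      change τ (σ (a • d)) = a • d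
      rw [hsm, tsm, hd]
    · intro i d (hd' : τ (σ d) = d)
      change τ (σ (_ * d)) = _ * d
      rw [hf, hj, gaugedPd, sub_mul, map_sub, td, Finset.sum_mul, map_sum, hd', sub_mul,
        Finset.sum_mul]
      simp only [smul_mul_assoc, tsm, tf, hj', hd']
      abel
    · intro i d (hd' : τ (σ d) = d)
      change τ (σ (_ * d)) = _ * d
      rw [hd, tf, hj', hd']
  refine ⟨j, hj, fun i f => ⟨_, commutator_aeval X_mul_gaugedPd hj i f⟩, ?_⟩
  have hpow : ∀ α : Fin N → ℕ, σ (commPow (polyCoords N).pd (polyCoords N).commute α) =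
      commPow (fun i => DOp.fn (MvPolynomial.X i : PolyRing N)) X_commute α := by
    intro α
    induction α using multiIndex_induction with
    | h0 => rw [commPow_zero, commPow_zero, h1]
    | hs α i ih => rw [commPow_add_single, commPow_add_single, hd, ih]
  have hcomp : ∀ a, normalOrder j (fun i => DOp.fn (MvPolynomial.X i : PolyRing N)) X_commute a =
      σ ((polyCoords N).normalOrd a) := by
    intro a
    obtain ⟨n, hn⟩ := exists_mem_degLT a
    refine map_mem_of_single (⊥ : AddSubgroup (DOp (PolyRing N))) n
      ((normalOrder j (fun i => DOp.fn (MvPolynomial.X i : PolyRing N))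
        X_commute).toAddMonoidHom - σ.comp (polyCoords N).normalOrd.toAddMonoidHom)
      (fun α f _ => ?_) hn |> fun h => sub_eq_zero.1 h
    change normalOrder j _ _ _ - σ (normalOrder _ _ _ _) = 0
    rw [normalOrder_single, normalOrder_single, DOp.fnHom_apply, hf, hpow, sub_self]
  have hfun : ⇑(normalOrder j (fun i => DOp.fn (MvPolynomial.X i : PolyRing N)) X_commute) =
      σ ∘ (polyCoords N).normalOrd := funext hcomp
  rw [hfun]
  have hbij : Function.Bijective σ :=
    ⟨fun a b h => by rw [← hτσ a, h, hτσ], fun d => ⟨τ d, hστ d⟩⟩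
  exact hbij.comp (polyCoords N).bijective_normalOrd

end Weyl
end QuiverDMod

/-! ### Symmetric forms nondegenerate on several subspaces, and volume forms. -/

namespace QuiverDMod

noncomputable section Forms

variable {E : Type} [AddCommGroup E] [Module ℂ E]

/-- The bilinear form `B` is nondegenerate on the subspace `T`. -/
def NondegOn (B : LinearMap.BilinForm ℂ E) (T : Submodule ℂ E) : Prop :=
  ∀ x ∈ T, (∀ y ∈ T, B x y = 0) → x = 0

variable [FiniteDimensional ℂ E]

/-- The Gram matrix of `B` on a basis of `T`. -/
def gram (B : LinearMap.BilinForm ℂ E) (T : Submodule ℂ E) :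
    Matrix (Fin (finrank ℂ T)) (Fin (finrank ℂ T)) ℂ :=
  Matrix.of fun i j => B (finBasis ℂ T i) (finBasis ℂ T j)

theorem vecMul_gram (B : LinearMap.BilinForm ℂ E) (T : Submodule ℂ E)
    (v : Fin (finrank ℂ T) → ℂ) (j : Fin (finrank ℂ T)) :
    Matrix.vecMul v (gram B T) j = B (∑ i, v i • finBasis ℂ T i : T) (finBasis ℂ T j) := by
  simp [Matrix.vecMul, dotProduct, gram]

theorem nondegOn_iff (B : LinearMap.BilinForm ℂ E) (T : Submodule ℂ E) :
    NondegOn B T ↔ (gram B T).det ≠ 0 := by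
  constructor
  · intro h h0
    obtain ⟨v, hv, hv0⟩ := Matrix.exists_vecMul_eq_zero_iff.2 h0
    apply hv
    set x : T := ∑ i, v i • finBasis ℂ T i with hx
    have hx0 : x = 0 := by
      refine Subtype.ext (h x x.2 fun y hy => ?_)
      have h1 : (B x) ∘ₗ T.subtype = 0 := (finBasis ℂ T).ext fun j => by
        have := congrFun hv0 j
        rw [vecMul_gram] at this
        exact this
      exact congrArg (fun f => f ⟨y, hy⟩) h1
    funext i
    have := congrArg (fun z => (finBasis ℂ T).repr z i) hx0
    simpa [hx, Finsupp.single_apply] using this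
  · intro h x hx hy
    have hs := (finBasis ℂ T).sum_repr ⟨x, hx⟩
    have h1 : Matrix.vecMul (fun i => (finBasis ℂ T).repr ⟨x, hx⟩ i) (gram B T) = 0 := by
      funext j
      rw [vecMul_gram, hs]
      exact hy _ (finBasis ℂ T j).2
    have h2 := Matrix.eq_zero_of_vecMul_eq_zero h h1
    have h3 : (⟨x, hx⟩ : T) = 0 := by
      rw [← hs]
      exact Finset.sum_eq_zero fun i _ => by rw [show (finBasis ℂ T).repr ⟨x, hx⟩ i = 0 from
        congrFun h2 i, zero_smul]
    exact congrArg Subtype.val h3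

/-- The sum of squares of extended coordinates of a basis of `T` works. -/
theorem exists_nondegOn (T : Submodule ℂ E) :
    ∃ B : LinearMap.BilinForm ℂ E, (∀ x y, B x y = B y x) ∧ NondegOn B T := by
  choose l hl using fun i => LinearMap.exists_extend (p := T) ((finBasis ℂ T).coord i)
  have hl' : ∀ i (x : T), l i x = (finBasis ℂ T).repr x i := fun i x =>
    congrArg (fun f => f x) (hl i)
  refine ⟨∑ i, LinearMap.BilinForm.linMulLin (l i) (l i), fun x y => ?_, fun x hx hy => ?_⟩
  · simp [LinearMap.sum_apply, mul_comm]
  · have h1 : ∀ i, (finBasis ℂ T).repr ⟨x, hx⟩ i = 0 := by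
      intro i
      have := hy _ (finBasis ℂ T i).2
      rw [← hl']
      simpa [LinearMap.sum_apply, hl', Finsupp.single_apply] using this
    have h2 : (⟨x, hx⟩ : T) = 0 := (finBasis ℂ T).ext_elem fun i => by rw [h1, map_zero]; rfl
    exact congrArg Subtype.val h2

/-- There is a symmetric form that is nondegenerate on finitely many given subspaces. -/
theorem exists_nondegOn_finset (s : Finset (Submodule ℂ E)) :
    ∃ B : LinearMap.BilinForm ℂ E, (∀ x y, B x y = B y x) ∧ ∀ T ∈ s, NondegOn B T := by
  classical
  induction s using Finset.induction_on with
  | empty => exact ⟨0, by simp, by simp⟩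
  | insert T₀ s _ ih =>
    obtain ⟨B, hB, hBs⟩ := ih
    obtain ⟨B', hB', hB's⟩ := exists_nondegOn T₀
    -- Gram matrices along the line from `B` to `B'`. Their determinants are polynomials, nonzero at
    -- `0` for the old subspaces and at `1` for `T₀`; a parameter avoiding all their roots gives the
    -- required form.
    let M : ∀ T : Submodule ℂ E, Matrix (Fin (finrank ℂ T)) (Fin (finrank ℂ T)) (Polynomial ℂ) :=
      fun T => Matrix.of fun i j => Polynomial.C (gram B T i j) +
        Polynomial.X * Polynomial.C (gram B' T i j - gram B T i j)
    have hM : ∀ T r, (M T).det.eval r = (gram (B + r • (B' - B)) T).det := by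
      intro T r
      rw [← Polynomial.coe_evalRingHom, RingHom.map_det]
      congr 1
      ext i j
      simp [M, gram]
    have hne : ∀ T ∈ insert T₀ s, (M T).det ≠ 0 := by
      intro T hT h0
      rcases Finset.mem_insert.1 hT with rfl | hT
      · have := hM T 1
        rw [h0, Polynomial.eval_zero, one_smul, add_sub_cancel] at this
        exact (nondegOn_iff _ _).1 hB's this.symm
      · have := hM T 0
        rw [h0, Polynomial.eval_zero, zero_smul, add_zero] at this
        exact (nondegOn_iff _ _).1 (hBs T hT) this.symm
    obtain ⟨r, hr⟩ : ∃ r, (∏ T ∈ insert T₀ s, (M T).det).eval r ≠ 0 := by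
      by_contra! h
      exact Finset.prod_ne_zero_iff.2 hne (Polynomial.funext fun r => by simp [h r])
    refine ⟨B + r • (B' - B), fun x y => ?_, fun T hT => ?_⟩
    · simp [hB x y, hB' x y]
    · rw [nondegOn_iff, ← hM]
      rw [Polynomial.eval_prod] at hr
      exact Finset.prod_ne_zero_iff.1 hr T hT

theorem NondegOn.exists_proj {B : LinearMap.BilinForm ℂ E} {T : Submodule ℂ E}
    (h : NondegOn B T) :
    ∃ P : E →ₗ[ℂ] E, (∀ w, P w ∈ T) ∧ ∀ w, ∀ t ∈ T, B (w - P w) t = 0 := by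
  let f : E →ₗ[ℂ] Dual ℂ T := T.dualRestrict ∘ₗ B
  have hinj : Function.Injective (f ∘ₗ T.subtype) := by
    rw [← LinearMap.ker_eq_bot, LinearMap.ker_eq_bot']
    intro x hx
    exact Subtype.ext (h x x.2 fun y hy => congrArg (fun g => g ⟨y, hy⟩) hx)
  let e := LinearMap.linearEquivOfInjective (f ∘ₗ T.subtype) hinj
    (Subspace.dual_finrank_eq (K := ℂ) (V := T)).symm
  refine ⟨T.subtype ∘ₗ e.symm.toLinearMap ∘ₗ f, fun w => (e.symm (f w)).2, fun w t ht => ?_⟩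
  have h1 : e (e.symm (f w)) = f w := e.apply_symm_apply _
  have h2 := congrArg (fun g => g ⟨t, ht⟩) h1
  rw [map_sub, LinearMap.sub_apply, sub_eq_zero]
  exact h2.symm

/-- Gram determinants change by the square of the determinant of a base change. A complex square
root of the Gram determinant of one basis therefore normalizes a volume form for all tuples. -/
theorem exists_constTop_sq (B : LinearMap.BilinForm ℂ E) (T : Submodule ℂ E) :
    ∃ ω : ConstTop T, ∀ t, ω t ^ 2 = (Matrix.of fun i j => B (t i) (t j)).det := by
  obtain ⟨z, hz⟩ := IsAlgClosed.exists_pow_nat_eq (gram B T).det (n := 2) two_pos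
  refine ⟨z • (finBasis ℂ T).det, fun t => ?_⟩
  have h : (Matrix.of fun i j => B (t i) (t j)) =
      ((finBasis ℂ T).toMatrix t).transpose * gram B T * (finBasis ℂ T).toMatrix t := by
    ext i j
    have ht : ∀ i, (t i : E) = ∑ k, (finBasis ℂ T).toMatrix t k i • (finBasis ℂ T k : E) := by
      intro i
      have := congrArg Subtype.val ((finBasis ℂ T).sum_toMatrix_smul_self t i)
      exact this.symm.trans (Submodule.coe_sum _ _ _)
    rw [Matrix.of_apply, ht i, ht j]
    simp [Matrix.mul_apply, gram, LinearMap.sum_apply, Finset.sum_mul, Finset.mul_sum]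
    refine Finset.sum_congr rfl fun k _ => Finset.sum_congr rfl fun l _ => ?_
    ring
  rw [h, Matrix.det_mul, Matrix.det_mul, Matrix.det_transpose, ← hz, AlternatingMap.smul_apply,
    Basis.det_apply, smul_eq_mul]
  ring

theorem constTop_ne_zero {B : LinearMap.BilinForm ℂ E} {T : Submodule ℂ E} (hB : NondegOn B T)
    {ω : ConstTop T} (hω : ∀ t, ω t ^ 2 = (Matrix.of fun i j => B (t i) (t j)).det) : ω ≠ 0 := by
  rintro rfl
  refine (nondegOn_iff B T).1 hB ?_
  rw [gram, ← hω]
  simp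

end Forms

/-! ### Metric frames adapted to an arrangement. -/

namespace Arrangement

noncomputable section Frames

variable {N : ℕ} (C : Arrangement N)

/-- Metric data on the strata of an arrangement: a symmetric form nondegenerate on all strata,
orthogonal projections, base points, volume forms and unit normal vectors. -/
structure Frame where
  B : LinearMap.BilinForm ℂ (Fin N → ℂ)
  symm : ∀ x y, B x y = B y x
  nondeg : ∀ α : C.Vertex, NondegOn B (T α)
  pr : C.Vertex → (Fin N → ℂ) →ₗ[ℂ] (Fin N → ℂ)
  pr_mem : ∀ α w, pr α w ∈ T α
  pr_orth : ∀ α w, ∀ t ∈ T α, B (w - pr α w) t = 0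
  pt : C.Vertex → (Fin N → ℂ)
  pt_mem : ∀ α, pt α ∈ α.1
  pt_orth : ∀ α, ∀ t ∈ T α, B (pt α) t = 0
  ω : ∀ α : C.Vertex, Om α
  ω_sq : ∀ α t, ω α t ^ 2 = (Matrix.of fun i j => B (t i) (t j)).det
  ν : C.Vertex → C.Vertex → (Fin N → ℂ)
  ν_symm : ∀ α β, ν α β = ν β α
  ν_mem : ∀ {α β}, Succ α β → ν α β ∈ T α
  ν_orth : ∀ {α β}, Succ α β → ∀ t ∈ T β, B (ν α β) t = 0
  ν_contract : ∀ {α β} (h : Succ α β),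
    contract h.T_le h.2 ⟨ν α β, ν_mem h⟩ (ω α) = ω β

variable {C}

theorem Succ.not_succ {α β : C.Vertex} (h : Succ α β) : ¬ Succ β α := fun h' => by
  have h1 := h.2
  have h2 := h'.2
  omega

/-- Subtracting its projection to `T β` from a vector of `T α` outside `T β` gives a normal vector.
Contraction with it sends `ω α` to a nonzero multiple of `ω β`, as constant top forms are a line,
and rescaling makes the multiple one. This fixes both length and orientation of the normal. -/
theorem exists_unit_normal {B : LinearMap.BilinForm ℂ (Fin N → ℂ)}
    (hB : ∀ α : C.Vertex, NondegOn B (T α)) (ω : ∀ α : C.Vertex, Om α) (hω : ∀ α, ω α ≠ 0)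
    {α β : C.Vertex} (h : Succ α β) :
    ∃ (n : Fin N → ℂ) (hn : n ∈ T α), (∀ t ∈ T β, B n t = 0) ∧
      contract h.T_le h.2 ⟨n, hn⟩ (ω α) = ω β := by
  obtain ⟨P, hP, hP'⟩ := (hB β).exists_proj
  obtain ⟨x, hxα, hxβ⟩ : ∃ x ∈ T α, x ∉ T β := by
    refine SetLike.exists_of_lt (lt_of_le_of_ne h.T_le fun he => ?_)
    have := h.2
    rw [he] at this
    omega
  have hn : x - P x ∈ T α := (T α).sub_mem hxα (h.T_le (hP x))
  have hn' : x - P x ∉ T β := fun h' => hxβ (by simpa using (T β).add_mem h' (hP x))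
  set η := contract h.T_le h.2 ⟨x - P x, hn⟩ (ω α) with hη
  have hη0 : η ≠ 0 := fun h0 => hω α
    ((contract_bijective h.T_le h.2 ⟨x - P x, hn⟩ hn').1 (by rw [← hη, h0, map_zero]))
  have hc : (constTopEquiv (T β)) η ≠ 0 := by simpa using hη0
  set c := constTopEquiv (T β) (ω β) / constTopEquiv (T β) η with hcdef
  refine ⟨c • (x - P x), (T α).smul_mem _ hn, fun t ht => ?_, ?_⟩
  · rw [map_smul, LinearMap.smul_apply, hP' x t ht, smul_zero]
  · have h1 : contract h.T_le h.2 ⟨c • (x - P x), (T α).smul_mem _ hn⟩ (ω α) = c • η :=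
      contract_smul h.T_le h.2 c ⟨x - P x, hn⟩ (ω α)
    rw [h1]
    apply (constTopEquiv (T β)).injective
    rw [map_smul, smul_eq_mul, hcdef, div_mul_cancel₀ _ hc]

open Classical in
theorem nonempty_frame : Nonempty C.Frame := by
  obtain ⟨B, hB, hBs⟩ := exists_nondegOn_finset (Finset.univ.image fun α : C.Vertex => T α)
  have hnd : ∀ α : C.Vertex, NondegOn B (T α) := fun α => hBs _ (by simp)
  choose pr hpr hpr' using fun α : C.Vertex => (hnd α).exists_proj
  choose ω hω using fun α : C.Vertex => exists_constTop_sq B (T α)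
  choose p hp using fun α : C.Vertex => α.2.1
  have hω0 : ∀ α : C.Vertex, ω α ≠ 0 := fun α => constTop_ne_zero (hnd α) (hω α)
  choose n hn hn' hn'' using fun (α β : C.Vertex) (h : Succ α β) =>
    exists_unit_normal hnd ω hω0 h
  -- The normal belongs to the unoriented edge: it is extended symmetrically, and by zero to
  -- non-adjacent pairs.
  let ν : C.Vertex → C.Vertex → Fin N → ℂ := fun α β =>
    if h : Succ α β then n α β h else if h : Succ β α then n β α h else 0
  have hν : ∀ {α β} (h : Succ α β), ν α β = n α β h := fun h => dif_pos h
  refine ⟨⟨B, hB, hnd, pr, hpr, hpr', fun α => -pr α (p α) +ᵥ p α, fun α => ?_, fun α t ht => ?_,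
    ω, hω, ν, fun α β => ?_, fun h => by rw [hν h]; exact hn _ _ h,
    fun h => by rw [hν h]; exact hn' _ _ h, fun {α β} h => ?_⟩⟩
  · exact AffineSubspace.vadd_mem_of_mem_direction ((T α).neg_mem (hpr α _)) (hp α)
  · rw [← hpr' α (p α) t ht, vadd_eq_add, neg_add_eq_sub]
  · by_cases h : Succ α β
    · simp [ν, h, h.not_succ]
    · by_cases h' : Succ β α
      · simp [ν, h, h']
      · simp [ν, h, h']
  · have h1 : (⟨ν α β, by rw [hν h]; exact hn _ _ h⟩ : T α) = ⟨n α β h, hn α β h⟩ :=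
      Subtype.ext (hν h)
    rw [h1]
    exact hn'' α β h

end Frames

end Arrangement
end QuiverDMod

/-! ### Incidence of strata, rotations of normals, and the wedge form of the quiver relations. -/

namespace QuiverDMod

noncomputable section Contract

variable {E : Type} [AddCommGroup E] [Module ℂ E]

theorem contract_contract {U V W : Submodule ℂ E} (hVU : V ≤ U) (hWV : W ≤ V)
    (h1 : finrank ℂ U = finrank ℂ V + 1) (h2 : finrank ℂ V = finrank ℂ W + 1)
    (h3 : finrank ℂ U = finrank ℂ W + 1 + 1) (ξ : U) (η : V) (ω : ConstTop U)
    (t : Fin (finrank ℂ W) → W) :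
    contract hWV h2 η (contract hVU h1 ξ ω) t =
      ((ω.domDomCongr (finCongr h3)).curryLeft ξ).curryLeft (Submodule.inclusion hVU η)
        (fun i => Submodule.inclusion (hWV.trans hVU) (t i)) := by
  rw [contract_apply]
  change ω _ = ω _
  congr 1
  funext i
  obtain ⟨j, rfl⟩ := (finCongr h1).symm.surjective i
  have hj : finCongr h3 ((finCongr h1).symm j) = Fin.cast (by rw [h2]) j := Fin.ext rfl
  simp only [Function.comp_apply, Equiv.apply_symm_apply, hj]
  refine Fin.cases ?_ (fun l => ?_) j
  · rfl
  · have hl : Fin.cast (by rw [h2] : finrank ℂ V + 1 = finrank ℂ W + 1 + 1) l.succ =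
        (finCongr h2 l).succ := Fin.ext rfl
    rw [hl, Fin.cons_succ, Fin.cons_succ]
    generalize finCongr h2 l = r
    refine Fin.cases ?_ (fun l => ?_) r
    · rfl
    · rfl

end Contract

namespace Arrangement

noncomputable section Frames

variable {N : ℕ} {C : Arrangement N}

theorem vsub_mem_T {α : C.Vertex} {x y : Fin N → ℂ} (hx : x ∈ α.1) (hy : y ∈ α.1) :
    x - y ∈ T α :=
  AffineSubspace.vsub_mem_direction hx hy

/-- Different strata of the same level with a common face have different directions. -/
theorem T_ne_of_common_face {α γ δ : C.Vertex} (hne : α ≠ γ) (h1 : δ.1 ≤ α.1) (h2 : δ.1 ≤ γ.1) :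
    T α ≠ T γ := fun h => by
  obtain ⟨p, hp⟩ := δ.2.1
  exact hne (Subtype.ext (AffineSubspace.ext_of_direction_eq h ⟨p, h1 hp, h2 hp⟩))

/-- For dimension reasons a common facet can only be the intersection of the two closures. -/
theorem common_face_unique {α γ δ δ' : C.Vertex} (hne : α ≠ γ) (h1 : Succ α δ) (h2 : Succ γ δ)
    (h1' : Succ α δ') (h2' : Succ γ δ') : δ' = δ := by
  have hT := T_ne_of_common_face hne h1.1 h2.1
  have hlt : finrank ℂ (T α ⊓ T γ : Submodule ℂ (Fin N → ℂ)) < finrank ℂ (T α) := by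
    refine Submodule.finrank_lt_finrank_of_lt (lt_of_le_of_ne inf_le_left fun h => hT ?_)
    exact Submodule.eq_of_le_of_finrank_eq (inf_eq_left.1 h) (by rw [h1.2, h2.2])
  have key : ∀ {β : C.Vertex}, Succ α β → Succ γ β → β.1 = α.1 ⊓ γ.1 := by
    intro β hα hγ
    obtain ⟨p, hp⟩ := β.2.1
    refine AffineSubspace.eq_of_direction_eq_of_nonempty_of_le ?_ ⟨p, hp⟩ (le_inf hα.1 hγ.1)
    rw [AffineSubspace.direction_inf_of_mem (hα.1 hp) (hγ.1 hp)]
    refine Submodule.eq_of_le_of_finrank_le (le_inf hα.T_le hγ.T_le) ?_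
    have := hα.2
    change finrank ℂ (T α ⊓ T γ : Submodule ℂ (Fin N → ℂ)) ≤ finrank ℂ (T β)
    omega
  exact Subtype.ext ((key h1' h2').trans (key h1 h2).symm)

/-- Two facets of a stratum with different directions have a common facet. -/
theorem exists_common_face {α β γ : C.Vertex} (h1 : Succ β α) (h2 : Succ β γ)
    (hT : T α ≠ T γ) : ∃ δ, Succ α δ ∧ Succ γ δ := by
  have hrank : finrank ℂ (T α) = finrank ℂ (T γ) := by
    have := h1.2
    have := h2.2
    omega
  have hsup : T α ⊔ T γ = T β := by
    refine Submodule.eq_of_le_of_finrank_le (sup_le h1.T_le h2.T_le) ?_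
    have hlt : T α < T α ⊔ T γ := lt_of_le_of_ne le_sup_left fun h => hT
      (Submodule.eq_of_le_of_finrank_eq (sup_eq_left.1 h.symm) hrank.symm).symm
    have := Submodule.finrank_lt_finrank_of_lt hlt
    rw [h1.2]
    omega
  obtain ⟨p, hp⟩ := α.2.1
  obtain ⟨q, hq⟩ := γ.2.1
  have hqp : q - p ∈ T α ⊔ T γ := by
    rw [hsup]
    exact vsub_mem_T (h2.1 hq) (h1.1 hp)
  -- As the two directions span `T β`, the difference of the base points splits, and so the two
  -- affine subspaces meet at `a + p`.
  obtain ⟨a, ha, c, hc, hac⟩ := Submodule.mem_sup.1 hqp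
  have hx1 : a +ᵥ p ∈ α.1 := AffineSubspace.vadd_mem_of_mem_direction ha hp
  have hx2 : a +ᵥ p ∈ γ.1 := by
    have h3 : a +ᵥ p = -c +ᵥ q := by
      rw [vadd_eq_add, vadd_eq_add]
      linear_combination hac
    rw [h3]
    exact AffineSubspace.vadd_mem_of_mem_direction ((T γ).neg_mem hc) hq
  obtain ⟨K, hK, hK'⟩ := α.2.2
  obtain ⟨L, hL, hL'⟩ := γ.2.2
  let δ : C.Vertex := ⟨α.1 ⊓ γ.1, ⟨a +ᵥ p, hx1, hx2⟩, K ∪ L, Set.union_subset hK hL, by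
    rw [sInf_union, ← hK', ← hL']⟩
  have hTδ : T δ = T α ⊓ T γ := AffineSubspace.direction_inf_of_mem hx1 hx2
  have hdim := Submodule.finrank_sup_add_finrank_inf_eq (T α) (T γ)
  rw [hsup, h1.2, ← hTδ] at hdim
  exact ⟨δ, ⟨inf_le_left, by omega⟩, ⟨inf_le_right, by omega⟩⟩

namespace Frame

variable (m : C.Frame)

theorem orth_pr (α : C.Vertex) (w : Fin N → ℂ) {t : Fin N → ℂ} (ht : t ∈ T α) :
    m.B (m.pr α w) t = m.B w t := by
  have := m.pr_orth α w t ht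
  rw [map_sub, LinearMap.sub_apply, sub_eq_zero] at this
  exact this.symm

theorem eq_of_orth (α : C.Vertex) {x y : Fin N → ℂ} (hx : x ∈ T α) (hy : y ∈ T α)
    (h : ∀ t ∈ T α, m.B x t = m.B y t) : x = y :=
  sub_eq_zero.1 (m.nondeg α _ ((T α).sub_mem hx hy) fun t ht => by
    rw [map_sub, LinearMap.sub_apply, h t ht, sub_self])

theorem pr_of_mem {α : C.Vertex} {w : Fin N → ℂ} (hw : w ∈ T α) : m.pr α w = w :=
  m.eq_of_orth α (m.pr_mem α w) hw fun _ ht => m.orth_pr α w ht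

theorem pr_of_orth {α : C.Vertex} {w : Fin N → ℂ} (hw : ∀ t ∈ T α, m.B w t = 0) :
    m.pr α w = 0 :=
  m.eq_of_orth α (m.pr_mem α w) (T α).zero_mem fun t ht => by
    rw [m.orth_pr α w ht, hw t ht, map_zero, LinearMap.zero_apply]

theorem ω_ne_zero (α : C.Vertex) : m.ω α ≠ 0 := constTop_ne_zero (m.nondeg α) (m.ω_sq α)

theorem constTopEquiv_ω_ne_zero (α : C.Vertex) : constTopEquiv (T α) (m.ω α) ≠ 0 := by
  simpa using m.ω_ne_zero α

/-- Adjoining the orthogonal vector `ν` to a basis of `T β` multiplies the Gram determinant by `B(ν,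
ν)`, whereas by `ν_contract` the value of the volume form does not change. -/
theorem ν_self {α β : C.Vertex} (h : Succ α β) : m.B (m.ν α β) (m.ν α β) = 1 := by
  set t := finBasis ℂ (T β) with ht
  have h0 : m.ω β t ≠ 0 := m.constTopEquiv_ω_ne_zero β
  let n : T α := ⟨m.ν α β, m.ν_mem h⟩
  let v : Fin (finrank ℂ (T β) + 1) → T α := Fin.cons n fun i => Submodule.inclusion h.T_le (t i)
  have h1 : m.ω α (fun i => v (finCongr h.2 i)) = m.ω β t := by
    rw [← m.ν_contract h]
    rfl
  have h2 := m.ω_sq α (fun i => v (finCongr h.2 i))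
  have h3 : (Matrix.of fun i j => m.B (v (finCongr h.2 i)) (v (finCongr h.2 j))) =
      (Matrix.of fun i j => m.B (v i) (v j)).submatrix (finCongr h.2) (finCongr h.2) := rfl
  have hv0 : ∀ j : Fin (finrank ℂ (T β)), m.B (v 0) (v j.succ) = 0 := fun j =>
    m.ν_orth h _ (t j).2
  rw [h1, h3, Matrix.det_submatrix_equiv_self, Matrix.det_succ_row_zero, Fin.sum_univ_succ] at h2
  have h4 : (Matrix.of fun i j => m.B (v i) (v j)).submatrix Fin.succ (Fin.succAbove 0) =
      Matrix.of fun i j => m.B (t i) (t j) := rfl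
  rw [h4, ← m.ω_sq β, Finset.sum_eq_zero fun j _ => by
    rw [Matrix.of_apply, hv0, mul_zero, zero_mul], Fin.val_zero, pow_zero, one_mul, add_zero] at h2
  have h5 : m.B (v 0) (v 0) = m.B (m.ν α β) (m.ν α β) := rfl
  rw [Matrix.of_apply, h5] at h2
  exact (mul_right_cancel₀ (pow_ne_zero 2 h0) (by rw [one_mul]; exact h2)).symm

theorem ν_not_mem {α β : C.Vertex} (h : Succ α β) : m.ν α β ∉ T β := fun h' => by
  have := m.ν_orth h _ h'
  rw [m.ν_self h] at this
  exact one_ne_zero this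

theorem sub_smul_ν_mem {α β : C.Vertex} (h : Succ α β) {t : Fin N → ℂ} (ht : t ∈ T α) :
    t - m.B t (m.ν α β) • m.ν α β ∈ T β := by
  have hsup : T β ⊔ Submodule.span ℂ {m.ν α β} = T α := by
    refine Submodule.eq_of_le_of_finrank_le (sup_le h.T_le ?_) ?_
    · rw [Submodule.span_le, Set.singleton_subset_iff]
      exact m.ν_mem h
    · rw [h.2]
      refine Submodule.finrank_lt_finrank_of_lt (lt_of_le_of_ne le_sup_left fun he => ?_)
      refine m.ν_not_mem h ?_
      rw [he]
      exact Submodule.mem_sup_right (Submodule.mem_span_singleton_self _)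
  rw [← hsup] at ht
  obtain ⟨s, hs, y, hy, rfl⟩ := Submodule.mem_sup.1 ht
  obtain ⟨a, rfl⟩ := Submodule.mem_span_singleton.1 hy
  have h1 : m.B (s + a • m.ν α β) (m.ν α β) = a := by
    rw [map_add, LinearMap.add_apply, m.symm s, m.ν_orth h s hs, map_smul, LinearMap.smul_apply,
      m.ν_self h, zero_add, smul_eq_mul, mul_one]
  rw [h1, add_sub_cancel_right]
  exact hs

theorem eq_smul_ν {α β : C.Vertex} (h : Succ α β) {t : Fin N → ℂ} (ht : t ∈ T α)
    (ht' : ∀ s ∈ T β, m.B t s = 0) : t = m.B t (m.ν α β) • m.ν α β :=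
  sub_eq_zero.1 (m.nondeg β _ (m.sub_smul_ν_mem h ht) fun s hs => by
    rw [map_sub, LinearMap.sub_apply, ht' s hs, map_smul, LinearMap.smul_apply, m.ν_orth h s hs,
      smul_zero, sub_zero])

/-- Projections at the two ends of an edge differ along the unit normal only. With `pt_sub` this
controls how the relations change from one stratum to an adjacent one. -/
theorem pr_sub {α β : C.Vertex} (h : Succ α β) (w : Fin N → ℂ) :
    m.pr α w - m.pr β w = m.B w (m.ν α β) • m.ν α β := by
  have h1 := m.sub_smul_ν_mem h (m.pr_mem α w)
  rw [m.orth_pr α w (m.ν_mem h)] at h1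
  have h2 : m.pr α w - m.B w (m.ν α β) • m.ν α β = m.pr β w :=
    m.eq_of_orth β h1 (m.pr_mem β w) fun t ht => by
      rw [map_sub, LinearMap.sub_apply, map_smul, LinearMap.smul_apply, m.ν_orth h t ht,
        smul_zero, sub_zero, m.orth_pr β w ht, m.orth_pr α w (h.T_le ht)]
  rw [← h2, sub_sub_cancel]

theorem pt_sub {α β : C.Vertex} (h : Succ α β) :
    m.pt α - m.pt β = m.B (m.pt α - m.pt β) (m.ν α β) • m.ν α β :=
  m.eq_smul_ν h (vsub_mem_T (m.pt_mem α) (h.1 (m.pt_mem β))) fun s hs => by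
    rw [map_sub, LinearMap.sub_apply, m.pt_orth α s (h.T_le hs), m.pt_orth β s hs, sub_zero]

/-- The unit normal vectors of two flags with the same ends differ by a rotation. -/
theorem exists_rotation {α β β' γ : C.Vertex} (h1 : Succ α β) (h2 : Succ β γ) (h1' : Succ α β')
    (h2' : Succ β' γ) : ∃ c s : ℂ, c ^ 2 + s ^ 2 = 1 ∧
      m.ν α β' = c • m.ν α β + s • m.ν β γ ∧ m.ν β' γ = -s • m.ν α β + c • m.ν β γ := by
  have hexp : ∀ x ∈ T α, (∀ t ∈ T γ, m.B x t = 0) →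
      x = m.B x (m.ν α β) • m.ν α β + m.B x (m.ν β γ) • m.ν β γ := by
    intro x hx hx'
    rw [← m.pr_sub h1, ← m.pr_sub h2, sub_add_sub_cancel, m.pr_of_mem hx, m.pr_of_orth hx',
      sub_zero]
  have hf1 := hexp _ (m.ν_mem h1') fun t ht => m.ν_orth h1' t (h2'.T_le ht)
  have hf2 := hexp _ (h1'.T_le (m.ν_mem h2')) (m.ν_orth h2')
  have he1 := m.ν_self h1
  have he2 := m.ν_self h2
  have he12 := m.ν_orth h1 _ (m.ν_mem h2)
  have hff1 := m.ν_self h1'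
  have hff2 := m.ν_self h2'
  have hff12 := m.ν_orth h1' _ (m.ν_mem h2')
  have he21 : m.B (m.ν β γ) (m.ν α β) = 0 := by rw [m.symm, he12]
  have h3 : finrank ℂ (T α) = finrank ℂ (T γ) + 1 + 1 := by rw [h1.2, h2.2]
  let t := finBasis ℂ (T γ)
  let A : T α → T α → ℂ := fun x y => (((m.ω α).domDomCongr (finCongr h3)).curryLeft x).curryLeft y
    (fun i => Submodule.inclusion (h2.T_le.trans h1.T_le) (t i))
  have hA : ∀ x y, A x y + A y x = 0 := by
    intro x y
    have hself : ∀ x, A x x = 0 := fun x => by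
      simp only [A, AlternatingMap.curryLeft_same]
      rfl
    have := hself (x + y)
    simp only [A, map_add, AlternatingMap.add_apply, AlternatingMap.curryLeft_add,
      LinearMap.add_apply] at this hself ⊢
    rw [hself, hself] at this
    linear_combination this
  let e1 : T α := ⟨m.ν α β, m.ν_mem h1⟩
  let e2 : T α := Submodule.inclusion h1.T_le ⟨m.ν β γ, m.ν_mem h2⟩
  have hAe : A e1 e2 = m.ω γ t := by
    rw [← m.ν_contract h2, ← m.ν_contract h1, contract_contract h1.T_le h2.T_le h1.2 h2.2 h3]
  have hAf : A ⟨m.ν α β', m.ν_mem h1'⟩ (Submodule.inclusion h1'.T_le ⟨m.ν β' γ, m.ν_mem h2'⟩) =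
      m.ω γ t := by
    rw [← m.ν_contract h2', ← m.ν_contract h1', contract_contract h1'.T_le h2'.T_le h1'.2 h2'.2 h3]
  generalize m.B (m.ν α β') (m.ν α β) = m11 at hf1
  generalize m.B (m.ν α β') (m.ν β γ) = m12 at hf1
  generalize m.B (m.ν β' γ) (m.ν α β) = m21 at hf2
  generalize m.B (m.ν β' γ) (m.ν β γ) = m22 at hf2
  have hf1' : (⟨m.ν α β', m.ν_mem h1'⟩ : T α) = m11 • e1 + m12 • e2 := Subtype.ext hf1
  have hf2' : Submodule.inclusion h1'.T_le ⟨m.ν β' γ, m.ν_mem h2'⟩ = m21 • e1 + m22 • e2 :=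
    Subtype.ext hf2
  -- Contracting `ω α` along either flag gives `ω γ`, so the transition matrix preserves the area
  -- form; orthogonality alone would leave the sign open.
  have hdet : m11 * m22 - m12 * m21 = 1 := by
    rw [hf1', hf2'] at hAf
    have h4 : A (m11 • e1 + m12 • e2) (m21 • e1 + m22 • e2) =
        m11 * m21 * A e1 e1 + m11 * m22 * A e1 e2 + m12 * m21 * A e2 e1 + m12 * m22 * A e2 e2 := by
      simp only [A, map_add, map_smul, AlternatingMap.add_apply, AlternatingMap.smul_apply,
        AlternatingMap.curryLeft_add, AlternatingMap.curryLeft_smul, LinearMap.add_apply,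
        LinearMap.smul_apply, smul_eq_mul]
      ring
    have h5 : (m11 * m22 - m12 * m21 - 1) * m.ω γ t = 0 := by
      rw [h4] at hAf
      linear_combination hAf - (m11 * m21 / 2) * hA e1 e1 - (m12 * m22 / 2) * hA e2 e2 -
        m12 * m21 * hA e1 e2 - (m11 * m22 - m12 * m21) * hAe
    exact sub_eq_zero.1 ((mul_eq_zero.1 h5).resolve_right (m.constTopEquiv_ω_ne_zero γ))
  rw [hf1] at hff1 hff12
  rw [hf2] at hff2 hff12
  simp only [map_add, map_smul, LinearMap.add_apply, LinearMap.smul_apply, smul_eq_mul, he1, he2,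
    he12, he21, mul_one, mul_zero, add_zero, zero_add] at hff1 hff2 hff12
  -- An orthogonal matrix of determinant one coincides with its matrix of cofactors.
  have h6 : m22 = m11 := by linear_combination m11 * hdet - m22 * hff1 + m12 * hff12
  have h7 : m21 = -m12 := by linear_combination -m12 * hdet - m21 * hff1 + m11 * hff12
  refine ⟨m11, m12, by linear_combination hff1, hf1, ?_⟩
  rw [hf2, h6, h7]

/-- The two-form `a ∧ b` evaluated on `u, w`. -/
def wedge (u w a b : Fin N → ℂ) : ℂ := m.B u a * m.B w b - m.B w a * m.B u b

theorem wedge_comm (u w a b : Fin N → ℂ) : m.wedge u w a b = -m.wedge u w b a := by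
  simp only [wedge]
  ring

/-- The rotation between the two pairs of normals has determinant one, so the two-form of a flag
depends only on its ends. -/
theorem wedge_flag {α β β' γ : C.Vertex} (h1 : Succ α β) (h2 : Succ β γ) (h1' : Succ α β')
    (h2' : Succ β' γ) (u w : Fin N → ℂ) :
    m.wedge u w (m.ν α β') (m.ν β' γ) = m.wedge u w (m.ν α β) (m.ν β γ) := by
  obtain ⟨c, s, hcs, e1, e2⟩ := m.exists_rotation h1 h2 h1' h2'
  rw [e1, e2]
  simp only [wedge, map_add, map_smul, smul_eq_mul]
  linear_combination (m.B u (m.ν α β) * m.B w (m.ν β γ) - m.B w (m.ν α β) * m.B u (m.ν β γ)) * hcs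

/-- In terms of the rotation both sides are `s` times the area form of the flag. This matches the
path through the upper vertex of a square with the path through the lower one. -/
theorem wedge_square {α β β' γ : C.Vertex} (h1 : Succ α β) (h2 : Succ β γ) (h1' : Succ α β')
    (h2' : Succ β' γ) (u w : Fin N → ℂ) :
    m.wedge u w (m.ν α β) (m.ν α β') = m.wedge u w (m.ν β γ) (m.ν β' γ) := by
  obtain ⟨c, s, -, e1, e2⟩ := m.exists_rotation h1 h2 h1' h2'
  rw [e1, e2]
  simp only [wedge, map_add, map_smul, smul_eq_mul]
  ring

theorem wedge_of_T_eq {α β γ : C.Vertex} (h1 : Succ β α) (h2 : Succ β γ) (hT : T α = T γ)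
    (u w : Fin N → ℂ) : m.wedge u w (m.ν β α) (m.ν β γ) = 0 := by
  have h := m.eq_smul_ν h1 (m.ν_mem h2) fun s hs => m.ν_orth h2 s (hT ▸ hs)
  rw [h]
  simp only [wedge, map_smul, smul_eq_mul]
  ring

/-- For fixed ends the wedge takes the same value at every intermediate vertex that can contribute.
Either this value factors out and a quiver relation kills the sum, or it is zero; the latter covers
exactly the pairs without a relation, namely `α = γ` and parallel strata with no common facet. -/
theorem sum_wedge_smul (𝒱 : C.GraphQuiver) (u w : Fin N → ℂ) (α γ : C.Vertex) :
    ∑ β, m.wedge u w (m.ν α β) (m.ν β γ) • (𝒱.A γ β ∘ₗ 𝒱.A β α) = 0 := by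
  have hconst : ∀ c : ℂ, ∑ β, c • (𝒱.A γ β ∘ₗ 𝒱.A β α) = 0 →
      (∀ β, (Succ α β ∨ Succ β α) → (Succ β γ ∨ Succ γ β) →
        m.wedge u w (m.ν α β) (m.ν β γ) = c) →
      ∑ β, m.wedge u w (m.ν α β) (m.ν β γ) • (𝒱.A γ β ∘ₗ 𝒱.A β α) = 0 := by
    intro c hc h
    rw [← hc]
    refine Finset.sum_congr rfl fun β _ => ?_
    by_cases h1 : Succ α β ∨ Succ β α
    · by_cases h2 : Succ β γ ∨ Succ γ β
      · rw [h β h1 h2]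
      · rw [not_or] at h2
        rw [𝒱.A_eq_zero γ β h2.2 h2.1, LinearMap.zero_comp, smul_zero, smul_zero]
    · rw [not_or] at h1
      rw [𝒱.A_eq_zero β α h1.2 h1.1, LinearMap.comp_zero, smul_zero, smul_zero]
  have hzero : (∀ β, (Succ α β ∨ Succ β α) → (Succ β γ ∨ Succ γ β) →
        m.wedge u w (m.ν α β) (m.ν β γ) = 0) →
      ∑ β, m.wedge u w (m.ν α β) (m.ν β γ) • (𝒱.A γ β ∘ₗ 𝒱.A β α) = 0 :=
    hconst 0 (by simp)
  have hconst' : ∀ c : ℂ, ∑ β, 𝒱.A γ β ∘ₗ 𝒱.A β α = 0 →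
      (∀ β, (Succ α β ∨ Succ β α) → (Succ β γ ∨ Succ γ β) →
        m.wedge u w (m.ν α β) (m.ν β γ) = c) →
      ∑ β, m.wedge u w (m.ν α β) (m.ν β γ) • (𝒱.A γ β ∘ₗ 𝒱.A β α) = 0 :=
    fun c h => hconst c (by rw [← Finset.smul_sum, h, smul_zero])
  by_cases hex : ∃ β, (Succ α β ∨ Succ β α) ∧ (Succ β γ ∨ Succ γ β)
  swap
  · exact hzero fun β h1 h2 => absurd ⟨β, h1, h2⟩ hex
  by_cases hαγ : α = γ
  · subst hαγ
    refine hzero fun β _ _ => ?_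
    rw [m.ν_symm β α, wedge]
    ring
  obtain ⟨β₀, hβ1, hβ2⟩ := hex
  rcases hβ1 with hβ1 | hβ1 <;> rcases hβ2 with hβ2 | hβ2
  · have e1 := hβ1.level_eq
    have e2 := hβ2.level_eq
    refine hconst' (m.wedge u w (m.ν α β₀) (m.ν β₀ γ)) (𝒱.comp_two γ α (by omega)) fun β h1 h2 => ?_
    rcases h1 with h1 | h1 <;> rcases h2 with h2 | h2
    · exact m.wedge_flag hβ1 hβ2 h1 h2 u w
    all_goals
      have e3 := h1.level_eq
      have e4 := h2.level_eq
      omega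
  -- A common facet `β₀` is present. It is the only lower intermediate vertex, and upper ones have
  -- the same wedge by `wedge_square`.
  · have e1 := hβ1.level_eq
    have e2 := hβ2.level_eq
    refine hconst' (m.wedge u w (m.ν α β₀) (m.ν β₀ γ))
      (𝒱.comp_same γ α β₀ (by omega) (Ne.symm hαγ) hβ2 hβ1) fun β h1 h2 => ?_
    rcases h1 with h1 | h1 <;> rcases h2 with h2 | h2
    rotate_left
    · rw [common_face_unique hαγ hβ1 hβ2 h1 h2]
    · rw [m.ν_symm α β, m.wedge_square h1 hβ1 h2 hβ2, m.ν_symm β₀ γ]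
    all_goals
      have e3 := h1.level_eq
      have e4 := h2.level_eq
      omega
  · have e1 := hβ1.level_eq
    have e2 := hβ2.level_eq
    by_cases hδ : ∃ δ, Succ α δ ∧ Succ γ δ
    · obtain ⟨δ, hδ1, hδ2⟩ := hδ
      refine hconst' (m.wedge u w (m.ν α δ) (m.ν δ γ))
        (𝒱.comp_same γ α δ (by omega) (Ne.symm hαγ) hδ2 hδ1) fun β h1 h2 => ?_
      rcases h1 with h1 | h1 <;> rcases h2 with h2 | h2
      rotate_left
      · rw [common_face_unique hαγ hδ1 hδ2 h1 h2]
      · rw [m.ν_symm α β, m.wedge_square h1 hδ1 h2 hδ2, m.ν_symm δ γ]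
      all_goals
        have e3 := h1.level_eq
        have e4 := h2.level_eq
        omega
    -- Without a common facet the two strata must be parallel by `exists_common_face`, so their
    -- normals inside any common upper stratum are proportional.
    · refine hzero fun β h1 h2 => ?_
      rcases h1 with h1 | h1 <;> rcases h2 with h2 | h2
      rotate_left
      · exact absurd ⟨β, h1, h2⟩ hδ
      · rw [m.ν_symm α β]
        refine m.wedge_of_T_eq h1 h2 ?_ u w
        by_contra hT
        exact hδ (exists_common_face h1 h2 hT)
      all_goals
        have e3 := h1.level_eq
        have e4 := h2.level_eq
        omega
  · have e1 := hβ1.level_eq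
    have e2 := hβ2.level_eq
    refine hconst' (m.wedge u w (m.ν α β₀) (m.ν β₀ γ)) (𝒱.comp_two γ α (by omega))
      fun β h1 h2 => ?_
    rcases h1 with h1 | h1 <;> rcases h2 with h2 | h2
    rotate_left 3
    · rw [m.ν_symm α β, m.ν_symm β γ, m.ν_symm α β₀, m.ν_symm β₀ γ, m.wedge_comm,
        m.wedge_flag hβ2 hβ1 h2 h1, ← m.wedge_comm]
    all_goals
      have e3 := h1.level_eq
      have e4 := h2.level_eq
      omega

end Frame

end Frames

end Arrangement
end QuiverDMod

/-! ### Presentation of the quiver D-module by one operator for each vector. -/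

namespace QuiverDMod

namespace Arrangement

noncomputable section Presentation

variable {N : ℕ} {C : Arrangement N}

theorem pi_tensor_hom_ext {O : Type} [CommRing O] [Algebra ℂ O] {ι : Type} [Fintype ι]
    [DecidableEq ι] {V : ι → Type} [∀ i, AddCommGroup (V i)] [∀ i, Module ℂ (V i)] {M : Type}
    [AddCommGroup M] [Module (DOp O) M] {f g : DOp O ⊗[ℂ] (∀ i, V i) →ₗ[DOp O] M}
    (h : ∀ i v, f (1 ⊗ₜ Pi.single i v) = g (1 ⊗ₜ Pi.single i v)) : f = g :=
  tensor_hom_ext fun w => by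
    rw [← Finset.univ_sum_single w, TensorProduct.tmul_sum, map_sum, map_sum]
    exact Finset.sum_congr rfl fun i _ => h i _

namespace Frame

variable (m : C.Frame)

/-- The linear function `B(w, ·)` as a polynomial. -/
def linPoly : (Fin N → ℂ) →ₗ[ℂ] PolyRing N where
  toFun w := affPoly (m.B w).toAffineMap
  map_add' w w' := by
    rw [← affPoly_add]
    congr 1
    ext x
    simp
  map_smul' r w := by
    rw [RingHom.id_apply, ← affPoly_smul]
    congr 1
    ext x
    simp

theorem linPoly_eq_sum (w : Fin N → ℂ) :
    m.linPoly w = ∑ k, m.B w (Pi.single k 1) • MvPolynomial.X k := by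
  change affPoly _ = _
  simp only [affPoly, MvPolynomial.smul_eq_C_mul]
  rw [show (m.B w).toAffineMap 0 = 0 from map_zero (m.B w), map_zero, zero_add]
  rfl

/-- A constant vector field as a differential operator. -/
def dirVf : (Fin N → ℂ) →ₗ[ℂ] DOp (PolyRing N) where
  toFun w := DOp.vf (constVf w)
  map_add' w w' := by
    rw [← DOp.vf_add]
    congr 1
    exact MvPolynomial.derivation_ext fun i => by simp [constVf_X]
  map_smul' r w := by
    rw [RingHom.id_apply]
    refine Eq.trans ?_ ((DOp.vfHom (O := PolyRing N)).map_smul r (constVf w))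
    change DOp.vf _ = DOp.vf _
    congr 1
    refine MvPolynomial.derivation_ext fun i => ?_
    rw [Derivation.smul_apply, constVf_X, constVf_X, Pi.smul_apply, smul_eq_mul, map_mul,
      MvPolynomial.smul_eq_C_mul]

/-- The operator `B(w - pr w, ·) + s ∂_{pr w} - B(w, pt)`. -/
def symbol (s : ℂ) (α : C.Vertex) : (Fin N → ℂ) →ₗ[ℂ] DOp (PolyRing N) :=
  (DOp.fnHom (PolyRing N)).toLinearMap ∘ₗ m.linPoly ∘ₗ (LinearMap.id - m.pr α) +
    s • dirVf ∘ₗ m.pr α - (m.B.flip (m.pt α)).smulRight 1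

theorem symbol_apply (s : ℂ) (α : C.Vertex) (w : Fin N → ℂ) :
    m.symbol s α w = DOp.fn (m.linPoly (w - m.pr α w)) + s • dirVf (m.pr α w) -
      m.B w (m.pt α) • 1 := rfl

open Classical in
/-- The sign `s` on descending edges and `1` on the other ones. -/
def sgn (s : ℂ) (α β : C.Vertex) : ℂ := if Succ α β then s else 1

variable (𝒱 : C.GraphQuiver)

/-- The endomorphism of the free module `D ⊗ ∏ V_α` whose image is spanned by the relations of
the quiver D-module attached to a vector. -/
def relMap (s : ℂ) (w : Fin N → ℂ) :
    DOp (PolyRing N) ⊗[ℂ] (∀ α, 𝒱.V α) →ₗ[DOp (PolyRing N)]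
      DOp (PolyRing N) ⊗[ℂ] (∀ α, 𝒱.V α) :=
  ∑ α, (rmap (m.symbol s α w) (LinearMap.single ℂ 𝒱.V α ∘ₗ LinearMap.proj α) -
    ∑ β, rmap 1 ((sgn s α β * m.B w (m.ν α β)) •
      (LinearMap.single ℂ 𝒱.V β ∘ₗ 𝒱.A β α ∘ₗ LinearMap.proj α)))

theorem relMap_single (s : ℂ) (w : Fin N → ℂ) (d : DOp (PolyRing N)) (α : C.Vertex)
    (v : 𝒱.V α) :
    m.relMap 𝒱 s w (d ⊗ₜ Pi.single α v) = (d * m.symbol s α w) ⊗ₜ Pi.single α v -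
      ∑ β, (sgn s α β * m.B w (m.ν α β)) • (d ⊗ₜ[ℂ] (Pi.single β (𝒱.A β α v) : ∀ α, 𝒱.V α)) := by
  rw [relMap, LinearMap.sum_apply, Finset.sum_eq_single α]
  · rw [LinearMap.sub_apply, LinearMap.sum_apply, rmap_tmul]
    congr 1
    · simp
    · refine Finset.sum_congr rfl fun β _ => ?_
      rw [rmap_tmul, mul_one, LinearMap.smul_apply, TensorProduct.tmul_smul]
      simp
  · intro α' _ hne
    have h0 : (Pi.single α v : ∀ α, 𝒱.V α) α' = 0 := Pi.single_eq_of_ne hne _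
    rw [LinearMap.sub_apply, LinearMap.sum_apply, rmap_tmul, LinearMap.comp_apply,
      LinearMap.proj_apply, h0, map_zero, TensorProduct.tmul_zero, zero_sub, neg_eq_zero]
    refine Finset.sum_eq_zero fun β _ => ?_
    rw [rmap_tmul, LinearMap.smul_apply, LinearMap.comp_apply, LinearMap.comp_apply,
      LinearMap.proj_apply, h0, map_zero, map_zero, smul_zero, TensorProduct.tmul_zero]
  · simp

theorem relMap_add (s : ℂ) (w w' : Fin N → ℂ) :
    m.relMap 𝒱 s (w + w') = m.relMap 𝒱 s w + m.relMap 𝒱 s w' :=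
  pi_tensor_hom_ext fun α v => by
    rw [LinearMap.add_apply, relMap_single, relMap_single, relMap_single]
    simp only [map_add, LinearMap.add_apply, mul_add, add_smul, TensorProduct.add_tmul,
      Finset.sum_add_distrib]
    abel

theorem relMap_smul (s r : ℂ) (w : Fin N → ℂ) :
    m.relMap 𝒱 s (r • w) = r • m.relMap 𝒱 s w :=
  pi_tensor_hom_ext fun α v => by
    rw [LinearMap.smul_apply, relMap_single, relMap_single]
    simp only [map_smul, LinearMap.smul_apply, smul_sub, mul_smul_comm, smul_eq_mul,
      Finset.smul_sum, smul_smul, TensorProduct.smul_tmul', mul_left_comm]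

theorem B_surjective : Function.Surjective m.B := by
  have hinj : Function.Injective m.B := by
    rw [← LinearMap.ker_eq_bot, LinearMap.ker_eq_bot']
    intro x hx
    exact m.nondeg C.openVertex x (by simp [T, openVertex]) fun y _ => by rw [hx]; rfl
  exact (LinearMap.injective_iff_surjective_of_finrank_eq_finrank
      (Subspace.dual_finrank_eq (K := ℂ) (V := Fin N → ℂ)).symm).1 hinj

theorem exists_dualVec : ∃ n : Fin N → Fin N → ℂ,
    ∀ i k, m.B (n i) (Pi.single k 1) = if i = k then 1 else 0 := by
  choose n hn using m.B_surjective
  refine ⟨fun i => n (LinearMap.proj i), fun i k => ?_⟩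
  rw [hn, LinearMap.proj_apply, Pi.single_apply]

/-- The basis dual to the standard one. -/
def dualVec (i : Fin N) : Fin N → ℂ := m.exists_dualVec.choose i

theorem B_dualVec (i k : Fin N) : m.B (m.dualVec i) (Pi.single k 1) = if i = k then 1 else 0 :=
  m.exists_dualVec.choose_spec i k

theorem linPoly_dualVec (i : Fin N) : m.linPoly (m.dualVec i) = MvPolynomial.X i := by
  rw [linPoly_eq_sum]
  simp [B_dualVec]

theorem eq_sum_dualVec (w : Fin N → ℂ) : w = ∑ i, m.B w (Pi.single i 1) • m.dualVec i := by
  have h : m.B (w - ∑ i, m.B w (Pi.single i 1) • m.dualVec i) = 0 := by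
    refine LinearMap.pi_ext' fun k => LinearMap.ext_ring ?_
    simp [LinearMap.sum_apply, B_dualVec]
  exact sub_eq_zero.1 (m.nondeg C.openVertex _ (by simp [T, openVertex]) fun y _ => by
    rw [h]; rfl)

/-- The operators depend linearly on `w`, so the `N` dual basis vectors account for all of them. -/
theorem relMap_mem (s : ℂ) (w : Fin N → ℂ) (x) :
    m.relMap 𝒱 s w x ∈ ⨆ i, LinearMap.range (m.relMap 𝒱 s (m.dualVec i)) := by
  have h : ∀ (t : Finset (Fin N)) (c : Fin N → ℂ), m.relMap 𝒱 s (∑ i ∈ t, c i • m.dualVec i) x ∈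
      ⨆ i, LinearMap.range (m.relMap 𝒱 s (m.dualVec i)) := by
    intro t c
    induction t using Finset.induction_on with
    | empty =>
      have := m.relMap_smul 𝒱 s 0 0
      rw [zero_smul, zero_smul] at this
      rw [Finset.sum_empty, this]
      exact Submodule.zero_mem _
    | insert i t hi ih =>
      rw [Finset.sum_insert hi, relMap_add, relMap_smul, LinearMap.add_apply, LinearMap.smul_apply]
      exact Submodule.add_mem _ (Submodule.smul_of_tower_mem _ _
        (Submodule.mem_iSup_of_mem i (LinearMap.mem_range_self _ x))) ih
  rw [m.eq_sum_dualVec w]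
  exact h _ _

/-- The identification of the constant top forms on a stratum with the scalars that sends the
volume form to `1`. -/
def κ (α : C.Vertex) : Om α ≃ₗ[ℂ] ℂ :=
  (constTopEquiv (T α)).trans (LinearEquiv.smulOfNeZero ℂ ℂ (constTopEquiv (T α) (m.ω α))⁻¹
    (inv_ne_zero (m.constTopEquiv_ω_ne_zero α)))

theorem κ_ω (α : C.Vertex) : m.κ α (m.ω α) = 1 :=
  inv_mul_cancel₀ (m.constTopEquiv_ω_ne_zero α)

theorem eq_κ_smul {α : C.Vertex} (ω : Om α) : ω = m.κ α ω • m.ω α :=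
  (m.κ α).injective (by rw [map_smul, κ_ω, smul_eq_mul, mul_one])

theorem contract_ω {α β : C.Vertex} (h : Succ α β) (ξ : T α) :
    contract h.T_le h.2 ξ (m.ω α) = m.B ξ (m.ν α β) • m.ω β := by
  have h1 : ξ = (ξ - m.B ξ (m.ν α β) • (⟨m.ν α β, m.ν_mem h⟩ : T α)) +
      m.B ξ (m.ν α β) • ⟨m.ν α β, m.ν_mem h⟩ := by simp
  conv_lhs => rw [h1]
  rw [contract_add, contract_smul, m.ν_contract h,
    contract_of_mem h.T_le h.2 _ (m.sub_smul_ν_mem h ξ.2), zero_add]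

theorem pair_eq {α β : C.Vertex} (h : Succ α β) {ξ : Fin N → ℂ} (hξ : ξ ∈ T α) {f : AffineFn N}
    (hf : f ∈ F β) : pair ξ f = m.B ξ (m.ν α β) * pair (m.ν α β) f := by
  have := pair_eq_zero_of_mem hf (m.sub_smul_ν_mem h hξ)
  rw [pair, map_sub, map_smul, sub_eq_zero] at this
  exact this

/-- The framing cancels: `π_{β,α}` carries the inverse of the pairing of the framing vector with the
framing function, and every pairing on `T α` with a function of `F β` is proportional to `B(·, ν)`.
-/
theorem pair_mul_κ_piDown (φ : C.EdgeFraming) {α β : C.Vertex} (h : Succ α β) {ξ : Fin N → ℂ}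
    (hξ : ξ ∈ T α) (ω : Om α) :
    pair ξ (φ.f β α) * m.κ β (piDown φ h ω) = m.B ξ (m.ν α β) * m.κ α ω := by
  have h0 := pair_framing_ne_zero φ h
  rw [m.pair_eq h (φ.ξ_mem h) (φ.f_mem h)] at h0
  have h1 : piDown φ h ω = (m.κ α ω * ((pair (φ.ξ α β) (φ.f β α))⁻¹ *
      m.B (φ.ξ α β) (m.ν α β))) • m.ω β := by
    conv_lhs => rw [m.eq_κ_smul ω]
    rw [map_smul, piDown, LinearMap.smul_apply, m.contract_ω h, smul_smul, smul_smul, mul_assoc]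
  rw [h1, map_smul, κ_ω, smul_eq_mul, mul_one, m.pair_eq h hξ (φ.f_mem h),
    m.pair_eq h (φ.ξ_mem h) (φ.f_mem h)]
  have h2 := left_ne_zero_of_mul h0
  have h3 := right_ne_zero_of_mul h0
  field_simp

theorem κ_piUp (φ : C.EdgeFraming) {α β : C.Vertex} (h : Succ α β) (ω : Om β) :
    m.B (φ.ξ α β) (m.ν α β) * m.κ α (piUp φ h ω) = m.κ β ω := by
  have h1 := (piUp_spec φ h ω (piUp φ h ω)).1 rfl
  rw [m.eq_κ_smul (piUp φ h ω), map_smul, m.contract_ω h, smul_smul] at h1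
  have h2 := congrArg (m.κ β) h1
  rw [map_smul, κ_ω, smul_eq_mul, mul_one] at h2
  rw [← h2, mul_comm]

/-- The affine functions vanishing on a stratum. -/
theorem exists_mem_F_iff (α : C.Vertex) (f : AffineFn N) : f ∈ F α ↔
    ∃ w, (∀ t ∈ T α, m.B w t = 0) ∧
      f = (m.B w).toAffineMap - AffineMap.const ℂ (Fin N → ℂ) (m.B w (m.pt α)) := by
  constructor
  · intro hf
    obtain ⟨w, hw⟩ := m.B_surjective f.linear
    have hpt : f (m.pt α) = 0 := hf _ (m.pt_mem α)
    refine ⟨w, fun t ht => ?_, ?_⟩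
    · rw [hw]
      exact pair_eq_zero_of_mem hf ht
    · ext x
      have h1 := affineFn_vadd f (x - m.pt α) (m.pt α)
      rw [vadd_eq_add, sub_add_cancel, hpt, add_zero, pair, map_sub] at h1
      rw [h1, hw]
      rfl
  · rintro ⟨w, hw, rfl⟩ x hx
    have := hw _ (vsub_mem_T hx (m.pt_mem α))
    rw [map_sub] at this
    exact this

theorem affPoly_sub_const (w : Fin N → ℂ) (a : ℂ) :
    affPoly ((m.B w).toAffineMap - AffineMap.const ℂ (Fin N → ℂ) a) =
      m.linPoly w - MvPolynomial.C a := by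
  have h1 : affPoly (AffineMap.const ℂ (Fin N → ℂ) a) = MvPolynomial.C a := by
    simp [affPoly, pair]
  have h2 := affPoly_add ((m.B w).toAffineMap - AffineMap.const ℂ (Fin N → ℂ) a)
    (AffineMap.const ℂ (Fin N → ℂ) a)
  rw [sub_add_cancel, h1] at h2
  exact eq_sub_of_add_eq h2.symm

-- At each stratum `w` is the sum of its tangential and normal parts, on which `relMap` reproduces
-- the two kinds of defining relations, so both submodules coincide. The tangential relations are
-- only rescaled by `s`; this freedom is used with `s = 1` for a quiver and `s = -1` for its dual.
open Classical in
theorem exists_equiv_E (φ : C.EdgeFraming) {s : ℂ} (hs : s ≠ 0) :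
    Nonempty (𝒱.E φ ≃ₗ[DOp (PolyRing N)] (DOp (PolyRing N) ⊗[ℂ] (∀ α, 𝒱.V α)) ⧸
      ⨆ i, LinearMap.range (m.relMap 𝒱 s (m.dualVec i))) := by
  let e₀ : 𝒱.Gen ≃ₗ[ℂ] (∀ α, 𝒱.V α) :=
    (DirectSum.linearEquivFunOnFintype ℂ C.Vertex fun α => Om α ⊗[ℂ] 𝒱.V α) ≪≫ₗ
      LinearEquiv.piCongrRight fun α =>
        TensorProduct.congr (m.κ α) (LinearEquiv.refl ℂ (𝒱.V α)) ≪≫ₗ TensorProduct.lid ℂ (𝒱.V α)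
  have he₀ : ∀ α ω v, e₀ (DirectSum.lof ℂ C.Vertex (fun α => Om α ⊗[ℂ] 𝒱.V α) α (ω ⊗ₜ[ℂ] v)) =
      Pi.single α (m.κ α ω • v) := by
    intro α ω v
    funext β
    simp only [e₀, LinearEquiv.trans_apply, DirectSum.linearEquivFunOnFintype_lof,
      LinearEquiv.piCongrRight_apply]
    rcases eq_or_ne β α with rfl | hne
    · simp
    · simp [Pi.single_eq_of_ne hne]
  let e : DOp (PolyRing N) ⊗[ℂ] 𝒱.Gen ≃ₗ[DOp (PolyRing N)]
      DOp (PolyRing N) ⊗[ℂ] (∀ α, 𝒱.V α) :=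
    TensorProduct.AlgebraTensorModule.congr (LinearEquiv.refl _ _) e₀
  have he : ∀ d α ω v, e (𝒱.elt d α ω v) = d ⊗ₜ Pi.single α (m.κ α ω • v) := fun d α ω v =>
    congrArg (d ⊗ₜ[ℂ] ·) (he₀ α ω v)
  have hes : ∀ (c : ℂ) d α ω v, e (c • 𝒱.elt d α ω v) =
      c • (d ⊗ₜ[ℂ] (Pi.single α (m.κ α ω • v) : ∀ α, 𝒱.V α)) := fun c d α ω v =>
    (he (c • d) α ω v)
  -- For tangential `ξ` the symbol reduces to `s ∂_ξ`, because `pt α` is orthogonal to `T α`.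
  -- Ascending edges drop out since their normals are orthogonal to `T α`, and descending ones carry
  -- the factor `s` from `sgn`.
  have hVf : ∀ α (ξ : T α) ω v, s • e (𝒱.relVf φ α ξ ω v) =
      m.relMap 𝒱 s ξ (1 ⊗ₜ Pi.single α (m.κ α ω • v)) := by
    intro α ξ ω v
    rw [relMap_single, one_mul, symbol_apply, m.pr_of_mem ξ.2, sub_self, map_zero, DOp.fn_zero,
      zero_add, m.symm, m.pt_orth α _ ξ.2, zero_smul, sub_zero, GraphQuiver.relVf, map_sub,
      map_sum, smul_sub, he, Finset.smul_sum]
    congr 1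
    refine Finset.sum_congr rfl fun β _ => ?_
    by_cases h : Succ α β
    · rw [dif_pos h, hes, sgn, if_pos h, ← TensorProduct.tmul_smul, ← TensorProduct.tmul_smul,
        ← TensorProduct.tmul_smul, ← Pi.single_smul, ← Pi.single_smul, ← Pi.single_smul, map_smul,
        smul_smul, smul_smul, smul_smul, mul_assoc, m.pair_mul_κ_piDown φ h ξ.2, ← mul_assoc]
    · rw [dif_neg h, map_zero, smul_zero]
      by_cases h' : Succ β α
      · rw [m.symm, m.ν_symm, m.ν_orth h' _ ξ.2, mul_zero, zero_smul]
      · rw [𝒱.A_eq_zero β α h' h, LinearMap.zero_apply, Pi.single_zero, TensorProduct.tmul_zero,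
          smul_zero]
  -- For normal `w` the symbol is the function itself; descending edges drop out, their normals
  -- being tangent to `α`.
  have hFn : ∀ α (f : F α) (w : Fin N → ℂ) (_ : ∀ t ∈ T α, m.B w t = 0)
      (_ : (f : AffineFn N) = (m.B w).toAffineMap -
        AffineMap.const ℂ (Fin N → ℂ) (m.B w (m.pt α))) ω v, e (𝒱.relFn φ α f ω v) =
      m.relMap 𝒱 s w (1 ⊗ₜ Pi.single α (m.κ α ω • v)) := by
    intro α f w hw hf ω v
    rw [relMap_single, one_mul, symbol_apply, m.pr_of_orth hw, sub_zero, map_zero, smul_zero,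
      add_zero, GraphQuiver.relFn, map_sub, map_sum, he, hf, affPoly_sub_const]
    congr 1
    · congr 1
      rw [← DOp.fnHom_apply, map_sub, DOp.fnHom_apply]
      congr 1
      exact ((DOp.fnHom (PolyRing N)).commutes _).trans (Algebra.algebraMap_eq_smul_one _)
    · refine Finset.sum_congr rfl fun β _ => ?_
      by_cases h : Succ β α
      · have h1 : pair (φ.ξ β α) ((m.B w).toAffineMap -
            AffineMap.const ℂ (Fin N → ℂ) (m.B w (m.pt α))) = m.B w (φ.ξ β α) := by
          simp [pair]
        have h2 : m.B w (φ.ξ β α) = m.B (φ.ξ β α) (m.ν β α) * m.B w (m.ν β α) := by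
          have := hw _ (m.sub_smul_ν_mem h (φ.ξ_mem h))
          rw [map_sub, map_smul, sub_eq_zero] at this
          exact this
        rw [dif_pos h, hes, h1, h2, sgn, if_neg h.not_succ, one_mul, ← TensorProduct.tmul_smul,
          ← TensorProduct.tmul_smul, ← Pi.single_smul, ← Pi.single_smul, map_smul, smul_smul,
          smul_smul, mul_right_comm, m.κ_piUp, m.ν_symm α β, mul_comm]
      · rw [dif_neg h, map_zero]
        by_cases h' : Succ α β
        · rw [hw _ (m.ν_mem h'), mul_zero, zero_smul]
        · rw [𝒱.A_eq_zero β α h h', LinearMap.zero_apply, Pi.single_zero, TensorProduct.tmul_zero,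
            smul_zero]
  refine ⟨Submodule.Quotient.equiv _ _ e (map_span_eq_iSup_range e _ _ ?_ fun i => ?_)⟩
  · rintro _ (⟨α, ξ, ω, v, rfl⟩ | ⟨α, f, ω, v, rfl⟩)
    · have h1 : e (𝒱.relVf φ α ξ ω v) = s⁻¹ • s • e (𝒱.relVf φ α ξ ω v) := by
        rw [smul_smul, inv_mul_cancel₀ hs, one_smul]
      rw [h1, hVf]
      exact Submodule.smul_of_tower_mem _ _ (m.relMap_mem 𝒱 s _ _)
    · obtain ⟨w, hw, hf⟩ := (m.exists_mem_F_iff α f).1 f.2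
      rw [hFn α f w hw hf]
      exact m.relMap_mem 𝒱 s _ _
  · refine range_le_of_tmul _ _ fun x => ?_
    rw [← Finset.univ_sum_single x, TensorProduct.tmul_sum, map_sum]
    refine Submodule.sum_mem _ fun α _ => ?_
    generalize m.dualVec i = w
    have h1 : w = m.pr α w + (w - m.pr α w) := by abel
    have hκ : ∀ v : 𝒱.V α, v = m.κ α (m.ω α) • v := fun v => by rw [κ_ω, one_smul]
    rw [h1, relMap_add, LinearMap.add_apply, hκ (x α)]
    refine Submodule.add_mem _ ?_ ?_
    · have h2 := hVf α ⟨m.pr α w, m.pr_mem α w⟩ (m.ω α) (x α)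
      refine h2 ▸ Submodule.smul_of_tower_mem _ _ ?_
      exact ⟨_, Submodule.subset_span (Or.inl ⟨_, _, _, _, rfl⟩), rfl⟩
    · have hw := m.pr_orth α w
      let f : F α := ⟨_, (m.exists_mem_F_iff α _).2 ⟨w - m.pr α w, hw, rfl⟩⟩
      have h2 := hFn α f (w - m.pr α w) hw rfl (m.ω α) (x α)
      exact h2 ▸ ⟨_, Submodule.subset_span (Or.inr ⟨_, _, _, _, rfl⟩), rfl⟩

end Frame

end Presentation

end Arrangement
end QuiverDMod

/-! ### Commutativity and regularity of the relation operators. -/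

namespace QuiverDMod

namespace Arrangement

noncomputable section QuiverDuality

variable {N : ℕ} {C : Arrangement N}

namespace Frame

variable (m : C.Frame)

theorem constVf_linPoly (a b : Fin N → ℂ) :
    constVf b (m.linPoly a) = MvPolynomial.C (m.B a b) :=
  constVf_affPoly b _

theorem dirVf_mul_fn (a b : Fin N → ℂ) : dirVf b * DOp.fn (m.linPoly a) =
    DOp.fn (m.linPoly a) * dirVf b + m.B a b • 1 := by
  change DOp.vf _ * _ = _ * DOp.vf _ + _
  rw [DOp.vf_mul_fn, constVf_linPoly]
  congr 1
  rw [← mul_one (DOp.fn _), DOp.fn_C_mul]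

theorem dirVf_eq_sum (a : Fin N → ℂ) : dirVf a = ∑ k, a k • (polyCoords N).pd k := by
  change DOp.vf (constVf a) = _
  rw [constVf_eq_sum, DOp.vf_sum]
  exact Finset.sum_congr rfl fun k _ => (DOp.vfHom (O := PolyRing N)).map_smul _ _

theorem fn_linPoly (a : Fin N → ℂ) :
    DOp.fn (m.linPoly a) = ∑ k, m.B a (Pi.single k 1) • DOp.fn (MvPolynomial.X k) := by
  simp only [linPoly_eq_sum, ← DOp.fnHom_apply, map_sum, map_smul]

theorem dirVf_commute (a b : Fin N → ℂ) :
    Commute (dirVf a : DOp (PolyRing N)) (dirVf b) := by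
  rw [dirVf_eq_sum, dirVf_eq_sum]
  exact Commute.sum_left _ _ _ fun i _ => Commute.sum_right _ _ _ fun k _ =>
    (((polyCoords N).commute i k).smul_left _).smul_right _

theorem symbol_commute (s : ℂ) (α : C.Vertex) (u w : Fin N → ℂ) :
    Commute (m.symbol s α u) (m.symbol s α w) := by
  have h1 : ∀ u w, Commute (dirVf (m.pr α u)) (DOp.fn (m.linPoly (w - m.pr α w))) := by
    intro u w
    change _ * _ = _ * _
    rw [dirVf_mul_fn, m.pr_orth α w _ (m.pr_mem α u), zero_smul, add_zero]
  have h2 : ∀ f g : PolyRing N, Commute (DOp.fn f) (DOp.fn g) := by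
    intro f g
    change _ * _ = _ * _
    rw [← DOp.fn_mul, ← DOp.fn_mul, mul_comm]
  rw [symbol_apply, symbol_apply]
  refine Commute.sub_left (Commute.sub_right ?_ ((Commute.one_right _).smul_right _))
    ((Commute.one_left _).smul_left _)
  exact Commute.add_left (Commute.add_right (h2 _ _) ((h1 w u).symm.smul_right s))
    (Commute.add_right ((h1 u w).smul_left s)
      (((dirVf_commute _ _).smul_left s).smul_right s))

/-- By `pr_sub` and `pt_sub` all three ingredients of the symbol change along the normal of the
edge, proportionally to `B(u, ν)`. -/
theorem exists_symbol_sub {α β : C.Vertex} (h : Succ α β) :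
    ∃ z : DOp (PolyRing N), ∀ u, m.symbol 1 α u - m.symbol 1 β u = m.B u (m.ν α β) • z := by
  obtain ⟨k, hk⟩ : ∃ k, m.pt α - m.pt β = k • m.ν α β := ⟨_, m.pt_sub h⟩
  refine ⟨dirVf (m.ν α β) - DOp.fn (m.linPoly (m.ν α β)) - k • 1, fun u => ?_⟩
  have h1 := m.pr_sub h u
  have h2 : dirVf (m.pr α u) - dirVf (m.pr β u) =
      m.B u (m.ν α β) • (dirVf (m.ν α β) : DOp (PolyRing N)) := by
    rw [← map_sub, h1, map_smul]
  have h3 : DOp.fn (m.linPoly (u - m.pr α u)) - DOp.fn (m.linPoly (u - m.pr β u)) =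
      -(m.B u (m.ν α β) • DOp.fn (m.linPoly (m.ν α β))) := by
    rw [← DOp.fnHom_apply, ← DOp.fnHom_apply, ← DOp.fnHom_apply, ← map_sub, ← map_sub,
      sub_sub_sub_cancel_left, ← neg_sub, h1, map_neg, map_neg, map_smul, map_smul]
  have h4 : m.B u (m.pt α) - m.B u (m.pt β) = k * m.B u (m.ν α β) := by
    rw [← map_sub, hk, map_smul, smul_eq_mul]
  have h5 : m.B u (m.pt α) • (1 : DOp (PolyRing N)) - m.B u (m.pt β) • 1 =
      (k * m.B u (m.ν α β)) • 1 := by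
    rw [← sub_smul, h4]
  rw [symbol_apply, symbol_apply, one_smul, one_smul, smul_sub, smul_sub, ← h2, smul_smul,
    mul_comm _ k, ← h5]
  rw [sub_eq_iff_eq_add.1 h3]
  abel

/-- These are the terms of the composite linear in the quiver maps. They are symmetric in `u` and
`w` because symbol differences along an edge are multiples of one operator. -/
theorem symbol_exchange {α β : C.Vertex} (h : Succ α β ∨ Succ β α) (u w : Fin N → ℂ) :
    m.B w (m.ν α β) • m.symbol 1 α u + m.B u (m.ν α β) • m.symbol 1 β w =
      m.B u (m.ν α β) • m.symbol 1 α w + m.B w (m.ν α β) • m.symbol 1 β u := by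
  rcases h with h | h
  · obtain ⟨z, hz⟩ := m.exists_symbol_sub h
    rw [sub_eq_iff_eq_add.1 (hz u), sub_eq_iff_eq_add.1 (hz w), smul_add, smul_add, smul_smul,
      smul_smul, mul_comm]
    abel
  · obtain ⟨z, hz⟩ := m.exists_symbol_sub h
    rw [m.ν_symm α β, sub_eq_iff_eq_add.1 (hz u), sub_eq_iff_eq_add.1 (hz w), smul_add, smul_add,
      smul_smul, smul_smul, mul_comm]
    abel

theorem sgn_one (α β : C.Vertex) : sgn 1 α β = 1 := ite_self _

variable (𝒱 : C.GraphQuiver)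

theorem relMap_relMap (u w : Fin N → ℂ) (α : C.Vertex) (v : 𝒱.V α) :
    m.relMap 𝒱 1 w (m.relMap 𝒱 1 u (1 ⊗ₜ Pi.single α v)) =
      (m.symbol 1 α u * m.symbol 1 α w) ⊗ₜ Pi.single α v -
      ∑ β, (m.B w (m.ν α β) • m.symbol 1 α u + m.B u (m.ν α β) • m.symbol 1 β w) ⊗ₜ[ℂ]
        (Pi.single β (𝒱.A β α v) : ∀ α, 𝒱.V α) +
      ∑ β, ∑ γ, (m.B u (m.ν α β) * m.B w (m.ν β γ)) • ((1 : DOp (PolyRing N)) ⊗ₜ[ℂ]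
        (Pi.single γ (𝒱.A γ β (𝒱.A β α v)) : ∀ α, 𝒱.V α)) := by
  rw [relMap_single, map_sub, map_sum, one_mul, relMap_single]
  have h : ∀ β, m.relMap 𝒱 1 w ((sgn 1 α β * m.B u (m.ν α β)) •
      ((1 : DOp (PolyRing N)) ⊗ₜ[ℂ] (Pi.single β (𝒱.A β α v) : ∀ α, 𝒱.V α))) =
      (m.B u (m.ν α β) • m.symbol 1 β w) ⊗ₜ Pi.single β (𝒱.A β α v) -
      ∑ γ, (m.B u (m.ν α β) * m.B w (m.ν β γ)) • ((1 : DOp (PolyRing N)) ⊗ₜ[ℂ]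
        (Pi.single γ (𝒱.A γ β (𝒱.A β α v)) : ∀ α, 𝒱.V α)) := by
    intro β
    rw [sgn_one, one_mul, LinearMap.map_smul_of_tower, relMap_single, one_mul, smul_sub,
      Finset.smul_sum, TensorProduct.smul_tmul']
    simp only [sgn_one, one_mul, smul_smul]
  rw [Finset.sum_congr rfl fun β _ => h β]
  simp only [sgn_one, one_mul, Finset.sum_sub_distrib, TensorProduct.add_tmul,
    Finset.sum_add_distrib, TensorProduct.smul_tmul']
  abel

/-- The terms quadratic in the quiver maps: their antisymmetrization in `u` and `w` is
`sum_wedge_smul`. -/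
theorem sum_sum_swap (u w : Fin N → ℂ) (α : C.Vertex) (v : 𝒱.V α) :
    ∑ β, ∑ γ, (m.B u (m.ν α β) * m.B w (m.ν β γ)) •
        (Pi.single γ (𝒱.A γ β (𝒱.A β α v)) : ∀ α, 𝒱.V α) =
      ∑ β, ∑ γ, (m.B w (m.ν α β) * m.B u (m.ν β γ)) •
        (Pi.single γ (𝒱.A γ β (𝒱.A β α v)) : ∀ α, 𝒱.V α) := by
  rw [Finset.sum_comm, Finset.sum_comm (f := fun β γ => (m.B w (m.ν α β) * m.B u (m.ν β γ)) •
        (Pi.single γ (𝒱.A γ β (𝒱.A β α v)) : ∀ α, 𝒱.V α))]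
  refine Finset.sum_congr rfl fun γ _ => ?_
  have h := congrArg (fun f => (LinearMap.single ℂ 𝒱.V γ) (f v)) (m.sum_wedge_smul 𝒱 u w α γ)
  simp only [LinearMap.sum_apply, map_sum, LinearMap.smul_apply, map_smul, LinearMap.zero_apply,
    map_zero] at h
  rw [← sub_eq_zero, ← Finset.sum_sub_distrib, ← h]
  exact Finset.sum_congr rfl fun β _ => (sub_smul _ _ _).symm

theorem relMap_relMap_comm (u w : Fin N → ℂ) (α : C.Vertex) (v : 𝒱.V α) :
    m.relMap 𝒱 1 w (m.relMap 𝒱 1 u (1 ⊗ₜ Pi.single α v)) =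
      m.relMap 𝒱 1 u (m.relMap 𝒱 1 w (1 ⊗ₜ Pi.single α v)) := by
  rw [relMap_relMap, relMap_relMap, (m.symbol_commute 1 α w u).eq]
  have h1 : ∀ β, (m.B w (m.ν α β) • m.symbol 1 α u + m.B u (m.ν α β) • m.symbol 1 β w) ⊗ₜ[ℂ]
        (Pi.single β (𝒱.A β α v) : ∀ α, 𝒱.V α) =
      (m.B u (m.ν α β) • m.symbol 1 α w + m.B w (m.ν α β) • m.symbol 1 β u) ⊗ₜ[ℂ]
        (Pi.single β (𝒱.A β α v) : ∀ α, 𝒱.V α) := by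
    intro β
    by_cases h : Succ α β ∨ Succ β α
    · rw [m.symbol_exchange h]
    · rw [not_or] at h
      rw [𝒱.A_eq_zero β α h.2 h.1, LinearMap.zero_apply, Pi.single_zero, TensorProduct.tmul_zero,
        TensorProduct.tmul_zero]
  have h2 := congrArg (fun z => (1 : DOp (PolyRing N)) ⊗ₜ[ℂ] z) (m.sum_sum_swap 𝒱 u w α v)
  simp only [TensorProduct.tmul_sum, TensorProduct.tmul_smul] at h2
  rw [Finset.sum_congr rfl fun β _ => h1 β, h2]

theorem relMap_commute (u w : Fin N → ℂ) : Commute (m.relMap 𝒱 1 u) (m.relMap 𝒱 1 w) :=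
  have h : m.relMap 𝒱 1 u ∘ₗ m.relMap 𝒱 1 w = m.relMap 𝒱 1 w ∘ₗ m.relMap 𝒱 1 u :=
    pi_tensor_hom_ext fun α v => by
      rw [LinearMap.comp_apply, LinearMap.comp_apply]
      exact m.relMap_relMap_comm 𝒱 w u α v
  h

/-- The symbols mix functions and derivations differently at each stratum. In the polarization by
`xᵢ` and `sB(a,·) - ∂_a` they nevertheless share the leading term `xᵢ`, independently of the
stratum. -/
theorem relMap_isRegularFamily {s : ℂ} (hs : s * s = 1)
    (hcomm : ∀ i k, Commute (m.relMap 𝒱 s (m.dualVec i)) (m.relMap 𝒱 s (m.dualVec k))) :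
    IsRegularFamily fun i => m.relMap 𝒱 s (m.dualVec i) := by
  obtain ⟨j, hj, hskew, hbij⟩ := exists_gauged_normalOrder
    (S := Matrix.of fun i k => s * m.B (Pi.single i 1) (Pi.single k 1))
    (fun i k => by rw [Matrix.of_apply, Matrix.of_apply, m.symm])
  have hgauge : ∀ a : Fin N → ℂ, j (∑ k, a k • MvPolynomial.X k) =
      s • DOp.fn (m.linPoly a) - dirVf a := by
    intro a
    rw [map_sum, dirVf_eq_sum, fn_linPoly]
    simp only [map_smul, hj, gaugedPd, smul_sub, Finset.sum_sub_distrib, Matrix.of_apply,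
      Finset.smul_sum, smul_smul]
    rw [Finset.sum_comm]
    congr 1
    refine Finset.sum_congr rfl fun l _ => ?_
    rw [← Finset.sum_smul]
    congr 1
    have ha : a = ∑ k, a k • Pi.single k (1 : ℂ) := by
      conv_lhs => rw [← Finset.univ_sum_single a]
      refine Finset.sum_congr rfl fun k _ => ?_
      rw [← Pi.single_smul, smul_eq_mul, mul_one]
    have h := congrArg (fun z => m.B z (Pi.single l 1)) ha
    simp only [map_sum, map_smul, LinearMap.sum_apply, LinearMap.smul_apply, smul_eq_mul] at h
    rw [h, Finset.mul_sum]
    exact Finset.sum_congr rfl fun k _ => mul_left_comm _ _ _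
  -- With `a` the projection of the dual vector and `b` the base point term, the symbol is `xᵢ -
  -- B(a,·) + s ∂_a - b = xᵢ - s (sB(a,·) - ∂_a) - b`; the equality uses `s² = 1`.
  have hsymbol : ∀ i α, ∃ g, m.symbol s α (m.dualVec i) = DOp.fn (MvPolynomial.X i) + j g := by
    intro i α
    refine ⟨-s • (∑ k, m.pr α (m.dualVec i) k • MvPolynomial.X k) -
      MvPolynomial.C (m.B (m.dualVec i) (m.pt α)), ?_⟩
    generalize hb : m.B (m.dualVec i) (m.pt α) = b
    generalize ha : m.pr α (m.dualVec i) = a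
    have h1 : j (-s • (∑ k, a k • MvPolynomial.X k) - MvPolynomial.C b) =
        -DOp.fn (m.linPoly a) + s • dirVf a - b • 1 := by
      rw [map_sub j, map_smul j, hgauge, show j (MvPolynomial.C b) = algebraMap ℂ _ b from
        j.commutes b, Algebra.algebraMap_eq_smul_one, smul_sub, smul_smul, neg_mul, hs, neg_smul,
        neg_smul, one_smul, sub_neg_eq_add]
    have h2 : DOp.fn (m.linPoly (m.dualVec i - a)) =
        DOp.fn (MvPolynomial.X i) - DOp.fn (m.linPoly a) := by
      rw [map_sub, linPoly_dualVec]
      exact (DOp.fnHom (PolyRing N)).map_sub _ _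
    rw [symbol_apply, ha, hb, h1, h2]
    abel
  refine isRegularFamily_of_normalOrder hskew hbij hcomm fun i x => ?_
  choose g hg using hsymbol
  have hsingle : ∀ α (v : 𝒱.V α), ∃ y : PolyRing N ⊗[ℂ] (∀ α, 𝒱.V α),
      m.relMap 𝒱 s (m.dualVec i) (1 ⊗ₜ Pi.single α v) =
      DOp.fn (MvPolynomial.X i) ⊗ₜ Pi.single α v +
        TensorProduct.map j.toLinearMap LinearMap.id y := by
    intro α v
    refine ⟨g i α ⊗ₜ Pi.single α v - ∑ β, (sgn s α β * m.B (m.dualVec i) (m.ν α β)) •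
      (1 ⊗ₜ[ℂ] (Pi.single β (𝒱.A β α v) : ∀ α, 𝒱.V α)), ?_⟩
    rw [relMap_single, one_mul, hg, map_sub, map_sum, TensorProduct.add_tmul, add_sub_assoc]
    simp only [map_smul, TensorProduct.map_tmul, LinearMap.id_apply, AlgHom.toLinearMap_apply,
      map_one]
  choose y hy using hsingle
  refine ⟨∑ α, y α (x α), ?_⟩
  have h1 : m.relMap 𝒱 s (m.dualVec i) (1 ⊗ₜ x) =
      ∑ α, m.relMap 𝒱 s (m.dualVec i) (1 ⊗ₜ Pi.single α (x α)) := by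
    rw [← map_sum, ← TensorProduct.tmul_sum, Finset.univ_sum_single]
  have h2 : DOp.fn (MvPolynomial.X i : PolyRing N) ⊗ₜ[ℂ] x =
      ∑ α, DOp.fn (MvPolynomial.X i : PolyRing N) ⊗ₜ[ℂ] (Pi.single α (x α) : ∀ α, 𝒱.V α) := by
    rw [← TensorProduct.tmul_sum, Finset.univ_sum_single]
  rw [h1, h2, map_sum, ← Finset.sum_add_distrib]
  exact Finset.sum_congr rfl fun α _ => hy α (x α)

end Frame

end QuiverDuality

end Arrangement
end QuiverDMod

/-! ### Comparison with the dual quiver and conclusion. -/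

namespace QuiverDMod

namespace Arrangement

noncomputable section QuiverDuality

variable {N : ℕ} {C : Arrangement N}

/-- The signed identification of the dual of a graded space with the product of the duals of its
summands. -/
def signedDual (V : C.Vertex → Type) [∀ α, AddCommGroup (V α)] [∀ α, Module ℂ (V α)] :
    (∀ α, Dual ℂ (V α)) ≃ₗ[ℂ] Dual ℂ (∀ α, V α) :=
  (LinearEquiv.piCongrRight fun α => LinearEquiv.smulOfNeZero ℂ (Dual ℂ (V α)) ((-1) ^ level α)
    (pow_ne_zero _ (neg_ne_zero.2 one_ne_zero))) ≪≫ₗ LinearMap.lsum ℂ V ℂ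

theorem signedDual_apply (V : C.Vertex → Type) [∀ α, AddCommGroup (V α)] [∀ α, Module ℂ (V α)]
    (l : ∀ α, Dual ℂ (V α)) (u : ∀ α, V α) :
    signedDual V l u = ∑ α, (-1) ^ level α * l α (u α) := by
  simp [signedDual, LinearMap.lsum_apply]

theorem signedDual_single (V : C.Vertex → Type) [∀ α, AddCommGroup (V α)]
    [∀ α, Module ℂ (V α)] (α : C.Vertex) (l : Dual ℂ (V α)) (u : ∀ α, V α) :
    signedDual V (Pi.single α l) u = (-1) ^ level α * l (u α) := by
  rw [signedDual_apply, Finset.sum_eq_single α, Pi.single_eq_same]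
  · intro β _ hne
    rw [Pi.single_eq_of_ne hne, LinearMap.zero_apply, mul_zero]
  · simp

theorem pi_tensor_induction {R : Type} [Ring R] [Algebra ℂ R] {ι : Type} [Fintype ι]
    [DecidableEq ι] {V : ι → Type} [∀ i, AddCommGroup (V i)] [∀ i, Module ℂ (V i)]
    {p : R ⊗[ℂ] (∀ i, V i) → Prop} (x : R ⊗[ℂ] (∀ i, V i))
    (zero : p 0) (add : ∀ x y, p x → p y → p (x + y))
    (single : ∀ d i v, p (d ⊗ₜ Pi.single i v)) : p x := by
  induction x using TensorProduct.induction_on with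
  | zero => exact zero
  | add x y hx hy => exact add x y hx hy
  | tmul d v =>
    rw [← Finset.univ_sum_single v, TensorProduct.tmul_sum]
    exact Finset.sum_induction _ p add zero fun i _ => single d i _

theorem dualPairing_add {O : Type} [CommRing O] [Algebra ℂ O] (c : Coordinates O N) {W : Type}
    [AddCommGroup W] [Module ℂ W] [FiniteDimensional ℂ W] (x y : DOp O ⊗[ℂ] Dual ℂ W)
    (p : DOp O ⊗[ℂ] W) : dualPairing c (x + y) p = dualPairing c x p + dualPairing c y p := by
  induction p using TensorProduct.induction_on with
  | zero => simp
  | add p q hp hq => rw [map_add, map_add, map_add, hp, hq, add_add_add_comm]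
  | tmul d w =>
    rw [dualPairing_tmul, dualPairing_tmul, dualPairing_tmul, map_add, LinearMap.add_apply,
      add_mul]

namespace Frame

variable (m : C.Frame) (𝒱 : C.GraphQuiver)

theorem transpose_dirVf (a : Fin N → ℂ) : (polyCoords N).transpose (dirVf a) = -dirVf a := by
  simp only [dirVf_eq_sum, map_sum, map_smul, Coordinates.transpose_pd, smul_neg,
    Finset.sum_neg_distrib]

theorem transpose_symbol (α : C.Vertex) (w : Fin N → ℂ) :
    (polyCoords N).transpose (m.symbol 1 α w) = m.symbol (-1) α w := by
  rw [symbol_apply, symbol_apply, map_sub, map_add, map_smul, map_smul, transpose_dirVf,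
    Coordinates.transpose_fn, Coordinates.transpose_one, one_smul, neg_smul, one_smul]

/-- The signed identification of the free modules over the dual quiver and over the dual space. -/
def dualFree : DOp (PolyRing N) ⊗[ℂ] (∀ α, 𝒱.dual.V α) ≃ₗ[DOp (PolyRing N)]
    DOp (PolyRing N) ⊗[ℂ] Dual ℂ (∀ α, 𝒱.V α) :=
  TensorProduct.AlgebraTensorModule.congr (LinearEquiv.refl _ _) (signedDual 𝒱.V)

/-- A vector of the dual quiver as a linear form. -/
def toDual {α : C.Vertex} (l : 𝒱.dual.V α) : Dual ℂ (𝒱.V α) := l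

theorem dualHomEquiv_dualFree (d : DOp (PolyRing N)) (α : C.Vertex) (l : 𝒱.dual.V α)
    (u : ∀ α, 𝒱.V α) :
    dualHomEquiv (∀ α, 𝒱.V α) (dualFree 𝒱 (d ⊗ₜ Pi.single α l)) u =
      ((-1) ^ level α * toDual 𝒱 l (u α)) • d :=
  (dualHomEquiv_tmul d (signedDual 𝒱.V (Pi.single α l)) u).trans
    (congrArg (· • d) (signedDual_single 𝒱.V α l u))

/-- Levels change by one along an edge, so on edges in either direction the product of `sgn (-1)`,
the ratio of level signs and `ε` is `1`. This is what the signs in `signedDual` are for. -/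
theorem sgn_mul_dual_A (α β : C.Vertex) (l : 𝒱.dual.V α) (v : 𝒱.V β) :
    sgn (-1) α β * ((-1) ^ level β * toDual 𝒱 (𝒱.dual.A β α l) v) =
      (-1) ^ level α * toDual 𝒱 l (𝒱.A α β v) := by
  have h0 : toDual 𝒱 (𝒱.dual.A β α l) v = eps α β * toDual 𝒱 l (𝒱.A α β v) := rfl
  rw [h0]
  by_cases h : Succ α β
  · rw [sgn, if_pos h, eps_down h, h.level_eq, pow_succ]
    ring
  · by_cases h' : Succ β α
    · rw [sgn, if_neg h, eps_up h', h'.level_eq, pow_succ]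
      ring
    · rw [𝒱.A_eq_zero α β h h', LinearMap.zero_apply, map_zero]
      ring

theorem dualHomEquiv_dualFree_relMap (w : Fin N → ℂ) (d : DOp (PolyRing N)) (α β : C.Vertex)
    (l : 𝒱.dual.V α) (v : 𝒱.V β) :
    dualHomEquiv (∀ α, 𝒱.V α)
        (dualFree 𝒱 (m.relMap 𝒱.dual (-1) w (d ⊗ₜ Pi.single α l)))
        (Pi.single β v) =
      ((-1) ^ level α * toDual 𝒱 l ((Pi.single β v : ∀ α, 𝒱.V α) α)) • (d * m.symbol (-1) α w) -
        (m.B w (m.ν α β) * ((-1) ^ level α * toDual 𝒱 l (𝒱.A α β v))) • d := by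
  have hr : ∀ (r : ℂ) (x : DOp (PolyRing N) ⊗[ℂ] (∀ α, 𝒱.dual.V α)),
      dualFree 𝒱 (r • x) = r • dualFree 𝒱 x := fun r x =>
    LinearMap.map_smul_of_tower (dualFree 𝒱).toLinearMap r x
  rw [relMap_single, map_sub, map_sub, map_sum, map_sum, LinearMap.sub_apply,
    LinearMap.sum_apply, dualHomEquiv_dualFree, Finset.sum_eq_single β]
  · rw [hr, map_smul, LinearMap.smul_apply, dualHomEquiv_dualFree, Pi.single_eq_same, smul_smul,
      mul_right_comm, sgn_mul_dual_A, mul_comm (m.B w _)]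
  · intro γ _ hne
    rw [hr, map_smul, LinearMap.smul_apply, dualHomEquiv_dualFree, Pi.single_eq_of_ne hne,
      map_zero, mul_zero, zero_smul, smul_zero]
  · simp

theorem dualPairing_dualFree_relMap (w : Fin N → ℂ) (d : DOp (PolyRing N)) (α β : C.Vertex)
    (l : 𝒱.dual.V α) (v : 𝒱.V β) :
    dualPairing (polyCoords N) (dualFree 𝒱 (d ⊗ₜ Pi.single α l))
        (m.relMap 𝒱 1 w (1 ⊗ₜ Pi.single β v)) =
      ((-1) ^ level α * toDual 𝒱 l ((Pi.single β v : ∀ α, 𝒱.V α) α)) • (d * m.symbol (-1) β w) -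
        (m.B w (m.ν α β) * ((-1) ^ level α * toDual 𝒱 l (𝒱.A α β v))) • d := by
  rw [relMap_single, map_sub, map_sum, one_mul, dualPairing_tmul, dualHomEquiv_dualFree,
    transpose_symbol, smul_mul_assoc, Finset.sum_eq_single α]
  · rw [map_smul, dualPairing_tmul, dualHomEquiv_dualFree, Pi.single_eq_same, smul_mul_assoc,
      Coordinates.transpose_one, mul_one, smul_smul, sgn_one, one_mul, m.ν_symm β α]
  · intro γ _ hne
    rw [map_smul, dualPairing_tmul, dualHomEquiv_dualFree, Pi.single_eq_of_ne hne.symm,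
      map_zero, mul_zero, zero_smul, zero_mul, smul_zero]
  · simp

/-- The relations of the dual quiver on the free module over the dual space. -/
def dualRel (w : Fin N → ℂ) : DOp (PolyRing N) ⊗[ℂ] Dual ℂ (∀ α, 𝒱.V α) →ₗ[DOp (PolyRing N)]
    DOp (PolyRing N) ⊗[ℂ] Dual ℂ (∀ α, 𝒱.V α) :=
  (dualFree 𝒱).toLinearMap ∘ₗ m.relMap 𝒱.dual (-1) w ∘ₗ (dualFree 𝒱).symm.toLinearMap

theorem dualFree_relMap (w : Fin N → ℂ) (x) :
    dualFree 𝒱 (m.relMap 𝒱.dual (-1) w x) = m.dualRel 𝒱 w (dualFree 𝒱 x) := by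
  rw [dualRel, LinearMap.comp_apply, LinearMap.comp_apply, LinearEquiv.coe_coe,
    LinearEquiv.coe_coe, LinearEquiv.symm_apply_apply]

/-- Transposition turns the symbol for `s = 1` into the one for `s = -1`, and the signed
identification turns the adjoint quiver maps into those of the dual quiver. Symbols act diagonally
in the strata, so only `α = β` contributes to that part. -/
theorem relMap_isTranspose (w : Fin N → ℂ) :
    IsTranspose (polyCoords N) (m.relMap 𝒱 1 w) (m.dualRel 𝒱 w) := by
  intro x u
  obtain ⟨x, rfl⟩ := (dualFree 𝒱).surjective x
  rw [← dualFree_relMap, ← Finset.univ_sum_single u, TensorProduct.tmul_sum, map_sum, map_sum,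
    map_sum]
  refine Finset.sum_congr rfl fun β _ => ?_
  induction x using pi_tensor_induction with
  | zero =>
    have h := dualPairing_add (polyCoords N) (W := ∀ α, 𝒱.V α) 0 0
      (m.relMap 𝒱 1 w (1 ⊗ₜ Pi.single β (u β)))
    rw [add_zero, left_eq_add] at h
    rw [map_zero, map_zero, map_zero, LinearMap.zero_apply, h]
  | add x y hx hy =>
    rw [map_add, map_add, map_add, LinearMap.add_apply, hx, hy, map_add, dualPairing_add]
  | single d α l =>
    refine (m.dualHomEquiv_dualFree_relMap 𝒱 w d α β l (u β)).trans
      (Eq.trans ?_ (m.dualPairing_dualFree_relMap 𝒱 w d α β l (u β)).symm)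
    rcases eq_or_ne α β with rfl | hne
    · rfl
    · rw [Pi.single_eq_of_ne hne, map_zero, mul_zero, zero_smul, zero_smul]

/-- Commutativity was computed for `s = 1` only; for `s = -1` it is inherited by transposition. -/
theorem relMap_dual_commute (i k : Fin N) :
    Commute (m.relMap 𝒱.dual (-1) (m.dualVec i)) (m.relMap 𝒱.dual (-1) (m.dualVec k)) := by
  have h := commute_of_isTranspose (fun i => m.relMap_isTranspose 𝒱 (m.dualVec i))
    (fun i k => m.relMap_commute 𝒱 (m.dualVec i) (m.dualVec k)) i k
  refine LinearMap.ext fun x => (dualFree 𝒱).injective ?_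
  have h1 := congrArg (fun f => f (dualFree 𝒱 x)) h.eq
  simp only [Module.End.mul_apply, ← dualFree_relMap] at h1
  exact h1

end Frame

theorem RHomDTilde_graphQuiver (φ : C.EdgeFraming) (𝒱 : C.GraphQuiver) :
    Nonempty (RHomDTilde (PolyRing N) N N (𝒱.E φ) ≅
      ModuleCat.of (DOp (PolyRing N)) (𝒱.dual.E φ)) ∧
      ∀ i : ℕ, i ≠ N → Limits.IsZero (RHomDTilde (PolyRing N) N i (𝒱.E φ)) := by
  obtain ⟨m⟩ := C.nonempty_frame
  obtain ⟨e⟩ := m.exists_equiv_E 𝒱 φ one_ne_zero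
  obtain ⟨e'⟩ := m.exists_equiv_E 𝒱.dual φ (neg_ne_zero.2 one_ne_zero)
  have hc := fun i k => m.relMap_commute 𝒱 (m.dualVec i) (m.dualVec k)
  have ht := fun i => m.relMap_isTranspose 𝒱 (m.dualVec i)
  have hreg' := (m.relMap_isRegularFamily 𝒱.dual (by norm_num)
    fun i k => m.relMap_dual_commute 𝒱 i k).of_equiv
      (Frame.dualFree 𝒱) fun i x => m.dualFree_relMap 𝒱 (m.dualVec i) x
  obtain ⟨⟨g⟩, h⟩ := RHomDTilde_of_isTranspose ht hc
    (m.relMap_isRegularFamily 𝒱 (one_mul 1) hc) hreg'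
  refine ⟨⟨RHomDTilde_congr N N e ≪≫ g ≪≫ LinearEquiv.toModuleIso
    ((Submodule.Quotient.equiv _ _ (Frame.dualFree 𝒱) ?_).symm.trans e'.symm)⟩,
    fun i hi => (h i hi).of_iso (RHomDTilde_congr N i e)⟩
  rw [← partialRange_all, ← partialRange_all]
  exact map_partialRange (Frame.dualFree 𝒱) (fun i x => m.dualFree_relMap 𝒱 (m.dualVec i) x) N

end QuiverDuality

end Arrangement
end QuiverDMod

theorem theorem4p12 (N : ℕ) (C : QuiverDMod.Arrangement N) :
    (∀ (φ : C.Equations) (𝒱 : C.LevelZeroQuiver),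
      Nonempty (QuiverDMod.RHomDTilde C.O0 N N (𝒱.E φ) ≅
        ModuleCat.of (QuiverDMod.DOp C.O0) (𝒱.dual.E φ)) ∧
      ∀ i : ℕ, i ≠ N → CategoryTheory.Limits.IsZero (QuiverDMod.RHomDTilde C.O0 N i (𝒱.E φ))) ∧
    (∀ (φ : C.EdgeFraming) (𝒱 : C.GraphQuiver),
      Nonempty (QuiverDMod.RHomDTilde (QuiverDMod.PolyRing N) N N (𝒱.E φ) ≅
        ModuleCat.of (QuiverDMod.DOp (QuiverDMod.PolyRing N)) (𝒱.dual.E φ)) ∧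
      ∀ i : ℕ, i ≠ N → CategoryTheory.Limits.IsZero (QuiverDMod.RHomDTilde (QuiverDMod.PolyRing N) N i (𝒱.E φ)))
    :=
  ⟨fun φ 𝒱 => QuiverDMod.Arrangement.RHomDTilde_levelZero φ 𝒱, fun φ 𝒱 =>
    QuiverDMod.Arrangement.RHomDTilde_graphQuiver φ 𝒱⟩
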